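/- A complex Gaussian vector is a random vector with the law of $A\mathbf v$, where $A$ is a complex matrix and $\mathbf v$ has i.i.d. standard complex Gaussian components (density $\frac1\pi e^{-|z|^2}$ on $\mathbb C$). Let $f:\mathbb R\to\mathbb C$ be a complex Gaussian stationary process: all its finite marginals are complex Gaussian vectors, and their laws are invariant under real shifts of time. Assume that $f$ has almost surely continuous sample paths, and let $r(t)=\mathbb E[f(t)\overline{f(0)}]$ be its covariance kernel, normalized by $r(0)=1$. Let $\rho$ be its spectral measure, i.e. the probability measure on $\mathbb R$ with $r(t)=\int_{\mathbb R}e^{-it\lambda}\,d\rho(\lambda)$ for all $t$. Assume that $f$ is non-degenerate, i.e. $\rho$ is not a single point mass, and that for some $\alpha>0$ $$\int_{\mathbb R}\lambda^2\log^{1+\alpha}(1+|\lambda|)\,d\rho(\lambda)<\infty .$$ Then almost surely $f$ is continuously differentiable and has no zeros on $\mathbb R$, and $r$ is twice continuously differentiable. Thus the winding $$\Delta(T)=\frac1{2i}\int_0^T\left[\frac{f'(t)}{f(t)}-\overline{\left(\frac{f'(t)}{f(t)}\right)}\right]dt$$ is well defined for every $T>0$, almost surely. With $R(x)=r'(x)/r(x)$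 for $r(x)\ne0$, define $K:\mathbb R\to\mathbb R$ by $$K(x)=\begin{cases}\frac12|r'(x)|^2, & |r(x)|=0\text{ or }1,\\[4pt] \dfrac{|r(x)|^2}{1-|r(x)|^2}\bigl(\operatorname{Im}\{R(x)-R(0)\}\bigr)^2-\dfrac12\log\left(\dfrac1{1-|r(x)|^2}\right)\operatorname{Re}\{R'(x)\}, & 0<|r(x)|<1.\end{cases}$$ Then $K$ is integrable on every compact subset of $\mathbb R$, and for every $T>0$ the random variable $\Delta(T)$ is square-integrable, with $$\mathbb E[\Delta(T)]=T\,\operatorname{Im} r'(0),\qquad \operatorname{Var}[\Delta(T)]=T\int_{-T}^{T}\left(1-\frac{|x|}{T}\right)K(x)\,dx .$$ -/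

import Mathlib

open MeasureTheory ProbabilityTheory

namespace GaussianWinding

noncomputable section

/-- The standard complex Gaussian law `𝒩_ℂ(0,1)`: density `π⁻¹ exp (-|z|²)` with respect to
Lebesgue measure on the plane. -/
def stdComplexGaussian : Measure ℂ :=
  volume.withDensity (fun z : ℂ => ENNReal.ofReal (Real.pi⁻¹ * Real.exp (-‖z‖ ^ 2)))

/-- A law `ν` on `ℂⁿ` is that of a (centred) complex Gaussian vector if it is the law of `A v`,
where `v` has i.i.d. `𝒩_ℂ(0,1)` components and `A` is an `n × m` complex matrix. -/
def IsComplexGaussianLaw {n : ℕ} (ν : Measure (Fin n → ℂ)) : Prop :=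
  ∃ (m : ℕ) (A : Matrix (Fin n) (Fin m) ℂ),
    ν = (Measure.pi (fun _ : Fin m => stdComplexGaussian)).map (fun v => A.mulVec v)

variable {Ω : Type*} [MeasurableSpace Ω]

/-- A complex Gaussian process indexed by `ℝ`: a family of random variables all of whose finite
marginals are complex Gaussian vectors. -/
structure IsComplexGaussianProcess (f : ℝ → Ω → ℂ) (P : Measure Ω) : Prop where
  measurable : ∀ t, Measurable (f t)
  gaussian : ∀ (n : ℕ) (t : Fin n → ℝ), IsComplexGaussianLaw (P.map (fun ω i => f (t i) ω))

/-- Stationarity: the finite-dimensional distributions are invariant under all real shifts. -/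
def IsStationary (f : ℝ → Ω → ℂ) (P : Measure Ω) : Prop :=
  ∀ (n : ℕ) (t : Fin n → ℝ) (s : ℝ),
    P.map (fun ω i => f (t i + s) ω) = P.map (fun ω i => f (t i) ω)

/-- The covariance kernel `r(t) = 𝔼[f(t) conj(f(0))]`. -/
def covKernel (f : ℝ → Ω → ℂ) (P : Measure Ω) (t : ℝ) : ℂ :=
  ∫ ω, f t ω * (starRingEnd ℂ) (f 0 ω) ∂P

/-- `ρ` is the spectral measure attached to the covariance kernel `r`: it is the probability
measure on `ℝ` with `r(t) = ∫ exp(-i t l) dρ(l)`. -/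
structure IsSpectralMeasure (ρ : Measure ℝ) (r : ℝ → ℂ) : Prop where
  isProbability : IsProbabilityMeasure ρ
  fourier : ∀ t : ℝ, r t = ∫ l : ℝ, Complex.exp (-Complex.I * (t : ℂ) * (l : ℂ)) ∂ρ

/-- The log-moment condition: `∫ l² log^{1+α}(1+|l|) dρ(l) < ∞` for some `α > 0`. -/
def LogMomentCondition (ρ : Measure ℝ) : Prop :=
  ∃ α : ℝ, 0 < α ∧ Integrable (fun l : ℝ => l ^ 2 * Real.log (1 + |l|) ^ (1 + α)) ρ

/-- The winding (increment of the argument) of the path `g` on `[0,T]`, as a real number. -/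
def winding (g : ℝ → ℂ) (T : ℝ) : ℝ :=
  ∫ t in (0 : ℝ)..T, (deriv g t / g t).im

/-- The winding is `(1/2i) ∫₀ᵀ [g'/g - conj (g'/g)] dt`. -/
theorem winding_eq (g : ℝ → ℂ) (T : ℝ) :
    (winding g T : ℂ) = 1 / (2 * Complex.I) *
      ∫ t in (0 : ℝ)..T, (deriv g t / g t - (starRingEnd ℂ) (deriv g t / g t)) := by
  simp only [Complex.sub_conj]
  rw [winding, ← intervalIntegral.integral_ofReal, ← intervalIntegral.integral_const_mul]
  congr 1
  funext t
  push_cast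
  field_simp

/-- `R = r'/r`. -/
def logDerivative (r : ℝ → ℂ) (x : ℝ) : ℂ := deriv r x / r x

/-- The variance kernel `K` built from the covariance kernel `r`. -/
def varKernel (r : ℝ → ℂ) (x : ℝ) : ℝ :=
  open Classical in
  if ‖r x‖ = 0 ∨ ‖r x‖ = 1 then (1 / 2 : ℝ) * ‖deriv r x‖ ^ 2
  else
    ‖r x‖ ^ 2 / (1 - ‖r x‖ ^ 2) * (logDerivative r x - logDerivative r 0).im ^ 2
      - (1 / 2 : ℝ) * Real.log (1 / (1 - ‖r x‖ ^ 2)) * (deriv (logDerivative r) x).re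

end

end GaussianWinding

/-! Put X(t) = f'(t) - i Im r'(0) f(t). Since r'(0) is purely imaginary, X(t) is uncorrelated with
f(t), hence independent of it, and Im(f'/f) = Im r'(0) + Φ with Φ(t) = Im(X(t)/f(t)). The
fluctuation Φ is centred, which gives the mean by Fubini. The variance is the integral over [0,T]²
of E[Φ(s)Φ(t)], so two facts carry the theorem: E[Φ(s)Φ(t)] = K(s-t) whenever |r(s-t)| < 1
(`integral_fluctuation_mul`), and a locally integrable bound on E|Φ(s)Φ(t)|
(`integrable_fluctuation_mul`). The factor T - |x| is the length of the slice s - t = x of the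
square.

Two-point function. For z = f(s), w = f(t), the variables X(s), X(t) are explicit multiples of the
residuals w - r̄z, z - rw plus noise independent of (z,w). Writing Im a Im b = ½ Re(a b̄ - ab)
leaves the means of w/z, 1/(z w̄) and w z̄/(z w̄) for a correlated pair. Given z, w is an affine
image of a standard Gaussian g; in polar coordinates the mean value property shows that only |g| <
|c| contributes to the mean of 1/(c+g), and a Frullani integral over |z| then produces
log(1/(1-|r|²)). The algebra collapses to K (`twoPoint_eq`).

Bound. Young's inequality separates tenth Gaussian moments from E(|z||w|)^(-5/4), and the latter is
at most a constant times (1-|r|²)^(-3/8). If |r(x)| = 1 then |r(x+t)| = |r(t)| for all t, and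
non-degeneracy of ρ gives 1-|r(t)|² ≥ ct² near 0. The singularities are therefore isolated and of
order |t|^(-3/4). As K is itself a two-point function, the same bound makes K locally integrable.

Paths. Slopes of f are compared on grids of mesh 2^(-2^n). The logarithm of the mesh is geometric in
n, so the log-moment condition makes the variances of slope differences decay like 2^(-n(1+α));
Gaussian tails beat the number of cells, and Borel–Cantelli gives uniform convergence of the slopes,
hence C¹ paths. Absence of zeros is Bulinskaya's argument: a small disc in ℂ has probability of
order ε², against 1/ε grid points. All variables, f' included, live in a space of circular Gaussian
variables that is stable under pointwise limits, where zero covariance means independence. -/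

namespace GaussianWinding

open Set Filter Topology

/-! ### The standard complex Gaussian law: moments, characteristic function, small balls, tails. -/

section

/-- The density of the standard complex Gaussian law, with values in `ℝ`. -/
noncomputable def gaussDensity (z : ℂ) : ℝ := Real.pi⁻¹ * Real.exp (-‖z‖ ^ 2)

lemma gaussDensity_nonneg (z : ℂ) : 0 ≤ gaussDensity z := by
  unfold gaussDensity; positivity

lemma continuous_gaussDensity : Continuous gaussDensity := by
  unfold gaussDensity; fun_prop

section
variable {E : Type*} [NormedAddCommGroup E] [NormedSpace ℝ E]

lemma integral_stdComplexGaussian (h : ℂ → E) :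
    ∫ z, h z ∂stdComplexGaussian = ∫ z, gaussDensity z • h z := by
  have := integral_withDensity_eq_integral_toReal_smul (μ := (volume : Measure ℂ))
    (f := fun z => ENNReal.ofReal (gaussDensity z))
    (continuous_gaussDensity.measurable.ennreal_ofReal) (by simp) h
  simp only [ENNReal.toReal_ofReal (gaussDensity_nonneg _)] at this
  exact this

lemma integrable_stdComplexGaussian_iff (h : ℂ → E) :
    Integrable h stdComplexGaussian ↔ Integrable (fun z => gaussDensity z • h z) := by
  have := integrable_withDensity_iff_integrable_smul' (μ := (volume : Measure ℂ))
    (f := fun z => ENNReal.ofReal (gaussDensity z)) (g := h)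
    (continuous_gaussDensity.measurable.ennreal_ofReal) (by simp)
  simp only [ENNReal.toReal_ofReal (gaussDensity_nonneg _)] at this
  exact this

end

lemma integral_norm_rpow_stdComplexGaussian {q : ℝ} (hq : -2 < q) :
    ∫ z : ℂ, ‖z‖ ^ q ∂stdComplexGaussian = Real.Gamma ((q + 2) / 2) := by
  rw [integral_stdComplexGaussian]
  have h := Complex.integral_rpow_mul_exp_neg_rpow (p := 2) one_le_two hq
  have : ∀ z : ℂ, gaussDensity z • ‖z‖ ^ q =
      Real.pi⁻¹ * (‖z‖ ^ q * Real.exp (-‖z‖ ^ (2 : ℝ))) := fun z => by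
    simp only [gaussDensity, smul_eq_mul, Real.rpow_two]; ring
  simp_rw [this]
  rw [integral_const_mul, h]
  field_simp

/-- The Bochner integral of a non-integrable function is 0, whereas the moment formula returns a
positive value of Γ; integrability follows from the formula. -/
lemma integrable_norm_rpow_stdComplexGaussian {q : ℝ} (hq : -2 < q) :
    Integrable (fun z : ℂ => ‖z‖ ^ q) stdComplexGaussian := by
  by_contra h
  have h1 := integral_norm_rpow_stdComplexGaussian hq
  rw [integral_undef h] at h1
  exact (Real.Gamma_pos_of_pos (by linarith : 0 < (q + 2) / 2)).ne h1

instance isProbabilityMeasure_stdComplexGaussian : IsProbabilityMeasure stdComplexGaussian := by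
  have h1 : Integrable (fun _ : ℂ => (1 : ℝ)) stdComplexGaussian := by
    simpa using integrable_norm_rpow_stdComplexGaussian (q := 0) (by norm_num)
  have h2 := integral_norm_rpow_stdComplexGaussian (q := 0) (by norm_num)
  have : IsFiniteMeasure stdComplexGaussian := by
    rcases integrable_const_iff.1 h1 with h | h
    · exact absurd h one_ne_zero
    · exact h
  constructor
  simp [measureReal_def] at h2
  rwa [ENNReal.toReal_eq_one_iff] at h2

lemma charFun_stdComplexGaussian (c : ℂ) :
    charFun stdComplexGaussian c = Complex.exp (-(‖c‖ ^ 2 / 4 : ℝ)) := by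
  rw [charFun_apply, integral_stdComplexGaussian]
  have h := GaussianFourier.integral_cexp_neg_mul_sq_norm_add (V := ℂ) (b := 1) (by simp)
    Complex.I c
  have : ∀ z : ℂ, gaussDensity z • Complex.exp (inner ℝ z c * Complex.I) =
      (Real.pi : ℂ)⁻¹ * Complex.exp (-1 * ‖z‖ ^ 2 + Complex.I * inner ℝ c z) := fun z => by
    rw [Complex.exp_add, real_inner_comm, Complex.real_smul, gaussDensity]
    push_cast
    rw [mul_comm Complex.I, mul_assoc, neg_one_mul]
  simp_rw [this]
  rw [integral_const_mul, h, Complex.finrank_real_complex]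
  simp only [div_one, Nat.cast_ofNat, ne_eq, OfNat.ofNat_ne_zero, not_false_eq_true, div_self,
    Complex.cpow_one, Complex.I_sq]
  rw [← mul_assoc, inv_mul_cancel₀ (by exact_mod_cast Real.pi_ne_zero), one_mul]
  push_cast
  congr 1
  ring

lemma stdComplexGaussian_absolutelyContinuous : stdComplexGaussian ≪ volume :=
  withDensity_absolutelyContinuous _ _

lemma ae_ne_zero_stdComplexGaussian : ∀ᵐ z ∂stdComplexGaussian, z ≠ 0 :=
  stdComplexGaussian_absolutelyContinuous.ae_le (Measure.ae_ne volume 0)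

/-- The density is at most 1/π and the disc has area πε². The exponent 2, against a number of grid
points linear in 1/ε, is what rules out zeros of the paths. -/
lemma stdComplexGaussian_closedBall_le {ε : ℝ} (hε : 0 ≤ ε) :
    stdComplexGaussian (Metric.closedBall 0 ε) ≤ ENNReal.ofReal (ε ^ 2) := by
  have : stdComplexGaussian (Metric.closedBall 0 ε) ≤
      ENNReal.ofReal Real.pi⁻¹ * volume (Metric.closedBall (0 : ℂ) ε) := by
    rw [stdComplexGaussian, withDensity_apply _ measurableSet_closedBall,
      ← setLIntegral_const]
    refine lintegral_mono fun z => ENNReal.ofReal_le_ofReal ?_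
    have : Real.exp (-‖z‖ ^ 2) ≤ 1 := Real.exp_le_one_iff.2 (by nlinarith [sq_nonneg ‖z‖])
    nlinarith [inv_pos.2 Real.pi_pos]
  refine this.trans (le_of_eq ?_)
  rw [Complex.volume_closedBall, ← ENNReal.ofReal_pow hε, ← ENNReal.ofReal_coe_nnreal,
    ← ENNReal.ofReal_mul (by positivity), ← ENNReal.ofReal_mul (by positivity)]
  congr 1
  simp only [NNReal.coe_real_pi]
  field_simp

lemma integral_exp_half_sq_stdComplexGaussian :
    Integrable (fun z : ℂ => Real.exp (‖z‖ ^ 2 / 2)) stdComplexGaussian ∧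
    ∫ z : ℂ, Real.exp (‖z‖ ^ 2 / 2) ∂stdComplexGaussian = 2 := by
  have key : ∫ z : ℂ, Real.exp (‖z‖ ^ 2 / 2) ∂stdComplexGaussian = 2 := by
    rw [integral_stdComplexGaussian]
    have h := Complex.integral_rpow_mul_exp_neg_mul_rpow (p := 2) (q := 0) (b := 1 / 2)
      one_le_two (by norm_num) (by norm_num)
    have : ∀ z : ℂ, gaussDensity z • Real.exp (‖z‖ ^ 2 / 2) =
        Real.pi⁻¹ * (‖z‖ ^ (0 : ℝ) * Real.exp (-(1 / 2) * ‖z‖ ^ (2 : ℝ))) := fun z => by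
      simp only [gaussDensity, smul_eq_mul, Real.rpow_two, Real.rpow_zero, one_mul]
      rw [mul_assoc, ← Real.exp_add]
      congr 2; ring
    simp_rw [this]
    rw [integral_const_mul, h]
    norm_num [Real.rpow_neg_one]
  refine ⟨?_, key⟩
  by_contra h
  rw [integral_undef h] at key
  norm_num at key

/-- Markov's inequality for exp(|z|²/2), whose mean is 2. The loss against the exact tail exp(-x²)
is harmless. -/
lemma stdComplexGaussian_real_tail_le {x : ℝ} (hx : 0 ≤ x) :
    stdComplexGaussian.real {z | x ≤ ‖z‖} ≤ 2 * Real.exp (-(x ^ 2 / 2)) := by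
  obtain ⟨hi, he⟩ := integral_exp_half_sq_stdComplexGaussian
  have h := mul_meas_ge_le_integral_of_nonneg (μ := stdComplexGaussian)
    (f := fun z : ℂ => Real.exp (‖z‖ ^ 2 / 2))
    (Eventually.of_forall fun z => (Real.exp_pos _).le) hi (Real.exp (x ^ 2 / 2))
  rw [he] at h
  have hs : stdComplexGaussian.real {z | x ≤ ‖z‖} ≤
      stdComplexGaussian.real {z : ℂ | Real.exp (x ^ 2 / 2) ≤ Real.exp (‖z‖ ^ 2 / 2)} := by
    refine measureReal_mono fun z hz => ?_
    simp only [mem_ofPred_eq] at hz ⊢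
    gcongr
  rw [Real.exp_neg, ← div_eq_mul_inv, le_div_iff₀ (Real.exp_pos _), mul_comm]
  exact (mul_le_mul_of_nonneg_left hs (Real.exp_pos _).le).trans h

end

/-! ### Means of 1/(c+g) and of conj(c+g)/(c+g) for a standard Gaussian g. -/

section

lemma circleAverage_inv_add_of_lt {c : ℂ} {ρ : ℝ} (hρ : 0 < ρ) (h : ρ < ‖c‖) :
    Real.circleAverage (fun z => (c + z)⁻¹) 0 ρ = c⁻¹ := by
  have hd : DiffContOnCl ℂ (fun z : ℂ => (c + z)⁻¹) (Metric.ball 0 |ρ|) := by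
    refine DifferentiableOn.diffContOnCl fun z hz => ?_
    rw [closure_ball _ (abs_pos.2 hρ.ne').ne', mem_closedBall_zero_iff, abs_of_pos hρ] at hz
    refine DifferentiableAt.differentiableWithinAt ?_
    refine ((differentiableAt_const _).add differentiableAt_id).inv fun h0 => ?_
    have : ‖c‖ = ‖z‖ := by rw [eq_neg_of_add_eq_zero_left h0]; simp
    linarith
  rw [hd.circleAverage, add_zero]

lemma circleAverage_inv {ρ : ℝ} (hρ : 0 < ρ) :
    Real.circleAverage (fun z : ℂ => z⁻¹) 0 ρ = 0 := by
  rw [Real.circleAverage_eq_circleIntegral hρ.ne']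
  have := circleIntegral.integral_sub_zpow_of_ne (n := -2) (by norm_num) 0 0 ρ
  have h2 : ∀ z : ℂ, (z - 0)⁻¹ • z⁻¹ = (z - 0) ^ (-2 : ℤ) := fun z => by
    rw [sub_zero, smul_eq_mul, ← mul_inv, ← sq, zpow_neg]; norm_cast
  simp_rw [h2]
  rw [this, smul_zero]

/-- By partial fractions the contour integrand is c⁻¹(1/z - 1/(z+c)). Both poles lie inside the
circle and their residues cancel. -/
lemma circleAverage_inv_add_of_gt {c : ℂ} {ρ : ℝ} (hc : c ≠ 0) (h : ‖c‖ < ρ) :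
    Real.circleAverage (fun z => (c + z)⁻¹) 0 ρ = 0 := by
  have hρ : 0 < ρ := (norm_nonneg c).trans_lt h
  rw [Real.circleAverage_eq_circleIntegral hρ.ne']
  have h1 : (∮ z in C(0, ρ), (z - 0)⁻¹ • (c + z)⁻¹) =
      ∮ z in C(0, ρ), c⁻¹ • ((z - 0)⁻¹ - (z - (-c))⁻¹) := by
    refine circleIntegral.integral_congr hρ.le fun z hz => ?_
    rw [mem_sphere_zero_iff_norm] at hz
    have hz0 : z ≠ 0 := by rintro rfl; simp at hz; linarith
    have hz1 : c + z ≠ 0 := fun h0 => by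
      have : ‖c‖ = ‖z‖ := by rw [eq_neg_of_add_eq_zero_left h0]; simp
      linarith
    have hz2 : z + c ≠ 0 := by rwa [add_comm]
    simp only [sub_zero, sub_neg_eq_add, smul_eq_mul]
    field_simp
    ring
  have hi : ∀ w ∈ Metric.ball (0 : ℂ) ρ, CircleIntegrable (fun z => (z - w)⁻¹) 0 ρ := by
    intro w hw
    rw [circleIntegrable_sub_inv_iff]
    right
    intro h3
    rw [mem_ball_zero_iff] at hw
    rw [mem_sphere_zero_iff_norm, abs_of_pos hρ] at h3
    linarith
  rw [h1, circleIntegral.integral_smul, circleIntegral.integral_sub (hi 0 (by simpa using hρ))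
    (hi (-c) (by simpa using h)), circleIntegral.integral_sub_inv_of_mem_ball (by simpa using hρ),
    circleIntegral.integral_sub_inv_of_mem_ball (by simpa using h)]
  simp

/-- On the circle z̄ = ρ²/z, so the integrand agrees there with a rational function; its partial
fractions are multiples of 1/(c+z) and 1/z. -/
lemma circleAverage_conj_div_add {c : ℂ} {ρ : ℝ} (hρ : 0 < ρ) (hc : c ≠ 0) (h : ρ ≠ ‖c‖) :
    Real.circleAverage (fun z => (starRingEnd ℂ) (c + z) / (c + z)) 0 ρ =
      ((starRingEnd ℂ) c - ρ ^ 2 / c) * Real.circleAverage (fun z => (c + z)⁻¹) 0 ρ := by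
  have hz0 : ∀ z ∈ Metric.sphere (0 : ℂ) |ρ|, c + z ≠ 0 := fun z hz h0 => by
    rw [mem_sphere_zero_iff_norm, abs_of_pos hρ] at hz
    have : ‖c‖ = ‖z‖ := by rw [eq_neg_of_add_eq_zero_left h0]; simp
    exact h (by rw [this, hz])
  have hz1 : ∀ z ∈ Metric.sphere (0 : ℂ) |ρ|, z ≠ 0 := fun z hz h0 => by
    rw [mem_sphere_zero_iff_norm, h0, norm_zero, abs_of_pos hρ] at hz
    linarith
  have h1 : EqOn (fun z => (starRingEnd ℂ) (c + z) / (c + z))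
      ((fun z => ((starRingEnd ℂ) c - ρ ^ 2 / c) • (c + z)⁻¹) + fun z => ((ρ : ℂ) ^ 2 / c) • z⁻¹)
      (Metric.sphere 0 |ρ|) := by
    intro z hz
    have h2 := hz0 z hz
    have h3 := hz1 z hz
    have h4 : (starRingEnd ℂ) z * z = ρ ^ 2 := by
      rw [mul_comm, Complex.mul_conj, Complex.normSq_eq_norm_sq]
      rw [mem_sphere_zero_iff_norm, abs_of_pos hρ] at hz
      rw [hz]; push_cast; rfl
    simp only [map_add, Pi.add_apply, smul_eq_mul]
    field_simp
    linear_combination c * h4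
  have hci1 : CircleIntegrable (fun z : ℂ => (c + z)⁻¹) 0 ρ := by
    refine ContinuousOn.circleIntegrable' ?_
    exact (continuousOn_const.add continuousOn_id).inv₀ hz0
  have hci2 : CircleIntegrable (fun z : ℂ => z⁻¹) 0 ρ := by
    refine ContinuousOn.circleIntegrable' ?_
    exact continuousOn_id.inv₀ hz1
  have hci1' : CircleIntegrable (fun z : ℂ => ((starRingEnd ℂ) c - ρ ^ 2 / c) • (c + z)⁻¹) 0 ρ :=
    hci1.const_smul
  have hci2' : CircleIntegrable (fun z : ℂ => ((ρ : ℂ) ^ 2 / c) • z⁻¹) 0 ρ := hci2.const_smul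
  rw [Real.circleAverage_congr_sphere h1, Real.circleAverage_add hci1' hci2',
    Real.circleAverage_fun_smul, Real.circleAverage_fun_smul, circleAverage_inv hρ]
  simp

lemma integral_stdComplexGaussian_radial {h : ℂ → ℂ} (hm : Measurable h)
    (hi : Integrable h stdComplexGaussian) :
    ∫ z, h z ∂stdComplexGaussian =
      ∫ ρ in Ioi (0 : ℝ), ((2 * ρ * Real.exp (-ρ ^ 2) : ℝ) : ℂ) * Real.circleAverage h 0 ρ := by
  set F : ℂ → ℂ := fun z => gaussDensity z • h z with hF
  have hFm : Measurable F := continuous_gaussDensity.measurable.smul hm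
  have hFi : Integrable F := (integrable_stdComplexGaussian_iff h).1 hi
  rw [integral_stdComplexGaussian, ← Complex.integral_comp_polarCoord_symm,
    polarCoord_target, Measure.volume_eq_prod, setIntegral_prod]
  · refine setIntegral_congr_fun measurableSet_Ioi fun ρ hρ => ?_
    have hρ' : 0 < ρ := hρ
    have e : ∀ θ : ℝ, ρ • gaussDensity (Complex.polarCoord.symm (ρ, θ)) •
        h (Complex.polarCoord.symm (ρ, θ)) =
        ((ρ * (Real.pi⁻¹ * Real.exp (-ρ ^ 2)) : ℝ) : ℂ) * h (circleMap 0 ρ θ) := fun θ => by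
      have : Complex.polarCoord.symm (ρ, θ) = circleMap 0 ρ θ := by
        simp [circleMap, Complex.exp_mul_I]
      rw [this, gaussDensity, smul_smul, Complex.real_smul]
      simp
    simp only [e]
    rw [integral_const_mul, Real.circleAverage_def, ← integral_Ioc_eq_integral_Ioo,
      ← intervalIntegral.integral_of_le (by linarith [Real.pi_pos])]
    -- The polar angle runs over (-π, π), the circle average over [0, 2π]; periodicity reconciles
    -- them.
    have hp : (fun θ => h (circleMap 0 ρ θ)).Periodic (2 * Real.pi) :=
      fun x => by simp [periodic_circleMap 0 ρ x]
    have := hp.intervalIntegral_add_eq (-Real.pi) 0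
    rw [show -Real.pi + 2 * Real.pi = Real.pi by ring, zero_add] at this
    rw [this, Complex.real_smul]
    push_cast
    have : (Real.pi : ℂ) ≠ 0 := by exact_mod_cast Real.pi_ne_zero
    field_simp
  · have hms : Measurable fun p : ℝ × ℝ => Complex.polarCoord.symm p := by
      simp only [Complex.polarCoord_symm_apply]; fun_prop
    refine ⟨(measurable_fst.smul (hFm.comp hms)).aestronglyMeasurable, ?_⟩
    rw [hasFiniteIntegral_iff_enorm]
    have h1 := Complex.lintegral_comp_polarCoord_symm (fun z => ‖F z‖ₑ)
    have h2 := hFi.2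
    rw [hasFiniteIntegral_iff_enorm, ← h1, polarCoord_target] at h2
    refine lt_of_le_of_lt (le_of_eq ?_) h2
    rw [← Measure.volume_eq_prod]
    refine setLIntegral_congr_fun (measurableSet_Ioi.prod measurableSet_Ioo) fun p hp => ?_
    have hp1 : (0 : ℝ) < p.1 := hp.1
    change ‖p.1 • F _‖ₑ = _
    rw [enorm_smul, smul_eq_mul, Real.enorm_eq_ofReal hp1.le]

/-- In the applications A is a family of circle averages and a is the distance of the pole from 0,
so larger circles contribute nothing. The circle through the pole is a single radius, hence null,
and needs no value. -/
lemma integral_indicator_gauss_radial {a : ℝ} (ha : 0 < a) (φ Ψ : ℝ → ℝ)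
    (hΨ : ∀ x, HasDerivAt Ψ (2 * x * Real.exp (-x ^ 2) * φ x) x) (hφ : Continuous φ)
    {A : ℝ → ℂ} {B : ℂ} (hA : ∀ ρ, 0 < ρ → ρ < a → A ρ = B * φ ρ)
    (hA' : ∀ ρ, a < ρ → A ρ = 0) :
    ∫ ρ in Ioi (0 : ℝ), ((2 * ρ * Real.exp (-ρ ^ 2) : ℝ) : ℂ) * A ρ = B * (Ψ a - Ψ 0 : ℝ) := by
  have h1 : ∫ ρ in Ioi (0 : ℝ), ((2 * ρ * Real.exp (-ρ ^ 2) : ℝ) : ℂ) * A ρ =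
      ∫ ρ in Ioi (0 : ℝ), (Iic a).indicator
        (fun ρ => B * ((2 * ρ * Real.exp (-ρ ^ 2) * φ ρ : ℝ) : ℂ)) ρ := by
    refine setIntegral_congr_ae measurableSet_Ioi ?_
    filter_upwards [Measure.ae_ne volume a] with ρ hρa hρ
    rcases lt_or_gt_of_ne hρa with h | h
    · rw [indicator_of_mem (show ρ ∈ Iic a from h.le), hA ρ hρ h]
      push_cast; ring
    · rw [indicator_of_notMem (by simpa using h), hA' ρ h, mul_zero]
  rw [h1, setIntegral_indicator measurableSet_Iic, Ioi_inter_Iic, integral_const_mul,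
    integral_complex_ofReal, ← intervalIntegral.integral_of_le ha.le]
  congr 2
  refine intervalIntegral.integral_eq_sub_of_hasDerivAt (fun x _ => hΨ x) ?_
  refine Continuous.intervalIntegrable ?_ _ _
  fun_prop

/-- Newton's theorem for the planar potential: only the Gaussian mass of the disc |g| < |c| acts, as
if concentrated at 0. -/
lemma integral_inv_add_stdComplexGaussian {c : ℂ} (hc : c ≠ 0)
    (hi : Integrable (fun g => (c + g)⁻¹) stdComplexGaussian) :
    ∫ g, (c + g)⁻¹ ∂stdComplexGaussian = ((1 - Real.exp (-‖c‖ ^ 2) : ℝ) : ℂ) / c := by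
  rw [integral_stdComplexGaussian_radial (by fun_prop) hi,
    integral_indicator_gauss_radial (norm_pos_iff.2 hc) (fun _ => 1) (fun x => -Real.exp (-x ^ 2))
      (B := c⁻¹) _ (by fun_prop)]
  · simp
    field_simp
    ring
  · intro ρ h1 h2
    rw [circleAverage_inv_add_of_lt h1 h2]; simp
  · intro ρ h1
    exact circleAverage_inv_add_of_gt hc h1
  · intro x
    have := (((hasDerivAt_id x).pow 2).neg.exp).neg
    convert! this using 1
    simp; ring

lemma norm_conj_div_self_le (w : ℂ) : ‖(starRingEnd ℂ) w / w‖ ≤ 1 := by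
  rw [norm_div, RCLike.norm_conj]
  exact div_self_le_one _

lemma integral_conj_div_add_stdComplexGaussian {c : ℂ} (hc : c ≠ 0) :
    ∫ g, (starRingEnd ℂ) (c + g) / (c + g) ∂stdComplexGaussian =
      (starRingEnd ℂ) c / c * ((1 - (1 - Real.exp (-‖c‖ ^ 2)) / ‖c‖ ^ 2 : ℝ) : ℂ) := by
  have hm : Measurable fun g : ℂ => (starRingEnd ℂ) (c + g) / (c + g) := by
    have : Measurable (starRingEnd ℂ) := Complex.continuous_conj.measurable
    fun_prop
  have hi : Integrable (fun g => (starRingEnd ℂ) (c + g) / (c + g)) stdComplexGaussian :=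
    Integrable.of_bound hm.aestronglyMeasurable 1 (ae_of_all _ fun g => norm_conj_div_self_le _)
  have hn : 0 < ‖c‖ := norm_pos_iff.2 hc
  have hcc : (starRingEnd ℂ) c = ‖c‖ ^ 2 / c := by
    rw [eq_div_iff hc, mul_comm, Complex.mul_conj, Complex.normSq_eq_norm_sq]; push_cast; rfl
  -- For ρ < |c| the circle average is (c̄ - ρ²/c)/c = (c̄/c)(1 - ρ²/|c|²), which dictates B and φ;
  -- the primitive Ψ comes from one integration by parts.
  rw [integral_stdComplexGaussian_radial hm hi,
    integral_indicator_gauss_radial hn (fun x => 1 - x ^ 2 / ‖c‖ ^ 2)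
      (fun x => -Real.exp (-x ^ 2) * (1 - x ^ 2 / ‖c‖ ^ 2) + Real.exp (-x ^ 2) / ‖c‖ ^ 2)
      (B := (starRingEnd ℂ) c / c) _ (by fun_prop)]
  · congr 2
    simp
    field_simp
    ring
  · intro ρ h1 h2
    rw [circleAverage_conj_div_add h1 hc h2.ne, circleAverage_inv_add_of_lt h1 h2, hcc]
    have : (‖c‖ : ℂ) ≠ 0 := by exact_mod_cast hn.ne'
    push_cast
    field_simp
  · intro ρ h1
    rw [circleAverage_conj_div_add (hn.trans h1) hc h1.ne', circleAverage_inv_add_of_gt hc h1,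
      mul_zero]
  · intro x
    have e := ((hasDerivAt_id x).pow 2).neg.exp
    have p := (((hasDerivAt_id x).pow 2).div_const (‖c‖ ^ 2)).const_sub 1
    have := (e.neg.mul p).add (e.div_const (‖c‖ ^ 2))
    convert! this using 1
    simp
    field_simp
    ring

lemma circleAverage_radial (φ : ℝ → ℂ) {ρ : ℝ} (hρ : 0 < ρ) :
    Real.circleAverage (fun z : ℂ => φ ‖z‖) 0 ρ = φ ρ := by
  rw [Real.circleAverage_congr_sphere (f₂ := fun _ => φ ρ) fun z hz => by
    rw [mem_sphere_zero_iff_norm, abs_of_pos hρ] at hz; simp [hz]]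
  exact Real.circleAverage_const _ _ _

/-- With b² = 1+κ the integrand is 2(exp(-ρ²) - exp(-(bρ)²))/ρ, so Frullani's formula gives 2 log b.
This is the source of the logarithm in K. -/
lemma frullani_gauss {κ : ℝ} (hκ : 0 < κ) :
    ∫ ρ in Ioi (0 : ℝ), 2 * ρ * Real.exp (-ρ ^ 2) * ((1 - Real.exp (-(κ * ρ ^ 2))) / ρ ^ 2) =
      Real.log (1 + κ) := by
  set b := Real.sqrt (1 + κ) with hb
  have hb0 : 0 < b := Real.sqrt_pos.2 (by linarith)
  have hb2 : b ^ 2 = 1 + κ := Real.sq_sqrt (by linarith)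
  have e : ∀ x ∈ Ioi (0 : ℝ), 2 * x * Real.exp (-x ^ 2) * ((1 - Real.exp (-(κ * x ^ 2))) / x ^ 2) =
      2 * (x⁻¹ • ((fun y : ℝ => Real.exp (-y ^ 2)) (1 * x) -
        (fun y : ℝ => Real.exp (-y ^ 2)) (b * x))) := fun x hx => by
    have hx : x ≠ 0 := ne_of_gt hx
    have : Real.exp (-(b * x) ^ 2) = Real.exp (-x ^ 2) * Real.exp (-(κ * x ^ 2)) := by
      rw [← Real.exp_add, mul_pow, hb2]; congr 1; ring
    simp only [smul_eq_mul, one_mul, this]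
    field_simp
  have hint : IntegrableOn (fun x : ℝ => x⁻¹ • ((fun y : ℝ => Real.exp (-y ^ 2)) (1 * x) -
        (fun y : ℝ => Real.exp (-y ^ 2)) (b * x))) (Ioi 0) := by
    have hg : IntegrableOn (fun x : ℝ => κ * (x * Real.exp (-1 * x ^ 2))) (Ioi 0) :=
      ((integrable_mul_exp_neg_mul_sq one_pos).const_mul κ).integrableOn
    refine Integrable.mono' hg (by fun_prop) ?_
    filter_upwards [ae_restrict_mem measurableSet_Ioi] with x hx
    have hx : 0 < x := hx
    have h2 : Real.exp (-(b * x) ^ 2) = Real.exp (-x ^ 2) * Real.exp (-(κ * x ^ 2)) := by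
      rw [← Real.exp_add, mul_pow, hb2]; congr 1; ring
    simp only [smul_eq_mul, one_mul, h2]
    have h3 : 1 - κ * x ^ 2 ≤ Real.exp (-(κ * x ^ 2)) := by
      have := Real.add_one_le_exp (-(κ * x ^ 2)); linarith
    have h4 : Real.exp (-(κ * x ^ 2)) ≤ 1 := Real.exp_le_one_iff.2 (by
      have : 0 < κ * x ^ 2 := by positivity
      linarith)
    rw [Real.norm_eq_abs, abs_of_nonneg (by
      have := Real.exp_pos (-x ^ 2)
      exact mul_nonneg (by positivity) (by nlinarith))]
    rw [inv_mul_le_iff₀ hx, neg_one_mul]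
    have := Real.exp_pos (-x ^ 2)
    nlinarith
  have hcont : Continuous fun y : ℝ => Real.exp (-y ^ 2) := by fun_prop
  have hF := Frullani.integral_Ioi_eq (f := fun y : ℝ => Real.exp (-y ^ 2)) (L := 1) (R := 0)
    (hcont.locallyIntegrable.locallyIntegrableOn _) one_pos hb0
    (by simpa using (hcont.tendsto 0).mono_left (nhdsWithin_le_nhds (s := Ioi 0)))
    (Real.tendsto_exp_atBot.comp
      (tendsto_neg_atTop_atBot.comp (tendsto_pow_atTop two_ne_zero))) hint
  rw [setIntegral_congr_fun measurableSet_Ioi e, integral_const_mul, hF, div_one, hb,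
    Real.log_sqrt (by linarith)]
  simp; ring

lemma integral_one_sub_exp_div_sq {κ : ℝ} (hκ : 0 < κ) :
    Integrable (fun z : ℂ => (((1 - Real.exp (-(κ * ‖z‖ ^ 2))) / ‖z‖ ^ 2 : ℝ) : ℂ))
      stdComplexGaussian ∧
    ∫ z : ℂ, (((1 - Real.exp (-(κ * ‖z‖ ^ 2))) / ‖z‖ ^ 2 : ℝ) : ℂ) ∂stdComplexGaussian =
      Real.log (1 + κ) := by
  have hm : Measurable (fun z : ℂ => (((1 - Real.exp (-(κ * ‖z‖ ^ 2))) / ‖z‖ ^ 2 : ℝ) : ℂ)) := by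
    fun_prop
  have hi : Integrable (fun z : ℂ => (((1 - Real.exp (-(κ * ‖z‖ ^ 2))) / ‖z‖ ^ 2 : ℝ) : ℂ))
      stdComplexGaussian := by
    refine Integrable.of_bound hm.aestronglyMeasurable κ (ae_of_all _ fun z => ?_)
    rw [Complex.norm_real]
    have h3 : 1 - κ * ‖z‖ ^ 2 ≤ Real.exp (-(κ * ‖z‖ ^ 2)) := by
      have := Real.add_one_le_exp (-(κ * ‖z‖ ^ 2)); linarith
    have h4 : Real.exp (-(κ * ‖z‖ ^ 2)) ≤ 1 := Real.exp_le_one_iff.2 (by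
      have : 0 ≤ κ * ‖z‖ ^ 2 := by positivity
      linarith)
    rw [Real.norm_eq_abs, abs_of_nonneg (div_nonneg (by linarith) (by positivity))]
    exact div_le_of_le_mul₀ (by positivity) hκ.le (by linarith)
  refine ⟨hi, ?_⟩
  rw [integral_stdComplexGaussian_radial hm hi, ← frullani_gauss hκ, ← integral_complex_ofReal]
  refine setIntegral_congr_fun measurableSet_Ioi fun ρ hρ => ?_
  rw [circleAverage_radial (fun x => (((1 - Real.exp (-(κ * x ^ 2))) / x ^ 2 : ℝ) : ℂ)) hρ]
  push_cast; rfl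

end

/-! ### Two correlated standard Gaussians. -/

section

section
variable {r : ℂ} {σ : ℝ}

lemma add_mul_eq_mul_div_add (hσ : σ ≠ 0) (z g : ℂ) :
    r * z + σ * g = σ * (r * z / σ + g) := by
  have : (σ : ℂ) ≠ 0 := by exact_mod_cast hσ
  field_simp

lemma norm_mul_div_sq (hσ : 0 < σ) (z : ℂ) :
    ‖r * z / σ‖ ^ 2 = (‖r‖ ^ 2 / σ ^ 2) * ‖z‖ ^ 2 := by
  rw [norm_div, norm_mul, Complex.norm_real, Real.norm_of_nonneg hσ.le]
  field_simp

lemma one_add_ratio (hσ : 0 < σ) (hr : ‖r‖ ^ 2 + σ ^ 2 = 1) :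
    Real.log (1 + ‖r‖ ^ 2 / σ ^ 2) = Real.log (1 / σ ^ 2) := by
  have : 1 + ‖r‖ ^ 2 / σ ^ 2 = 1 / σ ^ 2 := by field_simp; linarith
  rw [this]

/-- Two standard complex Gaussians with correlation: the expectation of `1 / (conj z * w)` for
`w = r z + σ g`. -/
lemma integral_inv_conj_mul_correlated (hr0 : r ≠ 0) (hσ : 0 < σ) (hr : ‖r‖ ^ 2 + σ ^ 2 = 1)
    (hi : Integrable (fun p : ℂ × ℂ => ((starRingEnd ℂ) p.1 * (r * p.1 + σ * p.2))⁻¹)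
      (stdComplexGaussian.prod stdComplexGaussian)) :
    ∫ p : ℂ × ℂ, ((starRingEnd ℂ) p.1 * (r * p.1 + σ * p.2))⁻¹
      ∂(stdComplexGaussian.prod stdComplexGaussian) = Real.log (1 / σ ^ 2) / r := by
  have hσ' : (σ : ℂ) ≠ 0 := by exact_mod_cast hσ.ne'
  have hκ : 0 < ‖r‖ ^ 2 / σ ^ 2 := by have := norm_pos_iff.2 hr0; positivity
  rw [integral_prod _ hi]
  -- The inner integral over g is the one-variable formula at c = rz/σ. There |c|² = κ|z|² with κ =
  -- |r|²/σ², and 1+κ = 1/σ² turns the Frullani value into log(1/σ²).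
  have h1 : ∀ᵐ z ∂stdComplexGaussian,
      ∫ g, ((starRingEnd ℂ) z * (r * z + σ * g))⁻¹ ∂stdComplexGaussian =
        r⁻¹ * (((1 - Real.exp (-(‖r‖ ^ 2 / σ ^ 2 * ‖z‖ ^ 2))) / ‖z‖ ^ 2 : ℝ) : ℂ) := by
    filter_upwards [hi.prod_right_ae, ae_ne_zero_stdComplexGaussian] with z hz hz0
    have hz0' : (starRingEnd ℂ) z ≠ 0 := by simpa using hz0
    have hc : r * z / σ ≠ 0 := div_ne_zero (mul_ne_zero hr0 hz0) hσ'
    have e : ∀ g : ℂ, ((starRingEnd ℂ) z * (r * z + σ * g))⁻¹ =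
        ((starRingEnd ℂ) z * σ)⁻¹ * (r * z / σ + g)⁻¹ := fun g => by
      rw [add_mul_eq_mul_div_add hσ.ne', ← mul_assoc, mul_inv]
    simp only [e] at hz ⊢
    have hz2 : Integrable (fun g => (r * z / σ + g)⁻¹) stdComplexGaussian := by
      refine (integrable_const_mul_iff ?_ _).1 hz
      exact (inv_ne_zero (mul_ne_zero hz0' hσ')).isUnit
    rw [integral_const_mul, integral_inv_add_stdComplexGaussian hc hz2, norm_mul_div_sq hσ]
    have : (‖z‖ : ℂ) ^ 2 = z * (starRingEnd ℂ) z := by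
      rw [Complex.mul_conj, Complex.normSq_eq_norm_sq]; push_cast; rfl
    push_cast
    rw [this]
    field_simp
  rw [integral_congr_ae h1, integral_const_mul, (integral_one_sub_exp_div_sq hκ).2,
    one_add_ratio hσ hr]
  exact (div_eq_inv_mul _ _).symm

/-- Conditioning on z with c = rz/σ: the factor z/z̄ cancels the phase of z in c̄/c, and what
remains is a radial function of z already integrated by `integral_one_sub_exp_div_sq`. -/
lemma integral_unimodular_correlated (hr0 : r ≠ 0) (hσ : 0 < σ) (hr : ‖r‖ ^ 2 + σ ^ 2 = 1) :
    ∫ p : ℂ × ℂ, (starRingEnd ℂ) (r * p.1 + σ * p.2) / (r * p.1 + σ * p.2) *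
        (p.1 / (starRingEnd ℂ) p.1)
      ∂(stdComplexGaussian.prod stdComplexGaussian) =
      (starRingEnd ℂ) r / r * (1 - Real.log (1 / σ ^ 2) * (σ ^ 2 / ‖r‖ ^ 2)) := by
  have hσ' : (σ : ℂ) ≠ 0 := by exact_mod_cast hσ.ne'
  have hn : 0 < ‖r‖ := norm_pos_iff.2 hr0
  have hκ : 0 < ‖r‖ ^ 2 / σ ^ 2 := by positivity
  have hmc : Measurable (starRingEnd ℂ) := Complex.continuous_conj.measurable
  have hi : Integrable (fun p : ℂ × ℂ => (starRingEnd ℂ) (r * p.1 + σ * p.2) /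
      (r * p.1 + σ * p.2) * (p.1 / (starRingEnd ℂ) p.1))
      (stdComplexGaussian.prod stdComplexGaussian) := by
    refine Integrable.of_bound (Measurable.aestronglyMeasurable (by fun_prop)) 1
      (ae_of_all _ fun p => ?_)
    rw [norm_mul]
    refine mul_le_one₀ (norm_conj_div_self_le _) (norm_nonneg _) ?_
    rw [norm_div, RCLike.norm_conj]
    exact div_self_le_one _
  rw [integral_prod _ hi]
  have h1 : ∀ᵐ z ∂stdComplexGaussian,
      ∫ g, (starRingEnd ℂ) (r * z + σ * g) / (r * z + σ * g) * (z / (starRingEnd ℂ) z)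
        ∂stdComplexGaussian =
        (starRingEnd ℂ) r / r * (1 - ((σ ^ 2 / ‖r‖ ^ 2 : ℝ) : ℂ) *
          (((1 - Real.exp (-(‖r‖ ^ 2 / σ ^ 2 * ‖z‖ ^ 2))) / ‖z‖ ^ 2 : ℝ) : ℂ)) := by
    filter_upwards [ae_ne_zero_stdComplexGaussian] with z hz0
    have hz0' : (starRingEnd ℂ) z ≠ 0 := by simpa using hz0
    have hc : r * z / σ ≠ 0 := div_ne_zero (mul_ne_zero hr0 hz0) hσ'
    have e : ∀ g : ℂ, (starRingEnd ℂ) (r * z + σ * g) / (r * z + σ * g) =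
        (starRingEnd ℂ) (r * z / σ + g) / (r * z / σ + g) := fun g => by
      rw [add_mul_eq_mul_div_add hσ.ne', map_mul, Complex.conj_ofReal, mul_div_mul_left _ _ hσ']
    simp only [e]
    rw [integral_mul_const, integral_conj_div_add_stdComplexGaussian hc, norm_mul_div_sq hσ]
    simp only [map_div₀, map_mul, Complex.conj_ofReal]
    have hn' : (‖r‖ : ℂ) ≠ 0 := by exact_mod_cast hn.ne'
    have hnz' : (‖z‖ : ℂ) ≠ 0 := by simpa using hz0
    push_cast
    field_simp
  rw [integral_congr_ae h1, integral_const_mul, integral_sub (integrable_const _)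
    ((integral_one_sub_exp_div_sq hκ).1.const_mul _), integral_const_mul,
    (integral_one_sub_exp_div_sq hκ).2, one_add_ratio hσ hr]
  simp
  left
  ring
end

end

/-! ### Centred circular Gaussian random variables. -/

section

variable {Ω : Type*} [MeasurableSpace Ω] {P : Measure Ω}

/-- `Y` is a centred circular complex Gaussian random variable with `𝔼|Y|² = q`. -/
structure IsCG (P : Measure Ω) (q : ℝ) (Y : Ω → ℂ) : Prop where
  measurable : Measurable Y
  nonneg : 0 ≤ q
  law : P.map Y = stdComplexGaussian.map (fun z => ((Real.sqrt q : ℝ) : ℂ) * z)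

lemma charFun_map_const_mul_stdComplexGaussian {q : ℝ} (hq : 0 ≤ q) (c : ℂ) :
    charFun (stdComplexGaussian.map (fun z => ((Real.sqrt q : ℝ) : ℂ) * z)) c =
      Complex.exp (-(q * ‖c‖ ^ 2 / 4 : ℝ)) := by
  have : (fun z : ℂ => ((Real.sqrt q : ℝ) : ℂ) * z) = fun z => Real.sqrt q • z := by
    ext z; rw [Complex.real_smul]
  rw [this, charFun_map_smul, charFun_stdComplexGaussian, norm_smul, mul_pow, Real.norm_eq_abs,
    sq_abs, Real.sq_sqrt hq]

namespace IsCG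

lemma charFun_eq {q : ℝ} {Y : Ω → ℂ} (h : IsCG P q Y) (c : ℂ) :
    charFun (P.map Y) c = Complex.exp (-(q * ‖c‖ ^ 2 / 4 : ℝ)) := by
  rw [h.law, charFun_map_const_mul_stdComplexGaussian h.nonneg]

lemma of_charFun [IsFiniteMeasure P] {q : ℝ} {Y : Ω → ℂ} (hY : Measurable Y) (hq : 0 ≤ q)
    (h : ∀ c, charFun (P.map Y) c = Complex.exp (-(q * ‖c‖ ^ 2 / 4 : ℝ))) : IsCG P q Y := by
  refine ⟨hY, hq, ?_⟩
  have : IsFiniteMeasure (stdComplexGaussian.map (fun z => ((Real.sqrt q : ℝ) : ℂ) * z)) :=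
    Measure.isFiniteMeasure_map _ _
  refine Measure.ext_of_charFun (funext fun c => ?_)
  rw [h, charFun_map_const_mul_stdComplexGaussian hq]

variable {q : ℝ} {Y : Ω → ℂ}

lemma integral_comp (h : IsCG P q Y) {E : Type*} [NormedAddCommGroup E] [NormedSpace ℝ E]
    {φ : ℂ → E} (hφ : StronglyMeasurable φ) :
    ∫ ω, φ (Y ω) ∂P = ∫ z, φ (Real.sqrt q * z) ∂stdComplexGaussian := by
  rw [← integral_map h.measurable.aemeasurable hφ.aestronglyMeasurable, h.law,
    integral_map (by fun_prop) hφ.aestronglyMeasurable]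

lemma integrable_comp_iff (h : IsCG P q Y) {E : Type*} [NormedAddCommGroup E]
    {φ : ℂ → E} (hφ : StronglyMeasurable φ) :
    Integrable (fun ω => φ (Y ω)) P ↔
      Integrable (fun z => φ (Real.sqrt q * z)) stdComplexGaussian := by
  have h1 := integrable_map_measure (μ := P) (f := Y) (g := φ)
    hφ.aestronglyMeasurable h.measurable.aemeasurable
  have h2 := integrable_map_measure (μ := stdComplexGaussian)
    (f := fun z => ((Real.sqrt q : ℝ) : ℂ) * z) (g := φ) hφ.aestronglyMeasurable (by fun_prop)
  rw [h.law] at h1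
  exact h1.symm.trans h2

lemma norm_sqrt_mul_rpow (q : ℝ) (z : ℂ) (p : ℝ) :
    ‖((Real.sqrt q : ℝ) : ℂ) * z‖ ^ p = Real.sqrt q ^ p * ‖z‖ ^ p := by
  rw [norm_mul, Complex.norm_real, Real.norm_of_nonneg (Real.sqrt_nonneg _),
    Real.mul_rpow (Real.sqrt_nonneg _) (norm_nonneg _)]

lemma integrable_norm_rpow (h : IsCG P q Y) {p : ℝ} (hp : -2 < p) :
    Integrable (fun ω => ‖Y ω‖ ^ p) P := by
  rw [h.integrable_comp_iff (φ := fun z => ‖z‖ ^ p) (by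
    exact Measurable.stronglyMeasurable (by fun_prop))]
  simp_rw [norm_sqrt_mul_rpow q]
  exact (integrable_norm_rpow_stdComplexGaussian hp).const_mul _

lemma integral_norm_rpow (h : IsCG P q Y) {p : ℝ} (hp : -2 < p) :
    ∫ ω, ‖Y ω‖ ^ p ∂P = Real.sqrt q ^ p * Real.Gamma ((p + 2) / 2) := by
  rw [h.integral_comp (φ := fun z => ‖z‖ ^ p) (by
    exact Measurable.stronglyMeasurable (by fun_prop))]
  simp_rw [norm_sqrt_mul_rpow q]
  rw [integral_const_mul, integral_norm_rpow_stdComplexGaussian hp]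

lemma integral_norm_sq (h : IsCG P q Y) : ∫ ω, ‖Y ω‖ ^ 2 ∂P = q := by
  have := h.integral_norm_rpow (p := 2) (by norm_num)
  simpa [Real.sq_sqrt h.nonneg] using this

lemma memLp_two (h : IsCG P q Y) : MemLp Y 2 P := by
  rw [memLp_two_iff_integrable_sq_norm h.measurable.aestronglyMeasurable]
  simpa using h.integrable_norm_rpow (p := 2) (by norm_num)

/-- The law is invariant under rotation by u, so the mean I satisfies I = vI with v ≠ 1. No
integrability is needed, as the Bochner integral is homogeneous in all cases; hence the use for 1/Y
and Y̅/Y. -/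
lemma integral_eq_of_homogeneous (h : IsCG P q Y) {φ : ℂ → ℂ} (hφ : Measurable φ)
    {u : ℂ} (hu : ‖u‖ = 1) {v : ℂ} (hv : v ≠ 1) (hh : ∀ z, φ (u * z) = v * φ z) :
    ∫ ω, φ (Y ω) ∂P = 0 := by
  have h1 : IsCG P q Y → ∫ ω, φ (Y ω) ∂P = v * ∫ ω, φ (Y ω) ∂P := fun h => by
    have hmp : stdComplexGaussian.map (fun z => u * z) = stdComplexGaussian := by
      have : IsProbabilityMeasure (stdComplexGaussian.map (fun z => u * z)) :=
        Measure.isProbabilityMeasure_map (by fun_prop)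
      refine Measure.ext_of_charFun (funext fun c => ?_)
      have e : ∀ z : ℂ, inner ℝ (u * z) c = (inner ℝ z ((starRingEnd ℂ) u * c) : ℝ) := fun z => by
        simp only [Complex.inner, map_mul]; congr 1; ring
      rw [charFun_apply, integral_map (by fun_prop) (by fun_prop)]
      simp_rw [e]
      rw [← charFun_apply, charFun_stdComplexGaussian, charFun_stdComplexGaussian, norm_mul,
        RCLike.norm_conj, hu, one_mul]
    rw [h.integral_comp hφ.stronglyMeasurable]
    conv_lhs => rw [← hmp]
    rw [integral_map (by fun_prop) (by
      exact (hφ.comp (by fun_prop)).aestronglyMeasurable), ← integral_const_mul]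
    refine integral_congr_ae (ae_of_all _ fun z => ?_)
    simp only
    rw [← hh]; congr 1; ring
  have h2 := h1 h
  have h3 : (1 - v) * ∫ ω, φ (Y ω) ∂P = 0 := by rw [sub_mul, one_mul, ← h2, sub_self]
  exact (mul_eq_zero.1 h3).resolve_left (sub_ne_zero.2 hv.symm)

lemma integral_eq_zero (h : IsCG P q Y) : ∫ ω, Y ω ∂P = 0 :=
  h.integral_eq_of_homogeneous (φ := id) measurable_id (u := -1) (v := -1) (by simp)
    (by norm_num) (fun z => rfl)

lemma integral_inv_eq_zero (h : IsCG P q Y) : ∫ ω, (Y ω)⁻¹ ∂P = 0 :=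
  h.integral_eq_of_homogeneous (φ := fun z => z⁻¹) (by fun_prop) (u := -1) (v := -1) (by simp)
    (by norm_num) (fun z => by rw [neg_one_mul, neg_one_mul, inv_neg])

lemma integral_sq_eq_zero (h : IsCG P q Y) : ∫ ω, Y ω ^ 2 ∂P = 0 :=
  h.integral_eq_of_homogeneous (φ := fun z => z ^ 2) (by fun_prop) (u := Complex.I) (v := -1)
    (by simp) (by norm_num) (fun z => by rw [mul_pow, Complex.I_sq])

lemma measure_norm_ge_le [IsFiniteMeasure P] (h : IsCG P q Y) {v : ℝ} (hqv : q ≤ v) (hv : 0 < v)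
    {x : ℝ} (hx : 0 ≤ x) :
    P {ω | x ≤ ‖Y ω‖} ≤ ENNReal.ofReal (2 * Real.exp (-(x ^ 2 / (2 * v)))) := by
  have hm : MeasurableSet {z : ℂ | x ≤ ‖z‖} := measurableSet_le measurable_const measurable_norm
  have h1 := map_measureReal_apply (μ := P) h.measurable hm
  rw [h.law, map_measureReal_apply (by fun_prop) hm] at h1
  change _ = P.real {ω | x ≤ ‖Y ω‖} at h1
  have hs := Real.sqrt_pos.2 hv
  have h2 := stdComplexGaussian_real_tail_le (x := x / Real.sqrt v) (by positivity)
  rw [div_pow, Real.sq_sqrt hv.le, div_div, mul_comm v 2] at h2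
  rw [← ofReal_measureReal, ← h1]
  refine ENNReal.ofReal_le_ofReal (le_trans (measureReal_mono fun z hz => ?_) h2)
  simp only [mem_preimage, mem_ofPred_eq, norm_mul, Complex.norm_real,
    Real.norm_of_nonneg (Real.sqrt_nonneg _)] at hz ⊢
  rw [div_le_iff₀' hs]
  exact hz.trans (mul_le_mul_of_nonneg_right (Real.sqrt_le_sqrt hqv) (norm_nonneg _))

lemma measure_norm_le_le (h : IsCG P 1 Y) {ε : ℝ} (hε : 0 ≤ ε) :
    P {ω | ‖Y ω‖ ≤ ε} ≤ ENNReal.ofReal (ε ^ 2) := by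
  have hm : MeasurableSet (Metric.closedBall (0 : ℂ) ε) := measurableSet_closedBall
  have := Measure.map_apply (μ := P) h.measurable hm
  have e : (fun z : ℂ => ((Real.sqrt 1 : ℝ) : ℂ) * z) = id := by ext z; simp
  rw [h.law, e, Measure.map_id] at this
  have e2 : {ω | ‖Y ω‖ ≤ ε} = Y ⁻¹' Metric.closedBall (0 : ℂ) ε := by
    ext ω; simp
  rw [e2, ← this]
  exact stdComplexGaussian_closedBall_le hε

lemma map_eq_std (h : IsCG P 1 Y) : P.map Y = stdComplexGaussian := by
  have e : (fun z : ℂ => ((Real.sqrt 1 : ℝ) : ℂ) * z) = id := by ext z; simp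
  rw [h.law, e, Measure.map_id]

/-- Characteristic functions converge by dominated convergence. Convergence of the variances is part
of the conclusion: it is read off from the logarithm of the limit at one point where that limit is
non-zero. -/
lemma tendsto_of_pointwise [IsProbabilityMeasure P] {q : ℕ → ℝ} {Y : ℕ → Ω → ℂ} {Z : Ω → ℂ}
    (h : ∀ n, IsCG P (q n) (Y n)) (hlim : ∀ ω, Tendsto (fun n => Y n ω) atTop (𝓝 (Z ω))) :
    ∃ q', Tendsto q atTop (𝓝 q') ∧ IsCG P q' Z := by
  have hZ : Measurable Z := measurable_of_tendsto_metrizable (fun n => (h n).measurable)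
    (tendsto_pi_nhds.2 hlim)
  have hchar : ∀ c : ℂ, Tendsto (fun n => Complex.exp (-(q n * ‖c‖ ^ 2 / 4 : ℝ))) atTop
      (𝓝 (charFun (P.map Z) c)) := fun c => by
    have e : ∀ {W : Ω → ℂ}, Measurable W → charFun (P.map W) c =
        ∫ ω, Complex.exp (inner ℝ (W ω) c * Complex.I) ∂P := fun hW => by
      rw [charFun_apply, integral_map hW.aemeasurable (by fun_prop)]
    simp_rw [← fun n => (h n).charFun_eq c, fun n => e (h n).measurable]
    rw [e hZ]
    refine tendsto_integral_of_dominated_convergence (fun _ => 1) (fun n => ?_)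
      (integrable_const 1) (fun n => ae_of_all _ fun ω => ?_) (ae_of_all _ fun ω => ?_)
    · have := (h n).measurable
      exact (Complex.continuous_exp.measurable.comp (by fun_prop)).aestronglyMeasurable
    · rw [Complex.norm_exp_ofReal_mul_I]
    · have : Continuous fun z : ℂ => Complex.exp (inner ℝ z c * Complex.I) := by fun_prop
      exact (this.tendsto _).comp (hlim ω)
  have : IsProbabilityMeasure (P.map Z) := Measure.isProbabilityMeasure_map hZ.aemeasurable
  have hcont : Continuous (charFun (P.map Z)) := continuous_charFun
  -- The limiting characteristic function is continuous with value 1 at 0. A zero at δ would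
  -- correspond to variances escaping to infinity.
  obtain ⟨δ, hδ, hφ⟩ : ∃ δ : ℝ, 0 < δ ∧ charFun (P.map Z) (δ : ℂ) ≠ 0 := by
    have h1 : charFun (P.map Z) ((0 : ℝ) : ℂ) ≠ 0 := by simp
    have h2 : ∀ᶠ δ : ℝ in 𝓝 0, charFun (P.map Z) (δ : ℂ) ≠ 0 :=
      ((hcont.comp Complex.continuous_ofReal).continuousAt.eventually_ne h1)
    obtain ⟨δ, h3, h4⟩ := ((h2.filter_mono nhdsWithin_le_nhds).and
      (self_mem_nhdsWithin : Ioi (0 : ℝ) ∈ 𝓝[>] 0)).exists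
    exact ⟨δ, h4, h3⟩
  have hnorm : Tendsto (fun n => Real.exp (-(q n * δ ^ 2 / 4))) atTop
      (𝓝 ‖charFun (P.map Z) (δ : ℂ)‖) := by
    have := (hchar (δ : ℂ)).norm
    simp only [Complex.norm_exp, Complex.norm_real, Real.norm_eq_abs, sq_abs] at this
    simpa [← Complex.ofReal_pow] using this
  have hlog := hnorm.log (norm_ne_zero_iff.2 hφ)
  simp only [Real.log_exp] at hlog
  set q' := -(4 / δ ^ 2) * Real.log ‖charFun (P.map Z) (δ : ℂ)‖ with hq'
  have hq : Tendsto q atTop (𝓝 q') := by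
    refine (hlog.const_mul (-(4 / δ ^ 2))).congr fun n => ?_
    field_simp
  refine ⟨q', hq, of_charFun hZ (ge_of_tendsto' hq fun n => (h n).nonneg) fun c => ?_⟩
  refine tendsto_nhds_unique (hchar c) ?_
  have : Continuous fun x : ℝ => Complex.exp (-(x * ‖c‖ ^ 2 / 4 : ℝ)) := by fun_prop
  exact (this.tendsto q').comp hq

end IsCG

end

/-! ### Gaussian spaces: covariance, pointwise limits, independence. -/

section

variable {Ω : Type*} [MeasurableSpace Ω] {P : Measure Ω}

/-- A linear space of random variables all of which are centred circular complex Gaussian. -/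
def IsGaussianSpace (P : Measure Ω) (H : Submodule ℂ (Ω → ℂ)) : Prop :=
  ∀ Y ∈ H, ∃ q, IsCG P q Y

/-- The covariance `𝔼[Y conj Z]`. -/
noncomputable def cov (P : Measure Ω) (Y Z : Ω → ℂ) : ℂ := ∫ ω, Y ω * (starRingEnd ℂ) (Z ω) ∂P

lemma cov_conj (Y Z : Ω → ℂ) : (starRingEnd ℂ) (cov P Y Z) = cov P Z Y := by
  rw [cov, cov, ← integral_conj]
  congr 1; ext ω; simp [mul_comm]

lemma cov_self (Y : Ω → ℂ) : cov P Y Y = (∫ ω, ‖Y ω‖ ^ 2 ∂P : ℝ) := by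
  rw [cov, ← integral_complex_ofReal]
  congr 1; ext ω; rw [Complex.mul_conj, Complex.normSq_eq_norm_sq]

namespace IsGaussianSpace

variable {H : Submodule ℂ (Ω → ℂ)} (h : IsGaussianSpace P H)
include h

lemma isCG {Y : Ω → ℂ} (hY : Y ∈ H) : IsCG P (∫ ω, ‖Y ω‖ ^ 2 ∂P) Y := by
  obtain ⟨q, hq⟩ := h Y hY
  rwa [hq.integral_norm_sq]

lemma measurable {Y : Ω → ℂ} (hY : Y ∈ H) : Measurable Y := (h.isCG hY).measurable

lemma memLp {Y : Ω → ℂ} (hY : Y ∈ H) : MemLp Y 2 P := (h.isCG hY).memLp_two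

lemma integrable_mul_conj {Y Z : Ω → ℂ} (hY : Y ∈ H) (hZ : Z ∈ H) :
    Integrable (fun ω => Y ω * (starRingEnd ℂ) (Z ω)) P :=
  (h.memLp hY).integrable_mul (h.memLp hZ).star

lemma integrable_mul {Y Z : Ω → ℂ} (hY : Y ∈ H) (hZ : Z ∈ H) :
    Integrable (fun ω => Y ω * Z ω) P :=
  (h.memLp hY).integrable_mul (h.memLp hZ)

/-- Circularity makes the mean of W² vanish for every member W; polarisation extends this to
products. Hence the Hermitian covariance determines all joint laws. -/
lemma integral_mul_eq_zero {Y Z : Ω → ℂ} (hY : Y ∈ H) (hZ : Z ∈ H) :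
    ∫ ω, Y ω * Z ω ∂P = 0 := by
  have e : ∀ ω, Y ω * Z ω = 4⁻¹ * ((Y + Z) ω ^ 2 - (Y - Z) ω ^ 2) := fun ω => by
    simp only [Pi.add_apply, Pi.sub_apply]; ring
  have hi : ∀ {W}, W ∈ H → Integrable (fun ω => W ω ^ 2) P := fun hW => by
    simpa [sq] using h.integrable_mul hW hW
  simp_rw [e]
  rw [integral_const_mul, integral_sub (hi (H.add_mem hY hZ)) (hi (H.sub_mem hY hZ)),
    (h.isCG (H.add_mem hY hZ)).integral_sq_eq_zero, (h.isCG (H.sub_mem hY hZ)).integral_sq_eq_zero]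
  simp

lemma cov_add_left {X Y Z : Ω → ℂ} (hX : X ∈ H) (hY : Y ∈ H) (hZ : Z ∈ H) :
    cov P (X + Y) Z = cov P X Z + cov P Y Z := by
  rw [cov, cov, cov, ← integral_add (h.integrable_mul_conj hX hZ) (h.integrable_mul_conj hY hZ)]
  congr 1; ext ω; simp [add_mul]

omit h in
lemma cov_smul_left (a : ℂ) (X Z : Ω → ℂ) : cov P (a • X) Z = a * cov P X Z := by
  rw [cov, cov, ← integral_const_mul]
  congr 1; ext ω; simp [mul_assoc]

lemma cov_sub_left {X Y Z : Ω → ℂ} (hX : X ∈ H) (hY : Y ∈ H) (hZ : Z ∈ H) :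
    cov P (X - Y) Z = cov P X Z - cov P Y Z := by
  rw [cov, cov, cov, ← integral_sub (h.integrable_mul_conj hX hZ) (h.integrable_mul_conj hY hZ)]
  congr 1; ext ω; simp [sub_mul]

lemma cov_add_right {X Y Z : Ω → ℂ} (hX : X ∈ H) (hY : Y ∈ H) (hZ : Z ∈ H) :
    cov P Z (X + Y) = cov P Z X + cov P Z Y := by
  rw [← cov_conj, h.cov_add_left hX hY hZ, map_add, cov_conj, cov_conj]

lemma cov_sub_right {X Y Z : Ω → ℂ} (hX : X ∈ H) (hY : Y ∈ H) (hZ : Z ∈ H) :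
    cov P Z (X - Y) = cov P Z X - cov P Z Y := by
  rw [← cov_conj, h.cov_sub_left hX hY hZ, map_sub, cov_conj, cov_conj]

omit h in
lemma cov_smul_right (a : ℂ) (X Z : Ω → ℂ) :
    cov P Z (a • X) = (starRingEnd ℂ) a * cov P Z X := by
  rw [← cov_conj, cov_smul_left, map_mul, cov_conj]

/-- Polarisation, used to deduce convergence of covariances from convergence of variances. -/
lemma four_mul_cov {Y Z : Ω → ℂ} (hY : Y ∈ H) (hZ : Z ∈ H) :
    4 * cov P Y Z = cov P (Y + Z) (Y + Z) - cov P (Y - Z) (Y - Z)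
      + Complex.I * cov P (Y + Complex.I • Z) (Y + Complex.I • Z)
      - Complex.I * cov P (Y - Complex.I • Z) (Y - Complex.I • Z) := by
  have hIZ := H.smul_mem Complex.I hZ
  rw [h.cov_add_left hY hZ (H.add_mem hY hZ), h.cov_sub_left hY hZ (H.sub_mem hY hZ),
    h.cov_add_left hY hIZ (H.add_mem hY hIZ), h.cov_sub_left hY hIZ (H.sub_mem hY hIZ)]
  simp only [h.cov_add_right hY hZ hY, h.cov_add_right hY hZ hZ, h.cov_add_right hY hIZ hY,
    h.cov_add_right hY hIZ hIZ, h.cov_sub_right hY hZ hY, h.cov_sub_right hY hZ hZ,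
    h.cov_sub_right hY hIZ hY, h.cov_sub_right hY hIZ hIZ, cov_smul_left, cov_smul_right,
    Complex.conj_I]
  linear_combination (2 * cov P Y Z - 2 * cov P Z Y) * Complex.I_sq

omit h in
/-- The sequential closure of a space of random variables under pointwise limits. -/
def seqClosure (H : Submodule ℂ (Ω → ℂ)) : Submodule ℂ (Ω → ℂ) where
  carrier := {Y | ∃ u : ℕ → Ω → ℂ, (∀ n, u n ∈ H) ∧ ∀ ω, Tendsto (fun n => u n ω) atTop (𝓝 (Y ω))}
  add_mem' := by
    rintro Y Z ⟨u, hu, hu'⟩ ⟨v, hv, hv'⟩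
    exact ⟨fun n => u n + v n, fun n => H.add_mem (hu n) (hv n), fun ω => (hu' ω).add (hv' ω)⟩
  zero_mem' := ⟨fun _ => 0, fun _ => H.zero_mem, fun _ => tendsto_const_nhds⟩
  smul_mem' := by
    rintro a Y ⟨u, hu, hu'⟩
    exact ⟨fun n => a • u n, fun n => H.smul_mem a (hu n), fun ω => (hu' ω).const_mul a⟩

omit h [MeasurableSpace Ω] in
lemma le_seqClosure : H ≤ seqClosure H := fun Y hY =>
  ⟨fun _ => Y, fun _ => hY, fun _ => tendsto_const_nhds⟩

lemma closure [IsProbabilityMeasure P] : IsGaussianSpace P (seqClosure H) := by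
  rintro Y ⟨u, hu, hlim⟩
  obtain ⟨q, -, hq⟩ := IsCG.tendsto_of_pointwise (fun n => h.isCG (hu n)) hlim
  exact ⟨q, hq⟩

lemma tendsto_cov_self [IsProbabilityMeasure P] {u : ℕ → Ω → ℂ} {Y : Ω → ℂ} (hu : ∀ n, u n ∈ H)
    (hlim : ∀ ω, Tendsto (fun n => u n ω) atTop (𝓝 (Y ω))) :
    Tendsto (fun n => cov P (u n) (u n)) atTop (𝓝 (cov P Y Y)) := by
  obtain ⟨q, hq, hY⟩ := IsCG.tendsto_of_pointwise (fun n => h.isCG (hu n)) hlim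
  simp only [cov_self, hY.integral_norm_sq]
  exact (Complex.continuous_ofReal.tendsto _).comp hq

lemma tendsto_cov [IsProbabilityMeasure P] {u v : ℕ → Ω → ℂ} {Y Z : Ω → ℂ} (hu : ∀ n, u n ∈ H)
    (hlim : ∀ ω, Tendsto (fun n => u n ω) atTop (𝓝 (Y ω))) (hv : ∀ n, v n ∈ H)
    (hlim' : ∀ ω, Tendsto (fun n => v n ω) atTop (𝓝 (Z ω))) :
    Tendsto (fun n => cov P (u n) (v n)) atTop (𝓝 (cov P Y Z)) := by
  have hY : Y ∈ seqClosure H := ⟨u, hu, hlim⟩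
  have hZ : Z ∈ seqClosure H := ⟨v, hv, hlim'⟩
  have hIv := fun n => H.smul_mem Complex.I (hv n)
  have hlimI : ∀ ω, Tendsto (fun n => (Complex.I • v n) ω) atTop (𝓝 ((Complex.I • Z) ω)) :=
    fun ω => (hlim' ω).const_mul _
  have key : Tendsto (fun n => 4 * cov P (u n) (v n)) atTop (𝓝 (4 * cov P Y Z)) := by
    simp_rw [fun n => h.four_mul_cov (hu n) (hv n)]
    rw [h.closure.four_mul_cov hY hZ]
    refine (((h.tendsto_cov_self (fun n => H.add_mem (hu n) (hv n)) fun ω =>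
      (hlim ω).add (hlim' ω)).sub (h.tendsto_cov_self (fun n => H.sub_mem (hu n) (hv n)) fun ω =>
      (hlim ω).sub (hlim' ω))).add ((h.tendsto_cov_self (fun n => H.add_mem (hu n) (hIv n)) fun ω =>
      (hlim ω).add (hlimI ω)).const_mul _)).sub
      ((h.tendsto_cov_self (fun n => H.sub_mem (hu n) (hIv n)) fun ω =>
      (hlim ω).sub (hlimI ω)).const_mul _)
  simpa using key.const_mul 4⁻¹

omit h in
lemma exists_re_mul (L : ℂ →L[ℝ] ℝ) : ∃ a : ℂ, ∀ z, L z = (a * z).re := by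
  refine ⟨(L 1 : ℂ) - (L Complex.I : ℂ) * Complex.I, fun z => ?_⟩
  conv_lhs => rw [← Complex.re_add_im z]
  have h1 : (z.re : ℂ) = z.re • (1 : ℂ) := by simp
  have h2 : (z.im : ℂ) * Complex.I = z.im • Complex.I := by simp
  rw [h1, h2, map_add, map_smul, map_smul]
  simp; ring

lemma integral_exp_re {Y : Ω → ℂ} (hY : Y ∈ H) :
    ∫ ω, Complex.exp ((Y ω).re * Complex.I) ∂P = Complex.exp (-(cov P Y Y) / 4) := by
  have h1 := (h.isCG hY).charFun_eq 1
  rw [charFun_apply, integral_map (h.measurable hY).aemeasurable (by fun_prop)] at h1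
  simp only [Complex.inner] at h1
  simp at h1
  rw [h1, cov_self]
  congr 1
  ring

/-- Uncorrelated pairs in a Gaussian space are independent. -/
lemma indepFun [IsProbabilityMeasure P] {U₁ U₂ W₁ W₂ : Ω → ℂ} (hU₁ : U₁ ∈ H) (hU₂ : U₂ ∈ H)
    (hW₁ : W₁ ∈ H) (hW₂ : W₂ ∈ H) (h11 : cov P U₁ W₁ = 0) (h12 : cov P U₁ W₂ = 0)
    (h21 : cov P U₂ W₁ = 0) (h22 : cov P U₂ W₂ = 0) :
    IndepFun (fun ω => (U₁ ω, U₂ ω)) (fun ω => (W₁ ω, W₂ ω)) P := by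
  have mU₁ := h.measurable hU₁
  have mU₂ := h.measurable hU₂
  have mW₁ := h.measurable hW₁
  have mW₂ := h.measurable hW₂
  -- A real functional on ℂ² × ℂ² is the real part of a complex linear one, so along the vector it
  -- becomes Re of a member of H, whose characteristic function depends on its variance alone.
  -- Vanishing cross covariances make the two variances add, and the exponential factors.
  rw [indepFun_iff_charFunDual_prod (by fun_prop) (by fun_prop)]
  intro L
  obtain ⟨a, ha⟩ := exists_re_mul
    (L.comp ((ContinuousLinearMap.inl ℝ (ℂ × ℂ) (ℂ × ℂ)).comp (ContinuousLinearMap.inl ℝ ℂ ℂ)))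
  obtain ⟨b, hb⟩ := exists_re_mul
    (L.comp ((ContinuousLinearMap.inl ℝ (ℂ × ℂ) (ℂ × ℂ)).comp (ContinuousLinearMap.inr ℝ ℂ ℂ)))
  obtain ⟨c, hc⟩ := exists_re_mul
    (L.comp ((ContinuousLinearMap.inr ℝ (ℂ × ℂ) (ℂ × ℂ)).comp (ContinuousLinearMap.inl ℝ ℂ ℂ)))
  obtain ⟨d, hd⟩ := exists_re_mul
    (L.comp ((ContinuousLinearMap.inr ℝ (ℂ × ℂ) (ℂ × ℂ)).comp (ContinuousLinearMap.inr ℝ ℂ ℂ)))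
  simp only [ContinuousLinearMap.comp_apply, ContinuousLinearMap.inl_apply,
    ContinuousLinearMap.inr_apply] at ha hb hc hd
  have hl : ∀ x y : ℂ, L ((x, y), 0) = (a * x + b * y).re := fun x y => by
    have : (((x, y), 0) : (ℂ × ℂ) × (ℂ × ℂ)) = ((x, 0), 0) + ((0, y), 0) := by simp
    rw [this, map_add, ha, hb, Complex.add_re]
  have hr : ∀ x y : ℂ, L (0, (x, y)) = (c * x + d * y).re := fun x y => by
    have : ((0, (x, y)) : (ℂ × ℂ) × (ℂ × ℂ)) = (0, (x, 0)) + (0, (0, y)) := by simp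
    rw [this, map_add, hc, hd, Complex.add_re]
  have hlr : ∀ p q : ℂ × ℂ, L (p, q) = ((a * p.1 + b * p.2) + (c * q.1 + d * q.2)).re :=
    fun p q => by
    have : (p, q) = ((p.1, p.2), (0 : ℂ × ℂ)) + ((0 : ℂ × ℂ), (q.1, q.2)) := by simp
    rw [this, map_add, hl, hr, Complex.add_re _ (c * _ + d * _)]
  have hV : a • U₁ + b • U₂ ∈ H := H.add_mem (H.smul_mem _ hU₁) (H.smul_mem _ hU₂)
  have hV' : c • W₁ + d • W₂ ∈ H := H.add_mem (H.smul_mem _ hW₁) (H.smul_mem _ hW₂)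
  have h0 : cov P (a • U₁ + b • U₂) (c • W₁ + d • W₂) = 0 := by
    rw [h.cov_add_left (H.smul_mem _ hU₁) (H.smul_mem _ hU₂) hV',
      h.cov_add_right (H.smul_mem _ hW₁) (H.smul_mem _ hW₂) (H.smul_mem _ hU₁),
      h.cov_add_right (H.smul_mem _ hW₁) (H.smul_mem _ hW₂) (H.smul_mem _ hU₂)]
    simp only [cov_smul_left, cov_smul_right, h11, h12, h21, h22]
    simp
  have h0' : cov P (c • W₁ + d • W₂) (a • U₁ + b • U₂) = 0 := by
    rw [← cov_conj, h0, map_zero]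
  have e1 := h.integral_exp_re (H.add_mem hV hV')
  have e2 := h.integral_exp_re hV
  have e3 := h.integral_exp_re hV'
  rw [h.cov_add_left hV hV' (H.add_mem hV hV'), h.cov_add_right hV hV' hV,
    h.cov_add_right hV hV' hV', h0, h0'] at e1
  simp only [charFunDual_apply]
  rw [integral_map (by fun_prop) (by fun_prop), integral_map (by fun_prop) (by fun_prop),
    integral_map (by fun_prop) (by fun_prop)]
  simp only [ContinuousLinearMap.comp_apply, ContinuousLinearMap.inl_apply,
    ContinuousLinearMap.inr_apply, hlr]
  simp only [Pi.add_apply, Pi.smul_apply, smul_eq_mul] at e1 e2 e3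
  simp only [Prod.fst_zero, Prod.snd_zero, mul_zero, add_zero, zero_add]
  rw [e1, e2, e3, ← Complex.exp_add]
  congr 1
  ring

end IsGaussianSpace

/-- A linear form in Av is a linear form Σ bₖvₖ in independent standard Gaussians; its
characteristic function is a product, and the variance is Σ|bₖ|². -/
lemma isCG_of_isComplexGaussianLaw [IsProbabilityMeasure P] {n : ℕ} {V : Ω → Fin n → ℂ}
    (hV : Measurable V) (hlaw : IsComplexGaussianLaw (P.map V)) (a : Fin n → ℂ) :
    ∃ q, IsCG P q (fun ω => ∑ i, a i * V ω i) := by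
  obtain ⟨m, A, hA⟩ := hlaw
  set b : Fin m → ℂ := fun k => ∑ i, a i * A i k with hb
  refine ⟨∑ k, ‖b k‖ ^ 2, IsCG.of_charFun (by fun_prop) (Finset.sum_nonneg fun _ _ => by positivity)
    fun c => ?_⟩
  have h1 : P.map (fun ω => ∑ i, a i * V ω i) =
      (Measure.pi (fun _ : Fin m => stdComplexGaussian)).map (fun v => ∑ k, b k * v k) := by
    have e : (fun ω => ∑ i, a i * V ω i) = (fun x : Fin n → ℂ => ∑ i, a i * x i) ∘ V := rfl
    have hAm : Measurable fun v : Fin m → ℂ => A.mulVec v := by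
      unfold Matrix.mulVec dotProduct; fun_prop
    rw [e, ← Measure.map_map (by fun_prop) hV, hA, Measure.map_map (by fun_prop) hAm]
    congr 1
    ext v
    simp only [Function.comp, Matrix.mulVec, dotProduct, hb, Finset.mul_sum, Finset.sum_mul]
    rw [Finset.sum_comm]
    simp only [mul_assoc]
  have hbm : Measurable fun v : Fin m → ℂ => ∑ k, b k * v k :=
    Finset.measurable_sum _ fun k _ => (measurable_pi_apply k).const_mul _
  rw [h1, charFun_apply, integral_map hbm.aemeasurable (by fun_prop)]
  have e : ∀ v : Fin m → ℂ, Complex.exp (inner ℝ (∑ k, b k * v k) c * Complex.I) =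
      ∏ k, Complex.exp (inner ℝ (v k) ((starRingEnd ℂ) (b k) * c) * Complex.I) := fun v => by
    rw [← Complex.exp_sum, ← Finset.sum_mul, sum_inner]
    congr 2
    push_cast
    refine Finset.sum_congr rfl fun k _ => ?_
    simp only [Complex.inner, map_mul]
    congr 2; ring
  simp_rw [e]
  rw [integral_fintype_prod_eq_prod
    (f := fun k z => Complex.exp (inner ℝ z ((starRingEnd ℂ) (b k) * c) * Complex.I))]
  simp_rw [← charFun_apply, charFun_stdComplexGaussian, norm_mul, RCLike.norm_conj]
  rw [← Complex.exp_sum]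
  congr 1
  push_cast
  rw [Finset.sum_mul, Finset.sum_div, ← Finset.sum_neg_distrib]
  simp only [mul_pow]

lemma IsComplexGaussianProcess.isGaussianSpace [IsProbabilityMeasure P] {f : ℝ → Ω → ℂ}
    (hf : IsComplexGaussianProcess f P) :
    IsGaussianSpace P (Submodule.span ℂ (range f)) := by
  intro Y hY
  obtain ⟨n, a, g, rfl⟩ := Submodule.mem_span_set'.1 hY
  choose t ht using fun i => (g i).2
  obtain ⟨q, hq⟩ := isCG_of_isComplexGaussianLaw (V := fun ω i => f (t i) ω)
    (measurable_pi_lambda _ fun i => hf.measurable (t i)) (hf.gaussian n t) a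
  refine ⟨q, ?_⟩
  convert! hq using 1
  ext ω
  simp [← ht]

end

/-! ### The covariance kernel: smoothness and the set where |r| = 1. -/

section

namespace IsSpectralMeasure
variable {ρ : Measure ℝ} {r : ℝ → ℂ} (h : IsSpectralMeasure ρ r)
include h

lemma eq_charFun (t : ℝ) : r t = charFun ρ (-t) := by
  rw [h.fourier, charFun_apply_real]
  congr 1; ext l; congr 1; push_cast; ring

lemma contDiff (h2 : MemLp id 2 ρ) : ContDiff ℝ 2 r := by
  have := h.isProbability
  have e : r = charFun ρ ∘ fun t => -t := funext h.eq_charFun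
  rw [e]
  exact (contDiff_charFun (n := 2) (by exact_mod_cast h2)).comp contDiff_neg

lemma zero : r 0 = 1 := by
  have := h.isProbability
  rw [h.eq_charFun]; simp

lemma neg (t : ℝ) : r (-t) = (starRingEnd ℂ) (r t) := by
  rw [h.eq_charFun, h.eq_charFun, ← charFun_neg]

lemma norm_le_one (t : ℝ) : ‖r t‖ ≤ 1 := by
  have := h.isProbability
  rw [h.eq_charFun]; exact norm_charFun_le_one _

lemma deriv_neg (t : ℝ) : deriv r (-t) = -(starRingEnd ℂ) (deriv r t) := by
  have e : (fun x => r (-x)) = fun x => star (r x) := funext h.neg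
  have h1 : deriv (fun x => r (-x)) t = -deriv r (-t) := deriv_comp_neg r t
  rw [e, deriv.star] at h1
  rw [← neg_eq_iff_eq_neg, ← h1]; rfl

lemma deriv_zero_re : (deriv r 0).re = 0 := by
  have := congrArg Complex.re (h.deriv_neg 0)
  simp at this
  linarith

/-- Equality in |∫ exp(-ixl) dρ| ≤ 1 forces exp(-ixl) = r(x) for ρ-almost every l, whence r(x+t) =
r(x)r(t). Near any point with |r| = 1, |r| is thus a translate of |r| near 0. -/
lemma norm_add_of_norm_eq_one {x : ℝ} (hx : ‖r x‖ = 1) (t : ℝ) : ‖r (x + t)‖ = ‖r t‖ := by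
  have := h.isProbability
  have hae : ∀ᵐ l : ℝ ∂ρ, Complex.exp (-Complex.I * (x : ℂ) * (l : ℂ)) = r x := by
    have hi : Integrable (fun l : ℝ => ‖Complex.exp (-Complex.I * (x : ℂ) * (l : ℂ)) - r x‖ ^ 2) ρ := by
      refine Integrable.of_bound (Continuous.aestronglyMeasurable (by fun_prop)) 4 (ae_of_all _ fun l => ?_)
      rw [norm_pow, norm_norm]
      have : ‖Complex.exp (-Complex.I * (x : ℂ) * (l : ℂ)) - r x‖ ≤ 1 + 1 := by
        refine (norm_sub_le _ _).trans (add_le_add (le_of_eq ?_) hx.le)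
        rw [Complex.norm_exp]; simp
      nlinarith [norm_nonneg (Complex.exp (-Complex.I * (x : ℂ) * (l : ℂ)) - r x)]
    have hz : ∫ l, ‖Complex.exp (-Complex.I * (x : ℂ) * (l : ℂ)) - r x‖ ^ 2 ∂ρ = 0 := by
      have e : ∀ l : ℝ, ‖Complex.exp (-Complex.I * (x : ℂ) * (l : ℂ)) - r x‖ ^ 2 =
          2 - 2 * (Complex.exp (-Complex.I * (x : ℂ) * (l : ℂ)) * (starRingEnd ℂ) (r x)).re := by
        intro l
        rw [← Complex.normSq_eq_norm_sq, Complex.normSq_sub, Complex.normSq_eq_norm_sq,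
          Complex.normSq_eq_norm_sq, hx, Complex.norm_exp]
        simp; norm_num
      have hie : Integrable (fun l : ℝ =>
          Complex.exp (-Complex.I * (x : ℂ) * (l : ℂ)) * (starRingEnd ℂ) (r x)) ρ := by
        refine Integrable.of_bound (by fun_prop) 1 (ae_of_all _ fun l => ?_)
        rw [norm_mul, RCLike.norm_conj, hx, Complex.norm_exp]; simp
      simp_rw [e]
      have hre := integral_re hie
      have hie' := hie.re
      simp only [RCLike.re_to_complex] at hre hie'
      rw [integral_sub (integrable_const _) (hie'.const_mul 2), integral_const_mul, hre, integral_mul_const, ← h.fourier, Complex.mul_conj, Complex.normSq_eq_norm_sq, hx]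
      simp
    have := (integral_eq_zero_iff_of_nonneg (fun l => by positivity) hi).1 hz
    filter_upwards [this] with l hl
    simpa [sub_eq_zero] using hl
  have : r (x + t) = r x * r t := by
    rw [h.fourier (x + t), h.fourier t, ← integral_const_mul]
    refine integral_congr_ae ?_
    filter_upwards [hae] with l hl
    rw [← hl, ← Complex.exp_add]; congr 1; push_cast; ring
  rw [this, norm_mul, hx, one_mul]

/-- A measure that is not a point mass has positive variance V. Centring ρ only multiplies r by a
phase, so |r| is the modulus of a standardised characteristic function, 1 - t²/2 + o(t²) at t of
size √V|x|. -/
lemma exists_sq_le (h2 : MemLp id 2 ρ) (hnd : ¬ ∃ φ : ℝ, ρ = Measure.dirac φ) :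
    ∃ c δ : ℝ, 0 < c ∧ 0 < δ ∧ ∀ x, |x| < δ → c * x ^ 2 ≤ 1 - ‖r x‖ ^ 2 := by
  have := h.isProbability
  set m := ∫ l, l ∂ρ with hm
  set V := ∫ l, (l - m) ^ 2 ∂ρ with hV
  have h1 : Integrable (fun l : ℝ => l) ρ := h2.integrable (by norm_num)
  have hi : Integrable (fun l : ℝ => (l - m) ^ 2) ρ :=
    (h2.sub (memLp_const m)).integrable_sq
  have hV0 : 0 < V := by
    rcases (integral_nonneg (fun l => sq_nonneg (l - m)) : 0 ≤ V).lt_or_eq with h0 | h0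
    · exact h0
    · exfalso
      have := (integral_eq_zero_iff_of_nonneg (fun l => sq_nonneg (l - m)) hi).1 h0.symm
      refine hnd ⟨m, ?_⟩
      have hae : (fun l : ℝ => l) =ᵐ[ρ] fun _ => m := by
        filter_upwards [this] with l hl
        simpa [sub_eq_zero] using hl
      have h3 : ρ.map (fun l : ℝ => l) = ρ.map fun _ => m := Measure.map_congr hae
      rw [Measure.map_id', Measure.map_const] at h3
      simpa using h3
  set s := Real.sqrt V with hs
  have hs0 : 0 < s := Real.sqrt_pos.2 hV0
  have hs2 : s ^ 2 = V := Real.sq_sqrt hV0.le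
  have ht := taylor_charFun_two (P := ρ) (X := fun l => (l - m) / s) (by fun_prop)
    (by rw [integral_div, integral_sub h1 (integrable_const _)]; simp [hm])
    (by
      simp only [Pi.pow_apply, div_pow]
      rw [integral_div, ← hV, hs2, div_self hV0.ne'])
  have hnorm : ∀ x, ‖r x‖ = ‖charFun (ρ.map fun l => (l - m) / s) (-(s * x))‖ := fun x => by
    rw [charFun_apply_real, integral_map (by fun_prop) (by fun_prop), h.fourier]
    have e : ∀ l : ℝ, Complex.exp (((-(s * x) : ℝ) : ℂ) * (((l - m) / s : ℝ) : ℂ) * Complex.I) =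
        Complex.exp (((x * m : ℝ) : ℂ) * Complex.I) *
          Complex.exp (-Complex.I * (x : ℂ) * (l : ℂ)) := fun l => by
      rw [← Complex.exp_add]
      have : (s : ℂ) ≠ 0 := by exact_mod_cast hs0.ne'
      congr 1; push_cast; field_simp; ring
    simp_rw [e]
    rw [integral_const_mul, norm_mul, Complex.norm_exp_ofReal_mul_I, one_mul]
  -- Spending half of t²/2 on the remainder gives |φ(t)| ≤ 1 - t²/4, hence 1 - |φ(t)|² ≥ t²/4 =
  -- Vx²/4. The condition |t| < 1 keeps 1 - t²/2 positive.
  have hb := (ht.bound (show (0 : ℝ) < 1 / 4 by norm_num))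
  have hb2 : ∀ᶠ t : ℝ in 𝓝 0, |t| < 1 := by
    have := (continuous_abs (G := ℝ)).tendsto 0
    rw [abs_zero] at this
    exact this.eventually (gt_mem_nhds one_pos)
  obtain ⟨δ, hδ, hball⟩ := Metric.eventually_nhds_iff.1 (hb.and hb2)
  refine ⟨V / 4, δ / s, by positivity, by positivity, fun x hx => ?_⟩
  have hlt : dist (-(s * x)) 0 < δ := by
    rw [dist_zero_right, Real.norm_eq_abs, abs_neg, abs_mul, abs_of_pos hs0]
    rwa [lt_div_iff₀' hs0] at hx
  obtain ⟨h3, h4⟩ := hball hlt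
  rw [hnorm]
  set t := -(s * x) with htdef
  have ht2 : t ^ 2 = V * x ^ 2 := by rw [htdef, neg_sq, mul_pow, hs2]
  have ht1 : t ^ 2 < 1 := by
    rw [← sq_abs]; nlinarith [abs_nonneg t]
  have h5 : ‖charFun (ρ.map fun l => (l - m) / s) t‖ ≤ 1 - t ^ 2 / 4 := by
    have e : charFun (ρ.map fun l => (l - m) / s) t =
        (charFun (ρ.map fun l => (l - m) / s) t - (1 - t ^ 2 / 2)) + ((1 - t ^ 2 / 2 : ℝ) : ℂ) := by
      push_cast; ring
    have h6 := norm_add_le (charFun (ρ.map fun l => (l - m) / s) t - (1 - t ^ 2 / 2))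
      ((1 - t ^ 2 / 2 : ℝ) : ℂ)
    rw [← e, Complex.norm_real, Real.norm_of_nonneg (by linarith)] at h6
    rw [Real.norm_of_nonneg (sq_nonneg t)] at h3
    linarith
  have h7 := norm_nonneg (charFun (ρ.map fun l => (l - m) / s) t)
  nlinarith

lemma eventually_norm_lt_one (h2 : MemLp id 2 ρ) (hnd : ¬ ∃ φ : ℝ, ρ = Measure.dirac φ) (x₀ : ℝ) :
    ∀ᶠ x in 𝓝[≠] x₀, ‖r x‖ < 1 := by
  rcases (h.norm_le_one x₀).lt_or_eq with hx | hx
  · have hc : Continuous fun x => ‖r x‖ := (h.contDiff h2).continuous.norm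
    exact (hc.continuousAt.eventually (gt_mem_nhds hx)).filter_mono nhdsWithin_le_nhds
  · obtain ⟨c, δ, hc, hδ, hb⟩ := h.exists_sq_le h2 hnd
    rw [eventually_nhdsWithin_iff]
    filter_upwards [Metric.ball_mem_nhds x₀ hδ] with x hx1 hx2
    have h1 := hb (x - x₀) (by simpa [Real.dist_eq] using hx1)
    have h3 := h.norm_add_of_norm_eq_one hx (x - x₀)
    rw [add_sub_cancel] at h3
    rw [← h3] at h1
    have h4 : 0 < (x - x₀) ^ 2 := by
      have : x - x₀ ≠ 0 := sub_ne_zero.2 hx2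
      positivity
    nlinarith [norm_nonneg (r x), h.norm_le_one x, mul_pos hc h4]

lemma ae_norm_lt_one (h2 : MemLp id 2 ρ) (hnd : ¬ ∃ φ : ℝ, ρ = Measure.dirac φ) :
    ∀ᵐ x, ‖r x‖ < 1 := by
  refine measure_null_of_locally_null _ fun x₀ _ => ?_
  have h1 := h.eventually_norm_lt_one h2 hnd x₀
  refine ⟨{x | ‖r x‖ < 1}ᶜ ∩ ({x | ‖r x‖ < 1} ∪ {x₀}), ?_, ?_⟩
  · refine inter_mem self_mem_nhdsWithin (nhdsWithin_le_nhds ?_)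
    rw [eventually_nhdsWithin_iff] at h1
    filter_upwards [h1] with x hx
    by_cases hxx : x = x₀
    · right; exact hxx
    · left; exact hx hxx
  · refine measure_mono_null (t := {x₀}) (fun x hx => ?_) (measure_singleton _)
    exact hx.2.resolve_left hx.1

/-- At a point with |r| = 1 the quadratic lower bound, transported by translation, dominates the
function by a multiple of |t|^(-3/4), which is integrable on the line. -/
lemma locallyIntegrable_rpow (h2 : MemLp id 2 ρ) (hnd : ¬ ∃ φ : ℝ, ρ = Measure.dirac φ) :
    LocallyIntegrable fun x => (1 - ‖r x‖ ^ 2) ^ (-(3 / 8) : ℝ) := by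
  have hcr : Continuous r := (h.contDiff h2).continuous
  have hm : Measurable fun x => (1 - ‖r x‖ ^ 2) ^ (-(3 / 8) : ℝ) := by
    have := hcr.measurable
    fun_prop
  intro x₀
  rcases (h.norm_le_one x₀).lt_or_eq with hx | hx
  · have hc : ContinuousAt (fun x => (1 - ‖r x‖ ^ 2) ^ (-(3 / 8) : ℝ)) x₀ := by
      refine ContinuousAt.rpow_const (by fun_prop) (Or.inl ?_)
      nlinarith [norm_nonneg (r x₀)]
    exact hc.tendsto.integrableAtFilter hm.stronglyMeasurable.stronglyMeasurableAtFilter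
      (volume.finiteAt_nhds x₀)
  · obtain ⟨c, δ, hc, hδ, hb⟩ := h.exists_sq_le h2 hnd
    have key : IntegrableOn (fun t => (1 - ‖r t‖ ^ 2) ^ (-(3 / 8) : ℝ)) (Metric.ball 0 δ) := by
      refine integrableOn_ball_of_norm_le_rpow (C := c ^ (-(3 / 8) : ℝ)) (α := 3 / 4) (by simp)
        (by simp; norm_num) ?_ hm.aestronglyMeasurable
      have hne : ∀ᵐ t ∂(volume.restrict (Metric.ball (0 : ℝ) δ)), t ≠ 0 :=
        ae_restrict_of_ae (Measure.ae_ne volume 0)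
      filter_upwards [ae_restrict_mem measurableSet_ball, hne] with t ht ht0
      have h1 := hb t (by simpa using ht)
      have h3 : 0 < c * t ^ 2 := by positivity
      rw [Real.norm_of_nonneg (Real.rpow_nonneg (h3.le.trans h1) _)]
      refine (Real.rpow_le_rpow_of_nonpos h3 h1 (by norm_num)).trans (le_of_eq ?_)
      rw [Real.mul_rpow hc.le (sq_nonneg _), ← sq_abs, Real.norm_eq_abs, ← Real.rpow_natCast,
        ← Real.rpow_mul (abs_nonneg _)]
      norm_num
    refine ⟨Metric.ball x₀ δ, Metric.ball_mem_nhds _ hδ, ?_⟩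
    have h3 : (fun x => (1 - ‖r x‖ ^ 2) ^ (-(3 / 8) : ℝ)) =
        (fun t => (1 - ‖r t‖ ^ 2) ^ (-(3 / 8) : ℝ)) ∘ fun x => x - x₀ := by
      ext x
      have := h.norm_add_of_norm_eq_one hx (x - x₀)
      rw [add_sub_cancel] at this
      simp [this]
    have h4 : Metric.ball x₀ δ = (fun x => x - x₀) ⁻¹' Metric.ball 0 δ := by
      ext x; simp [Real.dist_eq]
    rw [h3, h4, (measurePreserving_sub_right volume x₀).integrableOn_comp_preimage
      (MeasurableEquiv.subRight x₀).measurableEmbedding]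
    exact key

end IsSpectralMeasure

end

/-! ### A deterministic criterion for C¹ paths by slopes on nested grids. -/

section

/-- The number of cells per unit length of the `n`-th grid. -/
def gridSize (n : ℕ) : ℕ := 2 ^ 2 ^ n

lemma gridSize_pos (n : ℕ) : 0 < gridSize n := by unfold gridSize; positivity

lemma gridSize_pos' (n : ℕ) : (0 : ℝ) < gridSize n := by exact_mod_cast gridSize_pos n

/-- A cell splits into `gridSize n` cells of the next grid. Squaring makes log(`gridSize n`) = 2^n
log 2 geometric in n, so that a logarithmic moment yields summable errors. -/
lemma gridSize_succ (n : ℕ) : gridSize (n + 1) = gridSize n * gridSize n := by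
  unfold gridSize; rw [← pow_add]; congr 1; ring

lemma tendsto_gridSize : Tendsto (fun n => (gridSize n : ℝ)) atTop atTop := by
  refine tendsto_natCast_atTop_atTop.comp (tendsto_atTop_mono (fun n => ?_) tendsto_id)
  exact (Nat.lt_two_pow_self (n := n)).le.trans
    (Nat.pow_le_pow_right two_pos (Nat.lt_two_pow_self (n := n)).le)

/-- The slope of `f` over the `j`-th cell of the `n`-th grid. -/
noncomputable def gridSlope (f : ℝ → ℂ) (n : ℕ) (j : ℤ) : ℂ :=
  (gridSize n : ℂ) * (f ((j + 1) / gridSize n) - f (j / gridSize n))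

/-- The slopes of `f` on the `n`-th grid are `ε`-close to those on neighbouring cells and on
the subcells of the next grid, over the interval `[-n, n]`. -/
def GridRegular (f : ℝ → ℂ) (n : ℕ) (ε : ℝ) : Prop :=
  ∀ j : ℤ, |j| ≤ n * gridSize n → ‖gridSlope f n (j + 1) - gridSlope f n j‖ ≤ ε ∧
    ∀ k : ℕ, k < gridSize n →
      ‖gridSlope f (n + 1) (j * gridSize n + k) - gridSlope f n j‖ ≤ ε

lemma abs_floor_mul_le {t : ℝ} {L n N : ℕ} (hN : 0 < N) (ht : |t| ≤ L) (hn : L + 1 ≤ n) :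
    |⌊t * N⌋| ≤ n * N := by
  have hN' : (1 : ℝ) ≤ N := by exact_mod_cast hN
  have hn' : (L : ℝ) + 1 ≤ n := by exact_mod_cast hn
  rw [abs_le] at ht ⊢
  have h1 := Int.floor_le (t * N)
  have h2 := Int.lt_floor_add_one (t * N)
  have hA : (n : ℝ) * N ≥ (L + 1) * N := by nlinarith
  constructor
  · have : (-(n * N) : ℝ) ≤ (⌊t * N⌋ : ℝ) := by nlinarith
    exact_mod_cast this
  · have : (⌊t * N⌋ : ℝ) ≤ (n * N : ℝ) := by nlinarith
    exact_mod_cast this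

lemma floor_mul_sq (t : ℝ) {N : ℕ} (hN : 0 < N) :
    ∃ k : ℕ, k < N ∧ ⌊t * ((N * N : ℕ) : ℝ)⌋ = ⌊t * N⌋ * N + k := by
  have hN' : (0 : ℝ) < N := by exact_mod_cast hN
  have h1 := Int.floor_le (t * N)
  have h2 := Int.lt_floor_add_one (t * N)
  have e : t * ((N * N : ℕ) : ℝ) = t * N * N := by push_cast; ring
  have h3 : ⌊t * N⌋ * N ≤ ⌊t * ((N * N : ℕ) : ℝ)⌋ := by
    rw [Int.le_floor, e]; push_cast; nlinarith
  have h4 : ⌊t * ((N * N : ℕ) : ℝ)⌋ < ⌊t * N⌋ * N + N := by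
    rw [Int.floor_lt, e]; push_cast; nlinarith
  obtain ⟨k, hk⟩ := Int.eq_ofNat_of_zero_le (sub_nonneg.2 h3)
  refine ⟨k, ?_, by omega⟩
  have : (k : ℤ) < N := by omega
  exact_mod_cast this

lemma tendsto_floor_mul_div (x : ℝ) :
    Tendsto (fun N : ℝ => (⌊x * N⌋ / N : ℝ)) atTop (𝓝 x) := by
  have h1 : Tendsto (fun N : ℝ => x - N⁻¹) atTop (𝓝 x) := by
    simpa using (tendsto_const_nhds (x := x)).sub (tendsto_inv_atTop_zero (𝕜 := ℝ))
  refine tendsto_of_tendsto_of_tendsto_of_le_of_le' h1 tendsto_const_nhds ?_ ?_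
  · filter_upwards [eventually_gt_atTop 0] with N hN
    rw [le_div_iff₀ hN, sub_mul, inv_mul_cancel₀ hN.ne']
    linarith [Int.lt_floor_add_one (x * N)]
  · filter_upwards [eventually_gt_atTop 0] with N hN
    rw [div_le_iff₀ hN]
    exact Int.floor_le _

/-- The slope over the cell containing t is uniformly Cauchy in the level on [-L,L], and agrees up
to ε across neighbouring cells, so its limit g is continuous. The function f - ∫g changes by o(cell
length) over each cell; adding up, it is constant. -/
lemma hasDerivAt_of_gridRegular {f : ℝ → ℂ} (hf : Continuous f) {ε : ℕ → ℝ} (hε : Summable ε)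
    (hreg : ∀ᶠ n in atTop, GridRegular f n (ε n)) (L : ℕ) :
    ∃ g : ℝ → ℂ, Continuous g ∧ ∀ x ∈ Ioo (-L : ℝ) L, HasDerivAt f (g x) x := by
  obtain ⟨n₀, hn₀⟩ := eventually_atTop.1 hreg
  -- From level L+1 on, the cell of any t in [-L,L] has index within the range controlled by
  -- `GridRegular`, rounding down included.
  set n₁ := max n₀ (L + 1) with hn₁
  set G : ℕ → ℝ → ℂ := fun k t => gridSlope f (n₁ + k) ⌊t * gridSize (n₁ + k)⌋ with hG
  set e : ℕ → ℝ := fun k => ε (n₁ + k) with he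
  have hes : Summable e := by
    simpa [he, add_comm] using (summable_nat_add_iff n₁).2 hε
  have hR : ∀ k, GridRegular f (n₁ + k) (e k) := fun k =>
    hn₀ _ ((le_max_left _ _).trans (Nat.le_add_right _ _))
  have hfl : ∀ k t, |t| ≤ (L : ℝ) →
      |⌊t * gridSize (n₁ + k)⌋| ≤ ((n₁ + k : ℕ) : ℤ) * gridSize (n₁ + k) := fun k t ht =>
    abs_floor_mul_le (gridSize_pos _) ht ((le_max_right _ _).trans (Nat.le_add_right _ _))
  have hstep : ∀ t, |t| ≤ (L : ℝ) → ∀ k, dist (G k t) (G (k + 1) t) ≤ e k := fun t ht k => by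
    obtain ⟨m, hm, hm'⟩ := floor_mul_sq t (gridSize_pos (n₁ + k))
    have := ((hR k) _ (hfl k t ht)).2 m hm
    rw [← hm', ← gridSize_succ] at this
    rw [dist_comm, dist_eq_norm]
    exact this
  have hlim : ∀ t, ∃ a, |t| ≤ (L : ℝ) → Tendsto (fun k => G k t) atTop (𝓝 a) := fun t => by
    by_cases ht : |t| ≤ (L : ℝ)
    · obtain ⟨a, ha⟩ := cauchySeq_tendsto_of_complete
        (cauchySeq_of_dist_le_of_summable e (hstep t ht) hes)
      exact ⟨a, fun _ => ha⟩
    · exact ⟨0, fun h => absurd h ht⟩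
  choose g hg using hlim
  set d : ℕ → ℝ := fun k => ∑' m, e (k + m) with hd
  have hdlim : Tendsto d atTop (𝓝 0) := by
    simpa [hd, add_comm] using tendsto_sum_nat_add e
  have helim : Tendsto e atTop (𝓝 0) := hes.tendsto_atTop_zero
  have hgd : ∀ t, |t| ≤ (L : ℝ) → ∀ k, dist (G k t) (g t) ≤ d k := fun t ht k =>
    dist_le_tsum_of_dist_le_of_tendsto e (hstep t ht) hes (hg t ht) k
  have hadj : ∀ k x y, |x| ≤ (L : ℝ) → |y| ≤ (L : ℝ) → x ≤ y → (y - x) * gridSize (n₁ + k) ≤ 1 →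
      dist (G k x) (G k y) ≤ e k := by
    intro k x y hx hy hxy hd1
    have hN := gridSize_pos' (n₁ + k)
    have h1 : ⌊x * gridSize (n₁ + k)⌋ ≤ ⌊y * gridSize (n₁ + k)⌋ :=
      Int.floor_le_floor (by nlinarith)
    have h2 : ⌊y * gridSize (n₁ + k)⌋ ≤ ⌊x * gridSize (n₁ + k)⌋ + 1 := by
      rw [← Int.floor_add_one]; exact Int.floor_le_floor (by nlinarith)
    have h3 := (hR k _ (hfl k x hx)).1
    rcases h1.eq_or_lt with h4 | h4
    · simp only [hG, h4, dist_self]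
      exact (norm_nonneg _).trans h3
    · have h5 : ⌊y * gridSize (n₁ + k)⌋ = ⌊x * gridSize (n₁ + k)⌋ + 1 := by omega
      rw [dist_comm, dist_eq_norm]
      simp only [hG, h5]
      exact h3
  have hgadj : ∀ k x y, |x| ≤ (L : ℝ) → |y| ≤ (L : ℝ) → x ≤ y →
      (y - x) * gridSize (n₁ + k) ≤ 1 → dist (G k x) (g y) ≤ e k + d k := fun k x y hx hy hxy h1 =>
    (dist_triangle _ (G k y) _).trans (add_le_add (hadj k x y hx hy hxy h1) (hgd y hy k))
  have hLL : (-L : ℝ) ≤ L := by have : (0 : ℝ) ≤ L := Nat.cast_nonneg L; linarith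
  have hmem : ∀ {x}, x ∈ Icc (-L : ℝ) L ↔ |x| ≤ (L : ℝ) := fun {x} => by rw [mem_Icc, abs_le]
  have hgc : ContinuousOn g (Icc (-L : ℝ) L) := by
    have key : ∀ k x y, |x| ≤ (L : ℝ) → |y| ≤ (L : ℝ) → x ≤ y →
        (y - x) * gridSize (n₁ + k) ≤ 1 → dist (g x) (g y) ≤ d k + (e k + d k) :=
      fun k x y hx hy hxy h1 => (dist_triangle _ (G k x) _).trans
        (add_le_add (by rw [dist_comm]; exact hgd x hx k) (hgadj k x y hx hy hxy h1))
    rw [Metric.continuousOn_iff]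
    intro x hx η hη
    have h0 : Tendsto (fun k => d k + (e k + d k)) atTop (𝓝 0) := by
      simpa using hdlim.add (helim.add hdlim)
    obtain ⟨k, hk⟩ := (h0.eventually (gt_mem_nhds hη)).exists
    have hN := gridSize_pos' (n₁ + k)
    refine ⟨1 / gridSize (n₁ + k), by positivity, fun y hy hyx => ?_⟩
    rw [Real.dist_eq, lt_div_iff₀ hN] at hyx
    rcases le_total x y with hxy | hxy
    · rw [abs_of_nonneg (by linarith)] at hyx
      rw [dist_comm]
      exact (key k x y (hmem.1 hx) (hmem.1 hy) hxy hyx.le).trans_lt hk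
    · rw [abs_of_nonpos (by linarith), neg_sub] at hyx
      exact (key k y x (hmem.1 hy) (hmem.1 hx) hxy hyx.le).trans_lt hk
  -- Constant extension beyond [-L,L] replaces the arbitrary values of g there, so that the
  -- primitive is differentiable everywhere.
  set g' : ℝ → ℂ := IccExtend hLL ((Icc (-L : ℝ) L).domRestrict g) with hg'
  have hg'c : Continuous g' := (continuousOn_iff_continuous_domRestrict.1 hgc).Icc_extend'
  have hg'e : ∀ x, |x| ≤ (L : ℝ) → g' x = g x := fun x hx => by
    rw [hg', IccExtend_of_mem hLL _ (hmem.2 hx)]; rfl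
  refine ⟨g', hg'c, ?_⟩
  set H : ℝ → ℂ := fun t => f t - ∫ s in (0 : ℝ)..t, g' s with hH
  have hΦ : ∀ t, HasDerivAt (fun t => ∫ s in (0 : ℝ)..t, g' s) (g' t) t := fun t =>
    intervalIntegral.integral_hasDerivAt_right (hg'c.intervalIntegrable _ _)
      hg'c.stronglyMeasurable.stronglyMeasurableAtFilter hg'c.continuousAt
  have hHc : Continuous H := hf.sub (continuous_iff_continuousAt.2 fun t => (hΦ t).continuousAt)
  have hcell : ∀ k (i : ℤ), |(i / gridSize (n₁ + k) : ℝ)| ≤ L →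
      |((i + 1) / gridSize (n₁ + k) : ℝ)| ≤ L →
      ‖H ((i + 1) / gridSize (n₁ + k)) - H (i / gridSize (n₁ + k))‖ ≤
        (e k + d k) / gridSize (n₁ + k) := by
    intro k i h1 h2
    have hN := gridSize_pos' (n₁ + k)
    set N : ℝ := ((gridSize (n₁ + k) : ℕ) : ℝ) with hNdef
    have hN0 : (N : ℂ) ≠ 0 := by exact_mod_cast hN.ne'
    have hlen : (i + 1) / N - i / N = 1 / N := by field_simp; ring
    have e1 : H ((i + 1) / N) - H (i / N) =
        ∫ s in (i / N)..((i + 1) / N), (gridSlope f (n₁ + k) i - g' s) := by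
      rw [intervalIntegral.integral_sub (by simp) (hg'c.intervalIntegrable _ _),
        intervalIntegral.integral_const, hlen,
        ← intervalIntegral.integral_interval_sub_left (hg'c.intervalIntegrable 0 ((i + 1) / N))
          (hg'c.intervalIntegrable 0 (i / N)), hH, gridSlope, Complex.real_smul]
      have : ((gridSize (n₁ + k) : ℕ) : ℂ) = (N : ℂ) := by rw [hNdef]; push_cast; rfl
      rw [this, ← hNdef]
      push_cast
      field_simp
      ring
    rw [e1]
    have hle : i / N ≤ (i + 1) / N := by gcongr; linarith
    refine (intervalIntegral.norm_integral_le_of_norm_le_const (C := e k + d k) fun s hs => ?_).trans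
      (le_of_eq ?_)
    · rw [uIoc_of_le hle] at hs
      have hs1 : |s| ≤ (L : ℝ) := by
        rw [abs_le] at h1 h2 ⊢; exact ⟨h1.1.trans hs.1.le, hs.2.trans h2.2⟩
      have h3 := hgadj k (i / N) s h1 hs1 hs.1.le (by
        rw [← hNdef]
        have : (s - i / N) ≤ 1 / N := by rw [← hlen]; linarith [hs.2]
        rwa [le_div_iff₀ hN] at this)
      rw [hg'e s hs1, ← dist_eq_norm]
      have h4 : ⌊(i / N : ℝ) * N⌋ = i := by
        rw [div_mul_cancel₀ _ hN.ne']; exact Int.floor_intCast i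
      simp only [hG, ← hNdef, h4] at h3
      exact h3
    · rw [hlen, abs_of_pos (by positivity)]; ring
  have hcells : ∀ k (i : ℤ) (m : ℕ), |(i / gridSize (n₁ + k) : ℝ)| ≤ L →
      |((i + m) / gridSize (n₁ + k) : ℝ)| ≤ L →
      ‖H ((i + m) / gridSize (n₁ + k)) - H (i / gridSize (n₁ + k))‖ ≤
        m * ((e k + d k) / gridSize (n₁ + k)) := by
    intro k i m h1
    have hN := gridSize_pos' (n₁ + k)
    induction m with
    | zero => intro _; simp
    | succ m ih =>
      intro h2
      have h3 : |((i + m) / gridSize (n₁ + k) : ℝ)| ≤ L := by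
        rw [abs_le] at h1 h2 ⊢
        refine ⟨h1.1.trans ?_, le_trans ?_ h2.2⟩
        · gcongr; linarith [Nat.cast_nonneg (α := ℝ) m]
        · gcongr; linarith
      have h4 := hcell k (i + m) (by push_cast; exact h3) (by
        push_cast at h2 ⊢; rwa [add_assoc])
      have h5 := ih h3
      push_cast at h4 ⊢
      rw [← add_assoc]
      calc _ ≤ _ := norm_sub_le_norm_sub_add_norm_sub _ (H ((i + m) / gridSize (n₁ + k))) _
        _ ≤ _ := add_le_add h4 h5
        _ = _ := by ring
  have hNlim : Tendsto (fun k => (gridSize (n₁ + k) : ℝ)) atTop atTop := by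
    have := (tendsto_add_atTop_iff_nat (f := fun n => (gridSize n : ℝ)) n₁).2 tendsto_gridSize
    simpa [add_comm] using this
  have happrox : ∀ x : ℝ, Tendsto (fun k => (⌊x * gridSize (n₁ + k)⌋ / gridSize (n₁ + k) : ℝ)) atTop
      (𝓝 x) := fun x => (tendsto_floor_mul_div x).comp hNlim
  -- Between the grid points a, b just below x, y there are (b-a)N cells, each contributing at most
  -- (e+d)/N; the total (b-a)(e+d) tends to 0, and H is continuous.
  have hconst : ∀ x ∈ Ioo (-L : ℝ) L, ∀ y ∈ Ioo (-L : ℝ) L, x ≤ y → H y = H x := by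
    intro x hx y hy hxy
    set a : ℕ → ℝ := fun k => (⌊x * gridSize (n₁ + k)⌋ / gridSize (n₁ + k) : ℝ) with ha
    set b : ℕ → ℝ := fun k => (⌊y * gridSize (n₁ + k)⌋ / gridSize (n₁ + k) : ℝ) with hb
    have hlim1 : Tendsto (fun k => ‖H (b k) - H (a k)‖) atTop (𝓝 ‖H y - H x‖) :=
      (((hHc.tendsto y).comp (happrox y)).sub ((hHc.tendsto x).comp (happrox x))).norm
    have hlim2 : Tendsto (fun k => (b k - a k) * (e k + d k)) atTop (𝓝 0) := by
      simpa using ((happrox y).sub (happrox x)).mul (helim.add hdlim)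
    have hev : ∀ᶠ k in atTop, ‖H (b k) - H (a k)‖ ≤ (b k - a k) * (e k + d k) := by
      filter_upwards [(happrox x).eventually (Ioo_mem_nhds hx.1 hx.2),
        (happrox y).eventually (Ioo_mem_nhds hy.1 hy.2)] with k hk1 hk2
      have hN := gridSize_pos' (n₁ + k)
      have h1 : ⌊x * gridSize (n₁ + k)⌋ ≤ ⌊y * gridSize (n₁ + k)⌋ :=
        Int.floor_le_floor (by nlinarith)
      obtain ⟨m, hm⟩ := Int.eq_ofNat_of_zero_le (sub_nonneg.2 h1)
      have h2 : (⌊y * gridSize (n₁ + k)⌋ : ℝ) = ⌊x * gridSize (n₁ + k)⌋ + m := by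
        have : ⌊y * gridSize (n₁ + k)⌋ = ⌊x * gridSize (n₁ + k)⌋ + m := by omega
        rw [this]; push_cast; rfl
      have h3 := hcells k ⌊x * gridSize (n₁ + k)⌋ m (abs_le.2 ⟨hk1.1.le, hk1.2.le⟩)
        (by rw [← h2]; exact abs_le.2 ⟨hk2.1.le, hk2.2.le⟩)
      rw [← h2] at h3
      refine h3.trans (le_of_eq ?_)
      simp only [ha, hb, h2]
      field_simp
      ring
    have h0 := le_of_tendsto_of_tendsto hlim1 hlim2 hev
    have h1 := norm_le_zero_iff.1 h0
    exact sub_eq_zero.1 h1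
  intro x hx
  have hev : ∀ᶠ y in 𝓝 x, f y = H x + ∫ s in (0 : ℝ)..y, g' s := by
    filter_upwards [Ioo_mem_nhds hx.1 hx.2] with y hy
    have : H y = H x := by
      rcases le_total x y with h | h
      · exact hconst x hx y hy h
      · exact (hconst y hy x hx h).symm
    rw [← this, hH]; ring
  exact ((hΦ x).const_add (H x)).congr_of_eventuallyEq hev

lemma contDiff_of_gridRegular {f : ℝ → ℂ} (hf : Continuous f) {ε : ℕ → ℝ} (hε : Summable ε)
    (hreg : ∀ᶠ n in atTop, GridRegular f n (ε n)) : ContDiff ℝ 1 f := by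
  have key : ∀ x : ℝ, ∃ L : ℕ, x ∈ Ioo (-L : ℝ) L := fun x => by
    obtain ⟨L, hL⟩ := exists_nat_gt |x|
    exact ⟨L, abs_lt.1 hL⟩
  rw [contDiff_one_iff_deriv]
  constructor
  · intro x
    obtain ⟨L, hL⟩ := key x
    obtain ⟨g, -, hg⟩ := hasDerivAt_of_gridRegular hf hε hreg L
    exact (hg x hL).differentiableAt
  · rw [continuous_iff_continuousAt]
    intro x
    obtain ⟨L, hL⟩ := key x
    obtain ⟨g, hgc, hg⟩ := hasDerivAt_of_gridRegular hf hε hreg L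
    refine hgc.continuousAt.congr ?_
    filter_upwards [Ioo_mem_nhds hL.1 hL.2] with y hy
    exact (hg y hy).deriv.symm

end

/-! ### Spectral isometry and slopes of exponentials. -/

section

variable {Ω : Type*} [MeasurableSpace Ω] {P : Measure Ω}

lemma cov_eq_covKernel {f : ℝ → Ω → ℂ} (hm : ∀ t, Measurable (f t)) (hstat : IsStationary f P)
    (s t : ℝ) : cov P (f s) (f t) = covKernel f P (s - t) := by
  have h := hstat 2 ![s - t, 0] t
  have hφ : Measurable fun v : Fin 2 → ℂ => v 0 * (starRingEnd ℂ) (v 1) :=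
    (measurable_pi_apply 0).mul (Complex.continuous_conj.measurable.comp (measurable_pi_apply 1))
  have h1 := congrArg (fun ν => ∫ v, v 0 * (starRingEnd ℂ) (v 1) ∂ν) h
  rw [integral_map (measurable_pi_lambda _ fun i => hm _).aemeasurable hφ.aestronglyMeasurable,
    integral_map (measurable_pi_lambda _ fun i => hm _).aemeasurable hφ.aestronglyMeasurable] at h1
  simpa [cov, covKernel] using h1

section spectral
variable {ρ : Measure ℝ} {f : ℝ → Ω → ℂ}

/-- The spectral isometry on finite linear combinations. -/
lemma integral_norm_sq_sum {H : Submodule ℂ (Ω → ℂ)} (hH : IsGaussianSpace P H)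
    (hf : ∀ t, f t ∈ H) (hcov : ∀ s t, cov P (f s) (f t) = covKernel f P (s - t))
    (hspec : IsSpectralMeasure ρ (covKernel f P)) {ι : Type*} [Fintype ι] (a : ι → ℂ)
    (t : ι → ℝ) :
    ∫ ω, ‖∑ i, a i * f (t i) ω‖ ^ 2 ∂P =
      ∫ l : ℝ, ‖∑ i, a i * Complex.exp (-Complex.I * t i * l)‖ ^ 2 ∂ρ := by
  have := hspec.isProbability
  have e : ∀ x : ℂ, ((‖x‖ ^ 2 : ℝ) : ℂ) = x * (starRingEnd ℂ) x := fun x => by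
    rw [Complex.mul_conj, Complex.normSq_eq_norm_sq]
  have e2 : ∀ u : ι → ℂ, (((‖∑ i, a i * u i‖ ^ 2 : ℝ)) : ℂ) =
      ∑ i, ∑ j, a i * (starRingEnd ℂ) (a j) * (u i * (starRingEnd ℂ) (u j)) := fun u => by
    rw [e, map_sum, Finset.sum_mul_sum]
    refine Finset.sum_congr rfl fun i _ => Finset.sum_congr rfl fun j _ => ?_
    rw [map_mul]; ring
  rw [← Complex.ofReal_inj, ← integral_complex_ofReal, ← integral_complex_ofReal]
  simp_rw [fun ω => e2 fun i => f (t i) ω,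
    fun l : ℝ => e2 fun i => Complex.exp (-Complex.I * t i * l)]
  have hi : ∀ s u : ℝ, Integrable (fun l : ℝ => Complex.exp (-Complex.I * s * l) *
      (starRingEnd ℂ) (Complex.exp (-Complex.I * u * l))) ρ := fun s u => by
    have hc : Continuous fun l : ℝ => Complex.exp (-Complex.I * s * l) *
      (starRingEnd ℂ) (Complex.exp (-Complex.I * u * l)) :=
      Continuous.mul (by fun_prop) (Complex.continuous_conj.comp (by fun_prop))
    refine Integrable.of_bound hc.aestronglyMeasurable 1 (ae_of_all _ fun l => ?_)
    rw [norm_mul, RCLike.norm_conj, Complex.norm_exp, Complex.norm_exp]; simp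
  rw [integral_finsetSum _ fun i _ => integrable_finsetSum _ fun j _ =>
      (hH.integrable_mul_conj (hf _) (hf _)).const_mul _,
    integral_finsetSum _ fun i _ => integrable_finsetSum _ fun j _ => (hi _ _).const_mul _]
  refine Finset.sum_congr rfl fun i _ => ?_
  rw [integral_finsetSum _ fun j _ => (hH.integrable_mul_conj (hf _) (hf _)).const_mul _,
    integral_finsetSum _ fun j _ => (hi _ _).const_mul _]
  refine Finset.sum_congr rfl fun j _ => ?_
  rw [integral_const_mul, integral_const_mul]
  congr 1
  have h1 := hcov (t i) (t j)
  rw [cov, hspec.fourier] at h1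
  rw [h1]
  congr 1
  ext l
  rw [← Complex.exp_conj, ← Complex.exp_add]
  congr 1
  simp
  ring

end spectral

lemma norm_slope_exp_sub_le (l τ a b η : ℝ) (hab : a ≤ b) (ha : τ ≤ a) (hb : b ≤ τ + η) :
    ‖Complex.exp (-Complex.I * b * l) - Complex.exp (-Complex.I * a * l) -
      (b - a) * (-Complex.I * l * Complex.exp (-Complex.I * τ * l))‖ ≤ (b - a) * (l ^ 2 * η) := by
  set φ : ℝ → ℂ := fun t => Complex.exp (-Complex.I * t * l) -
    t * (-Complex.I * l * Complex.exp (-Complex.I * τ * l)) with hφ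
  have hd : ∀ t : ℝ, HasDerivAt φ (-Complex.I * l * Complex.exp (-Complex.I * t * l) -
      -Complex.I * l * Complex.exp (-Complex.I * τ * l)) t := fun t => by
    have h1 : HasDerivAt (fun t : ℝ => (t : ℂ)) 1 t := Complex.ofRealCLM.hasDerivAt
    have h2 := ((h1.const_mul (-Complex.I)).mul_const (l : ℂ)).cexp
    have h3 := h2.sub (h1.mul_const (-Complex.I * l * Complex.exp (-Complex.I * τ * l)))
    convert! h3 using 1
    ring
  have hbd : ∀ t ∈ Icc τ (τ + η), ‖-Complex.I * l * Complex.exp (-Complex.I * t * l) -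
      -Complex.I * l * Complex.exp (-Complex.I * τ * l)‖ ≤ l ^ 2 * η := fun t ht => by
    have e : -Complex.I * l * Complex.exp (-Complex.I * t * l) -
      -Complex.I * l * Complex.exp (-Complex.I * τ * l) =
      -Complex.I * l * Complex.exp (-Complex.I * τ * l) *
        (Complex.exp (Complex.I * ((-(t - τ) * l : ℝ) : ℂ)) - 1) := by
      rw [mul_sub, mul_assoc _ (Complex.exp _) (Complex.exp _), ← Complex.exp_add, mul_one]
      congr 3; push_cast; ring
    rw [e, norm_mul, norm_mul, norm_mul, norm_neg, Complex.norm_I, one_mul, Complex.norm_real,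
      Complex.norm_exp]
    have h1 := Real.norm_exp_I_mul_ofReal_sub_one_le (x := -(t - τ) * l)
    rw [norm_mul, norm_neg, Real.norm_of_nonneg (by linarith [ht.1] : 0 ≤ t - τ)] at h1
    have h2 : (-Complex.I * (τ : ℂ) * (l : ℂ)).re = 0 := by simp
    rw [h2, Real.exp_zero, mul_one]
    calc ‖l‖ * _ ≤ ‖l‖ * ((t - τ) * ‖l‖) := by gcongr
      _ = l ^ 2 * (t - τ) := by rw [Real.norm_eq_abs, ← sq_abs]; ring
      _ ≤ _ := by
        have := ht.2
        gcongr
        linarith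
  have h := Convex.norm_image_sub_le_of_norm_hasDerivWithin_le (f := φ)
    (fun t _ => (hd t).hasDerivWithinAt) hbd (convex_Icc τ (τ + η))
    (⟨ha, hab.trans hb⟩ : a ∈ Icc τ (τ + η)) (⟨ha.trans hab, hb⟩ : b ∈ Icc τ (τ + η))
  rw [Real.norm_of_nonneg (by linarith : 0 ≤ b - a)] at h
  rw [mul_comm (b - a)]
  convert! h using 2
  simp only [hφ]
  ring

lemma norm_exp_sub_exp_le (l a b : ℝ) :
    ‖Complex.exp (-Complex.I * b * l) - Complex.exp (-Complex.I * a * l)‖ ≤ |b - a| * |l| := by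
  have e : Complex.exp (-Complex.I * b * l) - Complex.exp (-Complex.I * a * l) =
      Complex.exp (-Complex.I * a * l) *
        (Complex.exp (Complex.I * ((-(b - a) * l : ℝ) : ℂ)) - 1) := by
    rw [mul_sub, ← Complex.exp_add, mul_one]
    congr 2; push_cast; ring
  rw [e, norm_mul, Complex.norm_exp]
  have h1 := Real.norm_exp_I_mul_ofReal_sub_one_le (x := -(b - a) * l)
  rw [norm_mul, norm_neg, Real.norm_eq_abs, Real.norm_eq_abs] at h1
  simpa using h1

/-- Each slope of exp(-itl) is at most |l| in modulus, and also lies within 2l²/N of the derivative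
at the common base point τ. The window of length 2/N accommodates two adjacent cells as well as a
cell and one of its subcells. -/
lemma norm_two_slopes_exp_le {M N l τ a b c d : ℝ} (hM : 0 < M) (hN : 0 < N)
    (hab : b - a = 1 / M) (hcd : d - c = 1 / N) (ha : τ ≤ a) (hb : b ≤ τ + 2 / N) (hc : τ ≤ c)
    (hd : d ≤ τ + 2 / N) :
    ‖(M : ℂ) * (Complex.exp (-Complex.I * b * l) - Complex.exp (-Complex.I * a * l)) -
      (N : ℂ) * (Complex.exp (-Complex.I * d * l) - Complex.exp (-Complex.I * c * l))‖ ^ 2 ≤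
      min (4 * l ^ 2) (16 * l ^ 4 / N ^ 2) := by
  have hMp : 0 < 1 / M := by positivity
  have hNp : 0 < 1 / N := by positivity
  have hMC : (M : ℂ) ≠ 0 := by exact_mod_cast hM.ne'
  have hNC : (N : ℂ) ≠ 0 := by exact_mod_cast hN.ne'
  refine le_min ?_ ?_
  · have h1 := norm_exp_sub_exp_le l a b
    have h2 := norm_exp_sub_exp_le l c d
    rw [hab, abs_of_pos hMp] at h1
    rw [hcd, abs_of_pos hNp] at h2
    have h3 : ‖(M : ℂ) * (Complex.exp (-Complex.I * b * l) - Complex.exp (-Complex.I * a * l)) -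
      (N : ℂ) * (Complex.exp (-Complex.I * d * l) - Complex.exp (-Complex.I * c * l))‖ ≤
      2 * |l| := by
      refine (norm_sub_le _ _).trans ?_
      rw [norm_mul, norm_mul, Complex.norm_real, Complex.norm_real, Real.norm_of_nonneg hM.le,
        Real.norm_of_nonneg hN.le]
      calc _ ≤ M * (1 / M * |l|) + N * (1 / N * |l|) := by gcongr
        _ = 2 * |l| := by field_simp; ring
    calc _ ≤ (2 * |l|) ^ 2 := by gcongr
      _ = 4 * l ^ 2 := by rw [mul_pow, sq_abs]; norm_num
  · have h1 := norm_slope_exp_sub_le l τ a b (2 / N) (by linarith) ha hb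
    have h2 := norm_slope_exp_sub_le l τ c d (2 / N) (by linarith) hc hd
    have e1 : (b : ℂ) - a = 1 / M := by exact_mod_cast congrArg (fun x : ℝ => (x : ℂ)) hab
    have e2 : (d : ℂ) - c = 1 / N := by exact_mod_cast congrArg (fun x : ℝ => (x : ℂ)) hcd
    rw [hab, e1] at h1
    rw [hcd, e2] at h2
    set W := -Complex.I * l * Complex.exp (-Complex.I * τ * l) with hW
    have h3 : ‖(M : ℂ) * (Complex.exp (-Complex.I * b * l) - Complex.exp (-Complex.I * a * l)) -
      (N : ℂ) * (Complex.exp (-Complex.I * d * l) - Complex.exp (-Complex.I * c * l))‖ ≤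
      4 * l ^ 2 / N := by
      have e : (M : ℂ) * (Complex.exp (-Complex.I * b * l) - Complex.exp (-Complex.I * a * l)) -
        (N : ℂ) * (Complex.exp (-Complex.I * d * l) - Complex.exp (-Complex.I * c * l)) =
        (M : ℂ) * (Complex.exp (-Complex.I * b * l) - Complex.exp (-Complex.I * a * l) -
          1 / M * W) -
        (N : ℂ) * (Complex.exp (-Complex.I * d * l) - Complex.exp (-Complex.I * c * l) -
          1 / N * W) := by
        field_simp; ring
      rw [e]
      refine (norm_sub_le _ _).trans ?_
      rw [norm_mul, norm_mul, Complex.norm_real, Complex.norm_real, Real.norm_of_nonneg hM.le,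
        Real.norm_of_nonneg hN.le]
      calc _ ≤ M * (1 / M * (l ^ 2 * (2 / N))) + N * (1 / N * (l ^ 2 * (2 / N))) := by gcongr
        _ = 4 * l ^ 2 / N := by field_simp; ring
    calc _ ≤ (4 * l ^ 2 / N) ^ 2 := by gcongr
      _ = _ := by rw [div_pow]; ring

end

/-! ### Variance of slope differences under the log-moment condition. -/

section

variable {Ω : Type*} [MeasurableSpace Ω] {P : Measure Ω}

lemma LogMomentCondition.memLp_two {ρ : Measure ℝ} [IsFiniteMeasure ρ]
    (h : LogMomentCondition ρ) : MemLp id 2 ρ := by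
  obtain ⟨α, hα, hi⟩ := h
  rw [memLp_two_iff_integrable_sq measurable_id.aestronglyMeasurable]
  refine Integrable.mono' ((integrable_const (4 : ℝ)).add hi) (by fun_prop) (ae_of_all _ fun l => ?_)
  simp only [id, Pi.add_apply]
  rw [Real.norm_of_nonneg (sq_nonneg l)]
  have hlog : 0 ≤ Real.log (1 + |l|) := Real.log_nonneg (by linarith [abs_nonneg l])
  rcases le_or_gt |l| 2 with hl | hl
  · have : l ^ 2 ≤ 4 := by rw [← sq_abs]; nlinarith [abs_nonneg l]
    have : 0 ≤ l ^ 2 * Real.log (1 + |l|) ^ (1 + α) := by positivity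
    linarith
  · have h1 : 1 ≤ Real.log (1 + |l|) := by
      rw [Real.le_log_iff_exp_le (by linarith)]
      have := Real.exp_one_lt_d9
      linarith
    have h2 : 1 ≤ Real.log (1 + |l|) ^ (1 + α) := Real.one_le_rpow h1 (by linarith)
    nlinarith [sq_nonneg l]

lemma exists_two_rpow_neg_le (s : ℝ) :
    ∃ C : ℝ, 0 ≤ C ∧ ∀ n : ℕ, ((gridSize n : ℝ))⁻¹ ≤ C * ((2 : ℝ) ^ n) ^ (-s) := by
  have h1 := tendsto_rpow_mul_exp_neg_mul_atTop_nhds_zero s (Real.log 2) (Real.log_pos one_lt_two)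
  have h2 := h1.comp (tendsto_pow_atTop_atTop_of_one_lt (r := (2 : ℝ)) one_lt_two)
  obtain ⟨C, hC⟩ := h2.bddAbove_range
  have hC' : ∀ n : ℕ, ((2 : ℝ) ^ n) ^ s * Real.exp (-Real.log 2 * 2 ^ n) ≤ C := fun n =>
    hC ⟨n, rfl⟩
  refine ⟨C, le_trans (by positivity) (hC' 0), fun n => ?_⟩
  have h3 := hC' n
  have h4 : Real.exp (-Real.log 2 * 2 ^ n) = ((gridSize n : ℝ))⁻¹ := by
    have := Real.exp_nat_mul (Real.log 2) (2 ^ n)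
    rw [Real.exp_log two_pos] at this
    push_cast at this
    rw [gridSize, neg_mul, Real.exp_neg, mul_comm, this]
    push_cast
    rfl
  rw [h4] at h3
  have h5 : (0 : ℝ) < ((2 : ℝ) ^ n) ^ s := by positivity
  rw [Real.rpow_neg (by positivity), ← div_eq_mul_inv, le_div_iff₀ h5]
  linarith

/-- Split at l² = N, where N = `gridSize n`. Above it, log(1+|l|) ≥ ½ log N = 2^n (log 2)/2, and the
log-moment pays for 4l²; this gives the constant K. Below it, the second term of the minimum is at
most 16l²/N, and 1/N decays faster than any power of 2^n. -/
lemma exists_integral_min_le {ρ : Measure ℝ} [IsFiniteMeasure ρ] {α : ℝ} (hα : 0 < α)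
    (hi : Integrable (fun l : ℝ => l ^ 2 * Real.log (1 + |l|) ^ (1 + α)) ρ)
    (h2 : MemLp id 2 ρ) :
    ∃ C : ℝ, 0 < C ∧ ∀ n : ℕ, ∫ l : ℝ, min (4 * l ^ 2) (16 * l ^ 4 / (gridSize n : ℝ) ^ 2) ∂ρ ≤
      C * ((2 : ℝ) ^ n) ^ (-(1 + α)) := by
  obtain ⟨C', hC', hC''⟩ := exists_two_rpow_neg_le (1 + α)
  have hi2 : Integrable (fun l : ℝ => l ^ 2) ρ := h2.integrable_sq
  set A := ∫ l : ℝ, l ^ 2 * Real.log (1 + |l|) ^ (1 + α) ∂ρ with hA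
  have hlog0 : ∀ l : ℝ, 0 ≤ Real.log (1 + |l|) := fun l =>
    Real.log_nonneg (by linarith [abs_nonneg l])
  have hA0 : 0 ≤ A := integral_nonneg fun l => by
    have := hlog0 l
    positivity
  set m := ∫ l : ℝ, l ^ 2 ∂ρ with hm
  have hm0 : 0 ≤ m := integral_nonneg fun l => sq_nonneg l
  have hl2 := Real.log_pos one_lt_two
  set K := 4 * (2 / Real.log 2) ^ (1 + α) with hK
  have hK0 : 0 < K := by positivity
  refine ⟨K * A + 16 * m * C' + 1, by positivity, fun n => ?_⟩
  have hN := gridSize_pos' n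
  set N : ℝ := ((gridSize n : ℕ) : ℝ) with hNdef
  set x : ℝ := (2 : ℝ) ^ n with hx
  have hx0 : 0 < x := by positivity
  have hlogN : Real.log N = x * Real.log 2 := by
    rw [hNdef, gridSize, hx]; push_cast; rw [Real.log_pow]; push_cast; rfl
  have hpt : ∀ l : ℝ, min (4 * l ^ 2) (16 * l ^ 4 / N ^ 2) ≤
      K * x ^ (-(1 + α)) * (l ^ 2 * Real.log (1 + |l|) ^ (1 + α)) + 16 * N⁻¹ * l ^ 2 := fun l => by
    have h0 := hlog0 l
    rcases le_or_gt N (l ^ 2) with h | h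
    · have h3 : x * (Real.log 2 / 2) ≤ Real.log (1 + |l|) := by
        have : N ≤ (1 + |l|) ^ 2 := by
          rw [← sq_abs] at h; nlinarith [abs_nonneg l]
        have h4 := Real.log_le_log hN this
        rw [hlogN, Real.log_pow] at h4
        push_cast at h4
        linarith
      have h4 : x ^ (1 + α) * (Real.log 2 / 2) ^ (1 + α) ≤ Real.log (1 + |l|) ^ (1 + α) := by
        rw [← Real.mul_rpow hx0.le (by positivity)]
        exact Real.rpow_le_rpow (by positivity) h3 (by linarith)
      have h5 : (2 / Real.log 2) ^ (1 + α) * (Real.log 2 / 2) ^ (1 + α) = 1 := by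
        rw [← Real.mul_rpow (by positivity) (by positivity)]
        have : 2 / Real.log 2 * (Real.log 2 / 2) = 1 := by field_simp
        rw [this, Real.one_rpow]
      have h6 : x ^ (-(1 + α)) * x ^ (1 + α) = 1 := by
        rw [← Real.rpow_add hx0]; simp
      have h7 : 4 * l ^ 2 ≤ K * x ^ (-(1 + α)) * (l ^ 2 * Real.log (1 + |l|) ^ (1 + α)) := by
        calc 4 * l ^ 2 = (K * x ^ (-(1 + α)) * l ^ 2) *
              (x ^ (1 + α) * (Real.log 2 / 2) ^ (1 + α)) := by
              rw [hK]; linear_combination (-(4 * l ^ 2) * (x ^ (-(1 + α)) * x ^ (1 + α))) * h5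
                - 4 * l ^ 2 * h6
          _ ≤ (K * x ^ (-(1 + α)) * l ^ 2) * Real.log (1 + |l|) ^ (1 + α) := by gcongr
          _ = _ := by ring
      refine (min_le_left _ _).trans (h7.trans ?_)
      have : 0 ≤ 16 * N⁻¹ * l ^ 2 := by positivity
      linarith
    · refine (min_le_right _ _).trans ?_
      have h3 : 16 * l ^ 4 / N ^ 2 ≤ 16 * N⁻¹ * l ^ 2 := by
        rw [div_le_iff₀ (by positivity)]
        have : 16 * N⁻¹ * l ^ 2 * N ^ 2 = 16 * l ^ 2 * N := by field_simp
        rw [this]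
        nlinarith [sq_nonneg l]
      have : 0 ≤ K * x ^ (-(1 + α)) * (l ^ 2 * Real.log (1 + |l|) ^ (1 + α)) := by positivity
      linarith
  have hint : Integrable (fun l : ℝ => K * x ^ (-(1 + α)) *
      (l ^ 2 * Real.log (1 + |l|) ^ (1 + α)) + 16 * N⁻¹ * l ^ 2) ρ :=
    (hi.const_mul _).add (hi2.const_mul _)
  have h1 : ∫ l : ℝ, min (4 * l ^ 2) (16 * l ^ 4 / N ^ 2) ∂ρ ≤
      K * x ^ (-(1 + α)) * A + 16 * N⁻¹ * m := by
    have := integral_mono_of_nonneg (ae_of_all ρ fun l : ℝ => (by positivity :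
      0 ≤ min (4 * l ^ 2) (16 * l ^ 4 / N ^ 2))) hint (ae_of_all _ hpt)
    rwa [integral_add (hi.const_mul _) (hi2.const_mul _), integral_const_mul,
      integral_const_mul] at this
  refine h1.trans ?_
  have h3 := hC'' n
  have h4 : 0 < x ^ (-(1 + α)) := by positivity
  calc K * x ^ (-(1 + α)) * A + 16 * N⁻¹ * m
      ≤ K * x ^ (-(1 + α)) * A + 16 * (C' * x ^ (-(1 + α))) * m := by gcongr
    _ ≤ (K * A + 16 * m * C' + 1) * x ^ (-(1 + α)) := by nlinarith

section
variable {ρ : Measure ℝ} {f : ℝ → Ω → ℂ} {H : Submodule ℂ (Ω → ℂ)}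

lemma integral_norm_sq_two_slopes_le (hH : IsGaussianSpace P H)
    (hf : ∀ t, f t ∈ H) (hcov : ∀ s t, cov P (f s) (f t) = covKernel f P (s - t))
    (hspec : IsSpectralMeasure ρ (covKernel f P)) (h2 : MemLp id 2 ρ)
    {M N τ a b c d : ℝ} (hM : 0 < M) (hN : 0 < N)
    (hab : b - a = 1 / M) (hcd : d - c = 1 / N) (ha : τ ≤ a) (hb : b ≤ τ + 2 / N) (hc : τ ≤ c)
    (hd : d ≤ τ + 2 / N) :
    ∫ ω, ‖(M : ℂ) * (f b ω - f a ω) - (N : ℂ) * (f d ω - f c ω)‖ ^ 2 ∂P ≤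
      ∫ l : ℝ, min (4 * l ^ 2) (16 * l ^ 4 / N ^ 2) ∂ρ := by
  have := hspec.isProbability
  have h := integral_norm_sq_sum hH hf hcov hspec ![(M : ℂ), -M, -N, N] ![b, a, d, c]
  simp only [Fin.sum_univ_four, Matrix.cons_val] at h
  have e : ∀ u v w z : ℂ, (M : ℂ) * u + -M * v + -N * w + N * z = M * (u - v) - N * (w - z) :=
    fun u v w z => by ring
  simp only [e] at h
  rw [h]
  have hi2 : Integrable (fun l : ℝ => 4 * l ^ 2) ρ := h2.integrable_sq.const_mul 4
  have hi : Integrable (fun l : ℝ => min (4 * l ^ 2) (16 * l ^ 4 / N ^ 2)) ρ := by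
    refine Integrable.mono' hi2 (by fun_prop) (ae_of_all _ fun l => ?_)
    rw [Real.norm_of_nonneg (by positivity)]
    exact min_le_left _ _
  exact integral_mono_of_nonneg (ae_of_all _ fun l => by positivity) hi
    (ae_of_all _ fun l => norm_two_slopes_exp_le hM hN hab hcd ha hb hc hd)

end

end

/-! ### Continuously differentiable paths. -/

section

variable {Ω : Type*} [MeasurableSpace Ω] {P : Measure Ω}

/-- With x = 2^n the exponent is x^(1+α/2)/(2C), which eventually exceeds (2 log 2 + 1)x. The part
2x log 2 = log N² absorbs the two factors of order N from counting cells and subcells; the rest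
gives exp(-n). -/
lemma summable_grid_bound {α C : ℝ} (hα : 0 < α) (hC : 0 < C) :
    Summable fun n : ℕ => (2 * (n * gridSize n : ℝ) + 1) * ((gridSize n + 1 : ℝ) *
      (2 * Real.exp (-((((2 : ℝ) ^ n) ^ (-(α / 4))) ^ 2 /
        (2 * (C * ((2 : ℝ) ^ n) ^ (-(1 + α)))))))) := by
  have hs : Summable fun n : ℕ => 12 * ((n : ℝ) ^ 1 * Real.exp (-n * 1)) := by
    simpa using (Real.summable_pow_mul_exp_neg_nat_mul 1 one_pos).mul_left 12
  refine Summable.of_norm_bounded_eventually_nat hs ?_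
  have h1 : Tendsto (fun n : ℕ => ((2 : ℝ) ^ n) ^ (α / 2) / (2 * C)) atTop atTop :=
    ((tendsto_rpow_atTop (by positivity : 0 < α / 2)).comp
      (tendsto_pow_atTop_atTop_of_one_lt (r := (2 : ℝ)) one_lt_two)).atTop_div_const (by positivity)
  filter_upwards [h1.eventually_ge_atTop (2 * Real.log 2 + 1), eventually_ge_atTop 1] with n hn hn1
  set x : ℝ := (2 : ℝ) ^ n with hx
  have hx0 : 0 < x := by positivity
  have hnx : (n : ℝ) ≤ x := by
    rw [hx]; exact_mod_cast (Nat.lt_two_pow_self (n := n)).le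
  have hn1' : (1 : ℝ) ≤ n := by exact_mod_cast hn1
  have hN1 : (1 : ℝ) ≤ gridSize n := by exact_mod_cast gridSize_pos n
  set N : ℝ := ((gridSize n : ℕ) : ℝ) with hN
  have hlogN : Real.log N = x * Real.log 2 := by
    rw [hN, gridSize, hx]; push_cast; rw [Real.log_pow]; push_cast; rfl
  have e : (x ^ (-(α / 4))) ^ 2 / (2 * (C * x ^ (-(1 + α)))) = x * (x ^ (α / 2) / (2 * C)) := by
    rw [div_eq_iff (by positivity)]
    have e1 : (x ^ (-(α / 4))) ^ 2 = x ^ (-(α / 2)) := by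
      rw [← Real.rpow_natCast, ← Real.rpow_mul hx0.le]; congr 1; push_cast; ring
    have e2 : x * x ^ (α / 2) * x ^ (-(1 + α)) = x ^ (-(α / 2)) := by
      conv_lhs => rw [← Real.rpow_one_add' hx0.le (by positivity), ← Real.rpow_add hx0]
      congr 1; ring
    rw [e1, ← e2]
    field_simp
  rw [e]
  have h3 : Real.exp (-(x * (x ^ (α / 2) / (2 * C)))) ≤ (N * N)⁻¹ * Real.exp (-n * 1) := by
    have h4 : -(x * (x ^ (α / 2) / (2 * C))) ≤ -(Real.log (N * N)) + (-n * 1) := by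
      rw [Real.log_mul (by positivity) (by positivity), hlogN]
      nlinarith
    refine (Real.exp_le_exp.2 h4).trans (le_of_eq ?_)
    rw [Real.exp_add, Real.exp_neg, Real.exp_log (by positivity)]
  rw [Real.norm_of_nonneg (by positivity), pow_one]
  calc (2 * (n * N) + 1) * ((N + 1) * (2 * Real.exp (-(x * (x ^ (α / 2) / (2 * C))))))
      ≤ (3 * (n * N)) * ((2 * N) * (2 * ((N * N)⁻¹ * Real.exp (-n * 1)))) := by
        gcongr
        · nlinarith
        · linarith
    _ = 12 * (n * Real.exp (-n * 1)) := by field_simp; ring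

section
variable {ρ : Measure ℝ} {f : ℝ → Ω → ℂ} {H : Submodule ℂ (Ω → ℂ)}

lemma measure_norm_two_slopes_ge_le [IsFiniteMeasure P] (hH : IsGaussianSpace P H)
    (hf : ∀ t, f t ∈ H) (hcov : ∀ s t, cov P (f s) (f t) = covKernel f P (s - t))
    (hspec : IsSpectralMeasure ρ (covKernel f P)) (h2 : MemLp id 2 ρ)
    {M N τ a b c d v ε : ℝ} (hM : 0 < M) (hN : 0 < N)
    (hab : b - a = 1 / M) (hcd : d - c = 1 / N) (ha : τ ≤ a) (hb : b ≤ τ + 2 / N) (hc : τ ≤ c)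
    (hd : d ≤ τ + 2 / N) (hv : ∫ l : ℝ, min (4 * l ^ 2) (16 * l ^ 4 / N ^ 2) ∂ρ ≤ v) (hv0 : 0 < v)
    (hε : 0 ≤ ε) :
    P {ω | ε ≤ ‖(M : ℂ) * (f b ω - f a ω) - (N : ℂ) * (f d ω - f c ω)‖} ≤
      ENNReal.ofReal (2 * Real.exp (-(ε ^ 2 / (2 * v)))) := by
  have hmem : (M : ℂ) • (f b - f a) - (N : ℂ) • (f d - f c) ∈ H :=
    H.sub_mem (H.smul_mem _ (H.sub_mem (hf _) (hf _))) (H.smul_mem _ (H.sub_mem (hf _) (hf _)))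
  exact (hH.isCG hmem).measure_norm_ge_le
    ((integral_norm_sq_two_slopes_le hH hf hcov hspec h2 hM hN hab hcd ha hb hc hd).trans hv) hv0 hε

/-- The log-moment condition makes the sample paths continuously differentiable. -/
lemma ae_contDiff [IsProbabilityMeasure P] (hH : IsGaussianSpace P H)
    (hf : ∀ t, f t ∈ H) (hcov : ∀ s t, cov P (f s) (f t) = covKernel f P (s - t))
    (hspec : IsSpectralMeasure ρ (covKernel f P)) (hlog : LogMomentCondition ρ)
    (hcont : ∀ᵐ ω ∂P, Continuous (fun t => f t ω)) :
    ∀ᵐ ω ∂P, ContDiff ℝ 1 (fun t => f t ω) := by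
  have := hspec.isProbability
  have h2 := hlog.memLp_two
  obtain ⟨α, hα, hi⟩ := hlog
  obtain ⟨C, hC, hCn⟩ := exists_integral_min_le hα hi h2
  -- Tolerance and variance bound in the scale 2^n: ε is geometric, hence summable, while ε²/v is of
  -- order 2^(n(1+α/2)) and outgrows log `gridSize n`, which is of order 2^n.
  set ε : ℕ → ℝ := fun n => ((2 : ℝ) ^ n) ^ (-(α / 4)) with hε
  set v : ℕ → ℝ := fun n => C * ((2 : ℝ) ^ n) ^ (-(1 + α)) with hv
  have hε0 : ∀ n, 0 < ε n := fun n => by simp only [hε]; positivity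
  have hv0 : ∀ n, 0 < v n := fun n => by simp only [hv]; positivity
  have hεs : Summable ε := by
    have e : ε = fun n => ((2 : ℝ) ^ (-(α / 4))) ^ n := by
      ext n
      simp only [hε]
      rw [← Real.rpow_natCast, ← Real.rpow_natCast, ← Real.rpow_mul zero_le_two,
        ← Real.rpow_mul zero_le_two, mul_comm]
    rw [e]
    exact summable_geometric_of_lt_one (by positivity)
      (Real.rpow_lt_one_of_one_lt_of_neg one_lt_two (by linarith))
  set p : ℕ → ℝ := fun n => 2 * Real.exp (-((ε n) ^ 2 / (2 * v n))) with hp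
  set B₁ : ℕ → ℤ → Set Ω := fun n j =>
    {ω | ε n ≤ ‖gridSlope (fun t => f t ω) n (j + 1) - gridSlope (fun t => f t ω) n j‖} with hB₁
  set B₂ : ℕ → ℤ → ℕ → Set Ω := fun n j k =>
    {ω | ε n ≤ ‖gridSlope (fun t => f t ω) (n + 1) (j * gridSize n + k) -
      gridSlope (fun t => f t ω) n j‖} with hB₂
  have hb₁ : ∀ n j, P (B₁ n j) ≤ ENNReal.ofReal (p n) := fun n j => by
    have hN := gridSize_pos' n
    have := measure_norm_two_slopes_ge_le (P := P) hH hf hcov hspec h2 (M := gridSize n)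
      (N := gridSize n) (τ := j / gridSize n) (a := (j + 1 : ℤ) / gridSize n)
      (b := ((j + 1 : ℤ) + 1) / gridSize n) (c := j / gridSize n) (d := (j + 1) / gridSize n)
      (v := v n) (ε := ε n) hN hN (by field_simp; ring) (by field_simp; ring)
      (by gcongr; linarith) (le_of_eq (by push_cast; field_simp; ring)) le_rfl
      (by rw [← add_div]; gcongr; linarith) (hCn n) (hv0 n) (hε0 n).le
    exact this
  have hb₂ : ∀ n j k, k < gridSize n → P (B₂ n j k) ≤ ENNReal.ofReal (p n) := fun n j k hk => by
    have hN := gridSize_pos' n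
    have hN' := gridSize_pos' (n + 1)
    have hNN : ((gridSize (n + 1) : ℕ) : ℝ) = (gridSize n : ℝ) * (gridSize n : ℝ) := by
      rw [gridSize_succ]; push_cast; rfl
    have hk' : (k : ℝ) + 1 ≤ gridSize n := by exact_mod_cast hk
    have hN1 : (1 : ℝ) ≤ gridSize n := by exact_mod_cast gridSize_pos n
    have := measure_norm_two_slopes_ge_le (P := P) hH hf hcov hspec h2 (M := gridSize (n + 1))
      (N := gridSize n) (τ := j / gridSize n) (a := (j * gridSize n + k : ℤ) / gridSize (n + 1))
      (b := ((j * gridSize n + k : ℤ) + 1) / gridSize (n + 1)) (c := j / gridSize n)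
      (d := (j + 1) / gridSize n)
      (v := v n) (ε := ε n) hN' hN (by field_simp; ring) (by field_simp; ring)
      (by
        rw [hNN, div_le_div_iff₀ hN (by positivity)]
        push_cast
        have : (0 : ℝ) ≤ k := Nat.cast_nonneg k
        nlinarith [mul_nonneg this hN.le])
      (by
        rw [hNN, ← add_div, div_le_div_iff₀ (by positivity) hN]
        push_cast
        nlinarith [mul_pos hN hN]) le_rfl
      (by rw [← add_div]; gcongr; linarith) (hCn n) (hv0 n) (hε0 n).le
    exact this
  set J : ℕ → Finset ℤ := fun n => Finset.Icc (-(n * gridSize n : ℤ)) (n * gridSize n) with hJ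
  set B : ℕ → Set Ω := fun n => ⋃ j ∈ J n, (B₁ n j ∪ ⋃ k ∈ Finset.range (gridSize n), B₂ n j k)
    with hB
  have hPB : ∀ n, P (B n) ≤ ENNReal.ofReal ((2 * (n * gridSize n : ℝ) + 1) *
      ((gridSize n + 1 : ℝ) * p n)) := fun n => by
    have hp0 : 0 ≤ p n := by simp only [hp]; positivity
    have h3 : ∀ j, P (B₁ n j ∪ ⋃ k ∈ Finset.range (gridSize n), B₂ n j k) ≤
        ENNReal.ofReal ((gridSize n + 1 : ℝ) * p n) := fun j => by
      refine (measure_union_le _ _).trans ?_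
      have h4 : P (⋃ k ∈ Finset.range (gridSize n), B₂ n j k) ≤
          ENNReal.ofReal (gridSize n * p n) := by
        refine (measure_biUnion_finset_le _ _).trans
          ((Finset.sum_le_card_nsmul _ _ (ENNReal.ofReal (p n)) fun k hk =>
            hb₂ n j k (Finset.mem_range.1 hk)).trans (le_of_eq ?_))
        rw [Finset.card_range, nsmul_eq_mul, ← ENNReal.ofReal_natCast,
          ← ENNReal.ofReal_mul (by positivity)]
      refine (add_le_add (hb₁ n j) h4).trans (le_of_eq ?_)
      rw [← ENNReal.ofReal_add hp0 (by positivity)]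
      congr 1; ring
    refine (measure_biUnion_finset_le _ _).trans
      ((Finset.sum_le_card_nsmul _ _ _ fun j _ => h3 j).trans (le_of_eq ?_))
    have hcard : (J n).card = 2 * (n * gridSize n) + 1 := by
      simp only [hJ, Int.card_Icc]
      have : (n * gridSize n : ℤ) + 1 - -(n * gridSize n : ℤ) =
        ((2 * (n * gridSize n) + 1 : ℕ) : ℤ) := by push_cast; ring
      rw [this, Int.toNat_natCast]
    rw [hcard, nsmul_eq_mul, ← ENNReal.ofReal_natCast, ← ENNReal.ofReal_mul (by positivity)]
    push_cast
    rfl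
  -- Borel–Cantelli: outside a null set only finitely many levels contain a bad pair of slopes.
  have hsum : ∑' n, P (B n) ≠ ⊤ := by
    refine ne_top_of_le_ne_top (summable_grid_bound hα hC).tsum_ofReal_ne_top
      (ENNReal.tsum_le_tsum hPB)
  filter_upwards [ae_eventually_notMem hsum, hcont] with ω hω hc
  refine contDiff_of_gridRegular hc hεs ?_
  filter_upwards [hω] with n hn j hj
  have hjJ : j ∈ J n := by
    simp only [hJ, Finset.mem_Icc]; exact abs_le.1 hj
  simp only [hB, mem_iUnion, not_exists] at hn
  have h4 := hn j hjJ
  rw [mem_union, not_or] at h4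
  refine ⟨(not_le.1 h4.1).le, fun k hk => ?_⟩
  have h5 := h4.2
  simp only [mem_iUnion, not_exists] at h5
  exact (not_le.1 (h5 k (Finset.mem_range.2 hk))).le

end

end

/-! ### Absence of zeros. -/

section

variable {Ω : Type*} [MeasurableSpace Ω] {P : Measure Ω}

/-- With Lipschitz constant M, a zero forces |f| ≤ M/K at a point of the grid of mesh 1/K. There are
2LK+1 such points, each with probability at most (M/K)², and the product tends to 0. -/
lemma measure_lipschitz_zero_eq_zero {f : ℝ → Ω → ℂ} (hf : ∀ t, IsCG P 1 (f t)) (L M : ℕ) :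
    P {ω | (∀ s ∈ Icc (-L : ℝ) L, ∀ t ∈ Icc (-L : ℝ) L, ‖f s ω - f t ω‖ ≤ M * |s - t|) ∧
      ∃ t ∈ Icc (-L : ℝ) L, f t ω = 0} = 0 := by
  set A := {ω | (∀ s ∈ Icc (-L : ℝ) L, ∀ t ∈ Icc (-L : ℝ) L, ‖f s ω - f t ω‖ ≤ M * |s - t|) ∧
      ∃ t ∈ Icc (-L : ℝ) L, f t ω = 0} with hA
  have hb : ∀ N : ℕ, P A ≤ ENNReal.ofReal ((2 * (L * (N + 1)) + 1) * (M / (N + 1)) ^ 2) := fun N => by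
    set K : ℕ := N + 1 with hK
    have hK0 : (0 : ℝ) < K := by rw [hK]; positivity
    have hsub : A ⊆ ⋃ j ∈ Finset.Icc (-(L * K : ℤ)) (L * K),
        {ω | ‖f (j / K) ω‖ ≤ M / K} := by
      rintro ω ⟨hlip, t, ht, h0⟩
      have h1 := Int.floor_le (t * K)
      have h2 := Int.lt_floor_add_one (t * K)
      have h3 : -(L * K : ℤ) ≤ ⌊t * K⌋ := by
        rw [Int.le_floor]; push_cast; nlinarith [ht.1]
      have h4 : ⌊t * K⌋ ≤ (L * K : ℤ) := by
        have : (⌊t * K⌋ : ℝ) ≤ (L * K : ℝ) := by nlinarith [ht.2]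
        exact_mod_cast this
      have h3' : -(L * K : ℝ) ≤ (⌊t * K⌋ : ℝ) := by exact_mod_cast h3
      have h4' : (⌊t * K⌋ : ℝ) ≤ (L * K : ℝ) := by exact_mod_cast h4
      simp only [mem_iUnion]
      refine ⟨⌊t * K⌋, Finset.mem_Icc.2 ⟨h3, h4⟩, ?_⟩
      have h5 := hlip (⌊t * K⌋ / K) ⟨by rw [le_div_iff₀ hK0]; linarith,
        by rw [div_le_iff₀ hK0]; exact h4'⟩ t ht
      rw [h0, sub_zero] at h5
      refine h5.trans ?_
      rw [div_eq_mul_one_div (M : ℝ)]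
      gcongr
      rw [abs_sub_comm, abs_of_nonneg]
      · rw [← sub_nonneg]
        have : 1 / (K : ℝ) - (t - ⌊t * K⌋ / K) = (⌊t * K⌋ + 1 - t * K) / K := by field_simp; ring
        rw [this]
        exact div_nonneg (by linarith) hK0.le
      · rw [sub_nonneg, div_le_iff₀ hK0]; exact h1
    refine (measure_mono hsub).trans ((measure_biUnion_finset_le _ _).trans
      ((Finset.sum_le_card_nsmul _ _ _ fun (j : ℤ) _ =>
        (hf (j / K)).measure_norm_le_le (ε := M / K) (by positivity)).trans (le_of_eq ?_)))
    have hcard : (Finset.Icc (-(L * K : ℤ)) (L * K)).card = 2 * (L * K) + 1 := by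
      rw [Int.card_Icc]
      have : (L * K : ℤ) + 1 - -(L * K : ℤ) = ((2 * (L * K) + 1 : ℕ) : ℤ) := by push_cast; ring
      rw [this, Int.toNat_natCast]
    rw [hcard, nsmul_eq_mul, ← ENNReal.ofReal_natCast, ← ENNReal.ofReal_mul (by positivity), hK]
    push_cast
    rfl
  have hlim : Tendsto (fun N : ℕ => (2 * (L * ((N : ℝ) + 1)) + 1) * (M / ((N : ℝ) + 1)) ^ 2) atTop
      (𝓝 0) := by
    have h1 : Tendsto (fun N : ℕ => 1 / ((N : ℝ) + 1)) atTop (𝓝 0) :=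
      tendsto_one_div_add_atTop_nhds_zero_nat
    have h2 : Tendsto (fun N : ℕ => (2 * L * M ^ 2 : ℝ) * (1 / ((N : ℝ) + 1)) +
        M ^ 2 * (1 / ((N : ℝ) + 1)) ^ 2) atTop (𝓝 0) := by
      simpa using (h1.const_mul (2 * L * M ^ 2 : ℝ)).add ((h1.pow 2).const_mul ((M : ℝ) ^ 2))
    refine h2.congr fun N => ?_
    have : (N : ℝ) + 1 ≠ 0 := by positivity
    field_simp
  have h3 := ge_of_tendsto' (ENNReal.tendsto_ofReal hlim) hb
  simpa using h3

/-- Bulinskaya's lemma: continuously differentiable complex Gaussian paths have no zeros. -/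
lemma ae_forall_ne_zero {f : ℝ → Ω → ℂ} (hf : ∀ t, IsCG P 1 (f t))
    (hC : ∀ᵐ ω ∂P, ContDiff ℝ 1 (fun t => f t ω)) : ∀ᵐ ω ∂P, ∀ t, f t ω ≠ 0 := by
  have h1 : ∀ᵐ ω ∂P, ∀ L M : ℕ, ¬ ((∀ s ∈ Icc (-L : ℝ) L, ∀ t ∈ Icc (-L : ℝ) L,
      ‖f s ω - f t ω‖ ≤ M * |s - t|) ∧ ∃ t ∈ Icc (-L : ℝ) L, f t ω = 0) := by
    rw [ae_all_iff]; intro L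
    rw [ae_all_iff]; intro M
    rw [ae_iff]
    simp only [not_not]
    exact measure_lipschitz_zero_eq_zero hf L M
  filter_upwards [h1, hC] with ω hω hc t ht
  obtain ⟨L, hL⟩ := exists_nat_ge |t|
  obtain ⟨C, hCb⟩ := (isCompact_Icc (a := (-L : ℝ)) (b := L)).exists_bound_of_continuousOn
    (hc.continuous_deriv le_rfl).continuousOn
  obtain ⟨M, hM⟩ := exists_nat_ge C
  refine hω L M ⟨fun s hs u hu => ?_, t, abs_le.1 hL, ht⟩
  exact Convex.norm_image_sub_le_of_norm_deriv_le (f := fun t => f t ω)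
    (fun x _ => (hc.differentiable one_ne_zero) x) (fun x hx => (hCb x hx).trans hM)
    (convex_Icc _ _) hu hs

end

/-! ### Negative moments of a correlated pair. -/

section

variable {Ω : Type*} [MeasurableSpace Ω] {P : Measure Ω}

lemma IsCG.ae_ne_zero {q : ℝ} {Y : Ω → ℂ} (h : IsCG P q Y) (hq : 0 < q) : ∀ᵐ ω ∂P, Y ω ≠ 0 := by
  have h1 : ∀ᵐ z ∂(P.map Y), z ≠ 0 := by
    rw [h.law, ae_map_iff (p := fun z => z ≠ 0) (by fun_prop) (measurableSet_singleton (0 : ℂ)).compl]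
    filter_upwards [ae_ne_zero_stdComplexGaussian] with z hz
    have := (Real.sqrt_pos.2 hq).ne'
    exact mul_ne_zero (by exact_mod_cast this) hz
  exact (ae_map_iff h.measurable.aemeasurable (measurableSet_singleton (0 : ℂ)).compl).1 h1

/-- Here a ≤ b are |z|, |w| and c is the modulus of the residual of the larger on the smaller, at
most 2b and independent of the smaller. Splitting 5/4 = 1/2 + 3/4 keeps the exponent 7/4 on a below
2, the threshold for a finite negative moment. -/
lemma rpow_neg_mul_le {a b c : ℝ} (ha : 0 < a) (hb : 0 < b) (hab : a ≤ b) (hc : 0 < c)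
    (hcb : c ≤ 2 * b) :
    (a * b) ^ (-(5 / 4) : ℝ) ≤ 2 ^ (3 / 4 : ℝ) * (a ^ (-(7 / 4) : ℝ) * c ^ (-(3 / 4) : ℝ)) := by
  have h1 : b ^ (-(1 / 2) : ℝ) ≤ a ^ (-(1 / 2) : ℝ) :=
    Real.rpow_le_rpow_of_nonpos ha hab (by norm_num)
  have h2 : b ^ (-(3 / 4) : ℝ) ≤ (c / 2) ^ (-(3 / 4) : ℝ) :=
    Real.rpow_le_rpow_of_nonpos (by positivity) (by linarith) (by norm_num)
  have h3 : (c / 2) ^ (-(3 / 4) : ℝ) = 2 ^ (3 / 4 : ℝ) * c ^ (-(3 / 4) : ℝ) := by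
    rw [Real.div_rpow hc.le zero_le_two, Real.rpow_neg zero_le_two]; field_simp
  have h4 : a ^ (-(7 / 4) : ℝ) = a ^ (-(5 / 4) : ℝ) * a ^ (-(1 / 2) : ℝ) := by
    rw [← Real.rpow_add ha]; norm_num
  have h5 : b ^ (-(5 / 4) : ℝ) = b ^ (-(1 / 2) : ℝ) * b ^ (-(3 / 4) : ℝ) := by
    rw [← Real.rpow_add hb]; norm_num
  rw [Real.mul_rpow ha.le hb.le, h4, h5]
  calc a ^ (-(5 / 4) : ℝ) * (b ^ (-(1 / 2) : ℝ) * b ^ (-(3 / 4) : ℝ))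
      ≤ a ^ (-(5 / 4) : ℝ) * (a ^ (-(1 / 2) : ℝ) * (c / 2) ^ (-(3 / 4) : ℝ)) := by gcongr
    _ = _ := by rw [h3]; ring

/-- Young's inequality with conjugate exponents 5 and 5/4. Numerators of quotients go to ordinary
Gaussian moments, denominators to a negative moment of order only slightly above 1. -/
lemma mul_inv_le_pow_add_rpow {u x : ℝ} (hu : 0 ≤ u) (hx : 0 ≤ x) :
    u * x⁻¹ ≤ u ^ 5 + x ^ (-(5 / 4) : ℝ) := by
  have h := Real.young_inequality_of_nonneg hu (inv_nonneg.2 hx) (p := 5) (q := 5 / 4)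
    (by rw [Real.holderConjugate_iff]; norm_num)
  have h1 : (x⁻¹) ^ (5 / 4 : ℝ) = x ^ (-(5 / 4) : ℝ) := by
    rw [Real.inv_rpow hx, Real.rpow_neg hx]
  rw [h1] at h
  have h2 : u ^ (5 : ℝ) = u ^ 5 := by norm_cast
  rw [h2] at h
  have h3 : 0 ≤ u ^ 5 := by positivity
  have h4 : 0 ≤ x ^ (-(5 / 4) : ℝ) := by positivity
  linarith

lemma mul_pow_five_le (a b : ℝ) : (a * b) ^ 5 ≤ a ^ 10 + b ^ 10 := by
  nlinarith [sq_nonneg (a ^ 5 - b ^ 5), sq_nonneg (a ^ 5 + b ^ 5)]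

lemma IsCG.integrable_norm_pow {q : ℝ} {Y : Ω → ℂ} (h : IsCG P q Y) (n : ℕ) :
    Integrable (fun ω => ‖Y ω‖ ^ n) P := by
  have := h.integrable_norm_rpow (p := n) (by
    have : (0 : ℝ) ≤ n := Nat.cast_nonneg n
    linarith)
  simpa using this

lemma IsCG.integral_norm_pow_ten {q : ℝ} {Y : Ω → ℂ} (h : IsCG P q Y) :
    ∫ ω, ‖Y ω‖ ^ 10 ∂P = q ^ 5 * 120 := by
  have := h.integral_norm_rpow (p := 10) (by norm_num)
  have e : Real.sqrt q ^ (10 : ℝ) = q ^ 5 := by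
    have : Real.sqrt q ^ (10 : ℝ) = (Real.sqrt q ^ 2) ^ 5 := by
      rw [← pow_mul]; norm_cast
    rw [this, Real.sq_sqrt h.nonneg]
  have e2 : ∀ ω, ‖Y ω‖ ^ (10 : ℝ) = ‖Y ω‖ ^ 10 := fun ω => by norm_cast
  simp_rw [e2, e] at this
  norm_num at this
  exact this

lemma conj_mul_self_eq (r : ℂ) : (starRingEnd ℂ) r * r = ((‖r‖ ^ 2 : ℝ) : ℂ) := by
  rw [mul_comm, Complex.mul_conj, Complex.normSq_eq_norm_sq]

/-- Two unit-variance members of a Gaussian space with covariance `r`, `|r| < 1`. -/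
structure IsUnitPair (P : Measure Ω) (H : Submodule ℂ (Ω → ℂ)) (z w : Ω → ℂ) (r : ℂ) : Prop where
  space : IsGaussianSpace P H
  left_mem : z ∈ H
  right_mem : w ∈ H
  cov_left : cov P z z = 1
  cov_right : cov P w w = 1
  cov_eq : cov P z w = r
  norm_lt : ‖r‖ < 1

lemma IsGaussianSpace.isCG_of_cov {H : Submodule ℂ (Ω → ℂ)} (h : IsGaussianSpace P H) {Y : Ω → ℂ}
    (hY : Y ∈ H) {q : ℝ} (hq : cov P Y Y = q) : IsCG P q Y := by
  have := h.isCG hY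
  rw [cov_self, Complex.ofReal_inj] at hq
  rwa [hq] at this

namespace IsUnitPair

variable {H : Submodule ℂ (Ω → ℂ)} {z w : Ω → ℂ} {r : ℂ} 

lemma symm (h : IsUnitPair P H z w r) : IsUnitPair P H w z ((starRingEnd ℂ) r) where
  space := h.space
  left_mem := h.right_mem
  right_mem := h.left_mem
  cov_left := h.cov_right
  cov_right := h.cov_left
  cov_eq := by rw [← h.cov_eq, cov_conj]
  norm_lt := by rw [RCLike.norm_conj]; exact h.norm_lt

variable (h : IsUnitPair P H z w r)
include h

lemma cov_swap : cov P w z = (starRingEnd ℂ) r := h.symm.cov_eq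

lemma one_sub_pos : 0 < 1 - ‖r‖ ^ 2 := by
  have := h.norm_lt; nlinarith [norm_nonneg r]

lemma isCG_left : IsCG P 1 z := h.space.isCG_of_cov h.left_mem (by simp [h.cov_left])

lemma isCG_right : IsCG P 1 w := h.symm.isCG_left

lemma resid_mem : w - (starRingEnd ℂ) r • z ∈ H :=
  H.sub_mem h.right_mem (H.smul_mem _ h.left_mem)

lemma cov_resid_left : cov P (w - (starRingEnd ℂ) r • z) z = 0 := by
  rw [h.space.cov_sub_left h.right_mem (H.smul_mem _ h.left_mem) h.left_mem,
    IsGaussianSpace.cov_smul_left, h.cov_swap, h.cov_left]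
  ring

lemma cov_resid_right : cov P (w - (starRingEnd ℂ) r • z) w = ((1 - ‖r‖ ^ 2 : ℝ) : ℂ) := by
  rw [h.space.cov_sub_left h.right_mem (H.smul_mem _ h.left_mem) h.right_mem,
    IsGaussianSpace.cov_smul_left, h.cov_right, h.cov_eq, conj_mul_self_eq]
  push_cast; ring

lemma isCG_resid : IsCG P (1 - ‖r‖ ^ 2) (w - (starRingEnd ℂ) r • z) := by
  refine h.space.isCG_of_cov h.resid_mem ?_
  rw [h.space.cov_sub_right h.right_mem (H.smul_mem _ h.left_mem) h.resid_mem,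
    IsGaussianSpace.cov_smul_right, h.cov_resid_left, h.cov_resid_right]
  ring

lemma indep_resid [IsProbabilityMeasure P] : IndepFun z (w - (starRingEnd ℂ) r • z) P := by
  have h0 : cov P z (w - (starRingEnd ℂ) r • z) = 0 := by
    rw [← cov_conj, h.cov_resid_left, map_zero]
  exact (h.space.indepFun h.left_mem h.left_mem h.resid_mem h.resid_mem h0 h0 h0 h0).comp
    measurable_fst measurable_fst

lemma ae_ne : ∀ᵐ ω ∂P, z ω ≠ 0 ∧ w ω ≠ 0 :=
  (h.isCG_left.ae_ne_zero one_pos).and (h.isCG_right.ae_ne_zero one_pos)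

lemma integrable_half [IsProbabilityMeasure P] :
    Integrable (fun ω => ‖z ω‖ ^ (-(7 / 4) : ℝ) *
      ‖(w - (starRingEnd ℂ) r • z) ω‖ ^ (-(3 / 4) : ℝ)) P ∧
    ∫ ω, ‖z ω‖ ^ (-(7 / 4) : ℝ) * ‖(w - (starRingEnd ℂ) r • z) ω‖ ^ (-(3 / 4) : ℝ) ∂P =
      Real.Gamma (1 / 8) * Real.Gamma (5 / 8) * (1 - ‖r‖ ^ 2) ^ (-(3 / 8) : ℝ) := by
  have hi : IndepFun (fun ω => ‖z ω‖ ^ (-(7 / 4) : ℝ))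
      (fun ω => ‖(w - (starRingEnd ℂ) r • z) ω‖ ^ (-(3 / 4) : ℝ)) P :=
    h.indep_resid.comp (φ := fun x : ℂ => ‖x‖ ^ (-(7 / 4) : ℝ))
      (ψ := fun x : ℂ => ‖x‖ ^ (-(3 / 4) : ℝ)) (by fun_prop) (by fun_prop)
  have i1 := h.isCG_left.integrable_norm_rpow (p := -(7 / 4)) (by norm_num)
  have i2 := h.isCG_resid.integrable_norm_rpow (p := -(3 / 4)) (by norm_num)
  refine ⟨hi.integrable_mul i1 i2, ?_⟩
  rw [hi.integral_fun_mul_eq_mul_integral i1.1 i2.1,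
    h.isCG_left.integral_norm_rpow (by norm_num), h.isCG_resid.integral_norm_rpow (by norm_num)]
  have e : Real.sqrt (1 - ‖r‖ ^ 2) ^ (-(3 / 4) : ℝ) = (1 - ‖r‖ ^ 2) ^ (-(3 / 8) : ℝ) := by
    rw [Real.sqrt_eq_rpow, ← Real.rpow_mul h.one_sub_pos.le]; norm_num
  rw [e, Real.sqrt_one, Real.one_rpow]
  norm_num
  ring

/-- The constant in the bound for the joint negative moment of a unit pair. -/
noncomputable def negMomentConst : ℝ :=
  2 * (2 ^ (3 / 4 : ℝ) * (Real.Gamma (1 / 8) * Real.Gamma (5 / 8)))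

/-- Whichever of |z|, |w| is larger is traded for its residual on the other, independent of it and
of variance 1-|r|². The residual's moment of order -3/4 scales as (1-|r|²)^(-3/8). -/
lemma integrable_rpow_mul [IsProbabilityMeasure P] :
    Integrable (fun ω => (‖z ω‖ * ‖w ω‖) ^ (-(5 / 4) : ℝ)) P ∧
    ∫ ω, (‖z ω‖ * ‖w ω‖) ^ (-(5 / 4) : ℝ) ∂P ≤
      negMomentConst * (1 - ‖r‖ ^ 2) ^ (-(3 / 8) : ℝ) := by
  obtain ⟨i1, e1⟩ := h.integrable_half
  obtain ⟨i2, e2⟩ := h.symm.integrable_half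
  simp only [Complex.conj_conj, RCLike.norm_conj] at i2 e2
  have mz := h.isCG_left.measurable
  have mw := h.isCG_right.measurable
  have hs := (i1.const_mul (2 ^ (3 / 4 : ℝ))).add (i2.const_mul (2 ^ (3 / 4 : ℝ)))
  have hb : ∀ᵐ ω ∂P, (‖z ω‖ * ‖w ω‖) ^ (-(5 / 4) : ℝ) ≤
      2 ^ (3 / 4 : ℝ) * (‖z ω‖ ^ (-(7 / 4) : ℝ) *
        ‖(w - (starRingEnd ℂ) r • z) ω‖ ^ (-(3 / 4) : ℝ)) +
      2 ^ (3 / 4 : ℝ) * (‖w ω‖ ^ (-(7 / 4) : ℝ) * ‖(z - r • w) ω‖ ^ (-(3 / 4) : ℝ)) := by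
    have hn := h.symm.isCG_resid.ae_ne_zero (by rw [RCLike.norm_conj]; exact h.one_sub_pos)
    simp only [Complex.conj_conj] at hn
    filter_upwards [h.ae_ne, h.isCG_resid.ae_ne_zero h.one_sub_pos, hn] with ω ⟨h1, h2⟩ h3 h4
    have p1 := norm_pos_iff.2 h1
    have p2 := norm_pos_iff.2 h2
    have hr := h.norm_lt.le
    rcases le_total ‖z ω‖ ‖w ω‖ with hle | hle
    · have := rpow_neg_mul_le p1 p2 hle (norm_pos_iff.2 h3) (by
        simp only [Pi.sub_apply, Pi.smul_apply, smul_eq_mul]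
        refine (norm_sub_le _ _).trans ?_
        rw [norm_mul, RCLike.norm_conj]
        nlinarith)
      have h5 : 0 ≤ 2 ^ (3 / 4 : ℝ) * (‖w ω‖ ^ (-(7 / 4) : ℝ) *
        ‖(z - r • w) ω‖ ^ (-(3 / 4) : ℝ)) := by positivity
      linarith
    · have := rpow_neg_mul_le p2 p1 hle (norm_pos_iff.2 h4) (by
        simp only [Pi.sub_apply, Pi.smul_apply, smul_eq_mul]
        refine (norm_sub_le _ _).trans ?_
        rw [norm_mul]
        nlinarith)
      have h5 : 0 ≤ 2 ^ (3 / 4 : ℝ) * (‖z ω‖ ^ (-(7 / 4) : ℝ) *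
        ‖(w - (starRingEnd ℂ) r • z) ω‖ ^ (-(3 / 4) : ℝ)) := by positivity
      rw [mul_comm ‖z ω‖]
      linarith
  have hi : Integrable (fun ω => (‖z ω‖ * ‖w ω‖) ^ (-(5 / 4) : ℝ)) P := by
    refine Integrable.mono' hs (Measurable.aestronglyMeasurable (by fun_prop)) ?_
    filter_upwards [hb] with ω hω
    rw [Real.norm_of_nonneg (by positivity)]
    exact hω
  refine ⟨hi, (integral_mono_ae hi hs hb).trans (le_of_eq ?_)⟩
  simp only [Pi.add_apply]
  rw [integral_add (i1.const_mul _) (i2.const_mul _), integral_const_mul, integral_const_mul, e1, e2,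
    negMomentConst]
  ring

/-- Young's inequality decouples the numerator from the denominator, so no relation between (U,V)
and (z,w) is required. -/
lemma integrable_of_norm_le [IsProbabilityMeasure P] {U V : Ω → ℂ} (hU : U ∈ H) (hV : V ∈ H)
    {φ : Ω → ℂ} (hφ : Measurable φ) (hb : ∀ ω, ‖φ ω‖ ≤ ‖U ω‖ * ‖V ω‖ * (‖z ω‖ * ‖w ω‖)⁻¹) :
    Integrable φ P := by
  have i1 := (h.space.isCG hU).integrable_norm_pow 10
  have i2 := (h.space.isCG hV).integrable_norm_pow 10
  refine Integrable.mono' ((i1.add i2).add h.integrable_rpow_mul.1) hφ.aestronglyMeasurable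
    (ae_of_all _ fun ω => (hb ω).trans ?_)
  refine (mul_inv_le_pow_add_rpow (by positivity) (by positivity)).trans ?_
  have := mul_pow_five_le ‖U ω‖ ‖V ω‖
  simp only [Pi.add_apply]
  linarith

lemma integral_norm_le [IsProbabilityMeasure P] {U V : Ω → ℂ} (hU : U ∈ H) (hV : V ∈ H)
    {M : ℝ} (hUM : cov P U U = M) (hVM : cov P V V = M) :
    ∫ ω, ‖U ω‖ * ‖V ω‖ * (‖z ω‖ * ‖w ω‖)⁻¹ ∂P ≤
      2 * (M ^ 5 * 120) + negMomentConst * (1 - ‖r‖ ^ 2) ^ (-(3 / 8) : ℝ) := by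
  have c1 := h.space.isCG_of_cov hU hUM
  have c2 := h.space.isCG_of_cov hV hVM
  have i1 := c1.integrable_norm_pow 10
  have i2 := c2.integrable_norm_pow 10
  obtain ⟨i3, e3⟩ := h.integrable_rpow_mul
  have := integral_mono_of_nonneg (μ := P)
    (f := fun ω => ‖U ω‖ * ‖V ω‖ * (‖z ω‖ * ‖w ω‖)⁻¹) (ae_of_all _ fun ω => by positivity)
    ((i1.add i2).add i3) (ae_of_all _ fun ω =>
      (mul_inv_le_pow_add_rpow (by positivity) (by positivity)).trans
        (add_le_add (mul_pow_five_le ‖U ω‖ ‖V ω‖) le_rfl))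
  refine this.trans ?_
  rw [integral_add' (i1.add i2) i3, integral_add' i1 i2, c1.integral_norm_pow_ten,
    c2.integral_norm_pow_ten]
  linarith

end IsUnitPair

end

/-! ### Two-point expectations by Gaussian regression. -/

section

variable {Ω : Type*} [MeasurableSpace Ω] {P : Measure Ω}

lemma integrable_fun_sub {f g : Ω → ℂ} (hf : Integrable f P) (hg : Integrable g P) :
    Integrable (fun ω => f ω - g ω) P :=
  hf.sub hg

namespace IsUnitPair

section Moments

variable {H : Submodule ℂ (Ω → ℂ)} {z w : Ω → ℂ} {r : ℂ} (h : IsUnitPair P H z w r)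
include h

omit [MeasurableSpace Ω] h in
lemma coresid_eq : z - (starRingEnd ℂ) ((starRingEnd ℂ) r) • w = z - r • w := by
  rw [Complex.conj_conj]

lemma coresid_mem : z - r • w ∈ H := coresid_eq ▸ h.symm.resid_mem

lemma cov_coresid_right : cov P (z - r • w) w = 0 := coresid_eq ▸ h.symm.cov_resid_left

lemma cov_coresid_left : cov P (z - r • w) z = ((1 - ‖r‖ ^ 2 : ℝ) : ℂ) := by
  have := h.symm.cov_resid_right
  rwa [coresid_eq, RCLike.norm_conj] at this

/-- Since w = r̄z + (residual independent of z), the law of (z,w) is an explicit linear image of two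
independent standard Gaussians. -/
lemma integral_comp [IsProbabilityMeasure P] {φ : ℂ × ℂ → ℂ} (hφ : Measurable φ) :
    ∫ ω, φ (z ω, w ω) ∂P = ∫ p, φ (p.1, (starRingEnd ℂ) r * p.1 +
      (Real.sqrt (1 - ‖r‖ ^ 2) : ℝ) * p.2) ∂(stdComplexGaussian.prod stdComplexGaussian) ∧
    (Integrable (fun ω => φ (z ω, w ω)) P ↔ Integrable (fun p => φ (p.1, (starRingEnd ℂ) r * p.1 +
      (Real.sqrt (1 - ‖r‖ ^ 2) : ℝ) * p.2)) (stdComplexGaussian.prod stdComplexGaussian)) := by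
  have mz := h.isCG_left.measurable
  have mw := h.isCG_right.measurable
  have mG := h.isCG_resid.measurable
  have key : P.map (fun ω => (z ω, w ω)) = (stdComplexGaussian.prod stdComplexGaussian).map
      (fun p => (p.1, (starRingEnd ℂ) r * p.1 + (Real.sqrt (1 - ‖r‖ ^ 2) : ℝ) * p.2)) := by
    have h1 := (indepFun_iff_map_prod_eq_prod_map_map mz.aemeasurable mG.aemeasurable).1
      h.indep_resid
    rw [h.isCG_left.map_eq_std, h.isCG_resid.law] at h1
    have h2 : stdComplexGaussian.prod (stdComplexGaussian.map
        (fun z => ((Real.sqrt (1 - ‖r‖ ^ 2) : ℝ) : ℂ) * z)) =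
        (stdComplexGaussian.prod stdComplexGaussian).map
          (Prod.map id (fun z => ((Real.sqrt (1 - ‖r‖ ^ 2) : ℝ) : ℂ) * z)) := by
      rw [← Measure.map_prod_map _ _ measurable_id (by fun_prop), Measure.map_id]
    have h3 : (fun ω => (z ω, w ω)) = (fun p : ℂ × ℂ => (p.1, (starRingEnd ℂ) r * p.1 + p.2)) ∘
        (fun ω => (z ω, (w - (starRingEnd ℂ) r • z) ω)) := by
      ext ω <;> simp
    rw [h3, ← Measure.map_map (by fun_prop) (by fun_prop), h1, h2,
      Measure.map_map (by fun_prop) (by fun_prop)]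
    rfl
  have m1 : AEMeasurable (fun ω => (z ω, w ω)) P := by fun_prop
  have m2 : AEMeasurable (fun p : ℂ × ℂ => (p.1, (starRingEnd ℂ) r * p.1 +
    (Real.sqrt (1 - ‖r‖ ^ 2) : ℝ) * p.2)) (stdComplexGaussian.prod stdComplexGaussian) := by
    fun_prop
  constructor
  · rw [← integral_map m1 hφ.aestronglyMeasurable, key, integral_map m2 hφ.aestronglyMeasurable]
  · have e1 := integrable_map_measure (μ := P) (g := φ) hφ.aestronglyMeasurable m1
    rw [key, integrable_map_measure hφ.aestronglyMeasurable m2] at e1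
    exact e1.symm

lemma integrable_inv [IsProbabilityMeasure P] {φ : Ω → ℂ} (hφ : Measurable φ)
    (hb : ∀ ω, ‖φ ω‖ ≤ (‖z ω‖ * ‖w ω‖)⁻¹) : Integrable φ P := by
  refine Integrable.mono' ((integrable_const 1).add h.integrable_rpow_mul.1)
    hφ.aestronglyMeasurable (ae_of_all _ fun ω => (hb ω).trans ?_)
  have := mul_inv_le_pow_add_rpow zero_le_one
    (mul_nonneg (norm_nonneg (z ω)) (norm_nonneg (w ω)))
  simpa using this

lemma sqrt_facts : 0 < Real.sqrt (1 - ‖r‖ ^ 2) ∧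
    ‖(starRingEnd ℂ) r‖ ^ 2 + Real.sqrt (1 - ‖r‖ ^ 2) ^ 2 = 1 :=
  ⟨Real.sqrt_pos.2 h.one_sub_pos, by
    rw [Real.sq_sqrt h.one_sub_pos.le, RCLike.norm_conj]; ring⟩

lemma integral_inv_mul_conj [IsProbabilityMeasure P] :
    ∫ ω, (z ω * (starRingEnd ℂ) (w ω))⁻¹ ∂P = Real.log (1 / (1 - ‖r‖ ^ 2)) / r := by
  -- At r = 0 the right side is 0 by the convention for division by zero; independence and the
  -- vanishing mean of 1/z give the same value.
  rcases eq_or_ne r 0 with rfl | hr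
  · have hi : IndepFun (fun ω => (z ω)⁻¹) (fun ω => ((starRingEnd ℂ) (w ω))⁻¹) P := by
      have := h.indep_resid.comp (φ := fun x => x⁻¹) (ψ := fun x => ((starRingEnd ℂ) x)⁻¹)
        (by fun_prop) (by fun_prop)
      simpa [Function.comp_def] using this
    have mz := h.isCG_left.measurable
    have mw := h.isCG_right.measurable
    simp_rw [mul_inv]
    rw [hi.integral_fun_mul_eq_mul_integral (Measurable.aestronglyMeasurable (by fun_prop))
      (Measurable.aestronglyMeasurable (by fun_prop)), h.isCG_left.integral_inv_eq_zero]
    simp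
  · obtain ⟨h0, h1⟩ := h.sqrt_facts
    have mz := h.isCG_left.measurable
    have mw := h.isCG_right.measurable
    obtain ⟨e1, e2⟩ := h.integral_comp (φ := fun p => ((starRingEnd ℂ) p.1 * p.2)⁻¹) (by fun_prop)
    have hi := e2.1 (h.integrable_inv (by fun_prop) fun ω => by simp [mul_comm])
    have h2 := integral_inv_conj_mul_correlated (by simpa using hr) h0 h1 hi
    rw [← e1, Real.sq_sqrt h.one_sub_pos.le] at h2
    have e3 : ∀ ω, (z ω * (starRingEnd ℂ) (w ω))⁻¹ =
        (starRingEnd ℂ) (((starRingEnd ℂ) (z ω) * w ω)⁻¹) := fun ω => by simp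
    simp_rw [e3]
    rw [integral_conj, h2, map_div₀, Complex.conj_ofReal, Complex.conj_conj]

lemma integral_unimodular [IsProbabilityMeasure P] :
    ∫ ω, w ω * (starRingEnd ℂ) (z ω) * (z ω * (starRingEnd ℂ) (w ω))⁻¹ ∂P =
      (starRingEnd ℂ) r / r *
        (1 - Real.log (1 / (1 - ‖r‖ ^ 2)) * ((1 - ‖r‖ ^ 2) / ‖r‖ ^ 2)) := by
  have mz := h.isCG_left.measurable
  have mw := h.isCG_right.measurable
  rcases eq_or_ne r 0 with rfl | hr
  · have hi : IndepFun (fun ω => (starRingEnd ℂ) (z ω) / z ω)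
        (fun ω => w ω / (starRingEnd ℂ) (w ω)) P := by
      have := h.indep_resid.comp (φ := fun x => (starRingEnd ℂ) x / x)
        (ψ := fun x => x / (starRingEnd ℂ) x) (by fun_prop) (by fun_prop)
      simpa [Function.comp_def] using this
    have e : ∀ ω, w ω * (starRingEnd ℂ) (z ω) * (z ω * (starRingEnd ℂ) (w ω))⁻¹ =
        (starRingEnd ℂ) (z ω) / z ω * (w ω / (starRingEnd ℂ) (w ω)) := fun ω => by
      rw [mul_inv]; ring
    have e0 : ∫ ω, (starRingEnd ℂ) (z ω) / z ω ∂P = 0 :=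
      h.isCG_left.integral_eq_of_homogeneous (φ := fun x => (starRingEnd ℂ) x / x) (by fun_prop)
        (u := Complex.I) (v := -1) (by simp) (by norm_num) fun x => by
          simp only [map_mul, Complex.conj_I]
          rw [mul_div_mul_comm]; simp
    simp_rw [e]
    rw [hi.integral_fun_mul_eq_mul_integral (Measurable.aestronglyMeasurable (by fun_prop))
      (Measurable.aestronglyMeasurable (by fun_prop)), e0]
    simp
  · obtain ⟨h0, h1⟩ := h.sqrt_facts
    obtain ⟨e1, -⟩ := h.integral_comp
      (φ := fun p => (starRingEnd ℂ) p.2 / p.2 * (p.1 / (starRingEnd ℂ) p.1)) (by fun_prop)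
    have h2 := integral_unimodular_correlated (by simpa using hr) h0 h1
    rw [← e1, Real.sq_sqrt h.one_sub_pos.le] at h2
    have e3 : ∀ ω, w ω * (starRingEnd ℂ) (z ω) * (z ω * (starRingEnd ℂ) (w ω))⁻¹ =
        (starRingEnd ℂ) ((starRingEnd ℂ) (w ω) / w ω * (z ω / (starRingEnd ℂ) (z ω))) := fun ω => by
      simp only [map_mul, map_div₀, Complex.conj_conj, mul_inv]; ring
    simp_rw [e3]
    rw [integral_conj, h2]
    simp only [map_mul, map_div₀, map_sub, map_one, Complex.conj_ofReal, Complex.conj_conj,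
      RCLike.norm_conj, ← Complex.ofReal_pow, Real.sq_sqrt h.one_sub_pos.le]
    push_cast
    rfl

/-- Dividing w = r̄z + residual by z, the residual term has mean zero because it is independent of z
and 1/z has mean zero. -/
lemma integral_div [IsProbabilityMeasure P] :
    Integrable (fun ω => w ω / z ω) P ∧ ∫ ω, w ω / z ω ∂P = (starRingEnd ℂ) r := by
  have mz := h.isCG_left.measurable
  have mw := h.isCG_right.measurable
  have mG := h.isCG_resid.measurable
  have hw : Integrable (fun ω => w ω / z ω) P :=
    h.integrable_of_norm_le h.right_mem h.right_mem (by fun_prop) fun ω => by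
      rcases eq_or_ne (w ω) 0 with h0 | h0
      · simp [h0]
      · rw [norm_div]; apply le_of_eq; field_simp
  refine ⟨hw, ?_⟩
  have hi := h.indep_resid.comp (φ := fun x => x⁻¹) (ψ := id) (by fun_prop) measurable_id
  have e0 : ∫ ω, (z ω)⁻¹ * (w - (starRingEnd ℂ) r • z) ω ∂P = 0 := by
    have := hi.integral_fun_mul_eq_mul_integral (Measurable.aestronglyMeasurable (by fun_prop))
      (Measurable.aestronglyMeasurable (by fun_prop))
    simp only [Function.comp_def, id_eq] at this
    rw [this, h.isCG_left.integral_inv_eq_zero, zero_mul]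
  have e1 : ∫ ω, (z ω)⁻¹ * (w - (starRingEnd ℂ) r • z) ω ∂P =
      ∫ ω, (w ω / z ω - (starRingEnd ℂ) r) ∂P := by
    refine integral_congr_ae ?_
    filter_upwards [h.ae_ne] with ω hω
    have := hω.1
    simp only [Pi.sub_apply, Pi.smul_apply, smul_eq_mul]
    field_simp
  rw [e1, integral_sub hw (integrable_const _)] at e0
  simpa [sub_eq_zero] using e0

lemma integral_div' [IsProbabilityMeasure P] :
    Integrable (fun ω => z ω / w ω) P ∧ ∫ ω, z ω / w ω ∂P = r := by
  simpa using h.symm.integral_div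

lemma integral_resid_mul_coresid [IsProbabilityMeasure P] :
    ∫ ω, (w - (starRingEnd ℂ) r • z) ω * (z - r • w) ω * (z ω * w ω)⁻¹ ∂P =
      ((1 - ‖r‖ ^ 2 : ℝ) : ℂ) := by
  obtain ⟨i1, e1⟩ := h.integral_div
  obtain ⟨i2, e2⟩ := h.integral_div'
  have e : ∫ ω, (w - (starRingEnd ℂ) r • z) ω * (z - r • w) ω * (z ω * w ω)⁻¹ ∂P =
      ∫ ω, ((1 + (starRingEnd ℂ) r * r) - r * (w ω / z ω) - (starRingEnd ℂ) r * (z ω / w ω)) ∂P := by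
    refine integral_congr_ae ?_
    filter_upwards [h.ae_ne] with ω ⟨h1, h2⟩
    simp only [Pi.sub_apply, Pi.smul_apply, smul_eq_mul]
    field_simp
    ring
  rw [e, integral_sub (integrable_fun_sub (integrable_const _) (i1.const_mul _)) (i2.const_mul _),
    integral_sub (integrable_const _) (i1.const_mul _), integral_const_mul, integral_const_mul,
    e1, e2, integral_const, mul_comm r, conj_mul_self_eq]
  simp

lemma integral_resid_mul_conj_coresid [IsProbabilityMeasure P] :
    ∫ ω, (w - (starRingEnd ℂ) r • z) ω * (starRingEnd ℂ) ((z - r • w) ω) *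
        (z ω * (starRingEnd ℂ) (w ω))⁻¹ ∂P =
      (starRingEnd ℂ) r / r *
        (1 - Real.log (1 / (1 - ‖r‖ ^ 2)) * ((1 - ‖r‖ ^ 2) / ‖r‖ ^ 2)) - (starRingEnd ℂ) r ^ 2 := by
  have mz := h.isCG_left.measurable
  have mw := h.isCG_right.measurable
  obtain ⟨i1, e1⟩ := h.integral_div
  obtain ⟨i2, e2⟩ := h.integral_div'
  have i3 : Integrable (fun ω => w ω * (starRingEnd ℂ) (z ω) * (z ω * (starRingEnd ℂ) (w ω))⁻¹) P :=
    h.integrable_of_norm_le h.right_mem h.left_mem (by fun_prop) fun ω => by simp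
  have i4 : Integrable (fun ω => (starRingEnd ℂ) (z ω / w ω)) P := ((RCLike.conjCLE : ℂ ≃L[ℝ] ℂ).toContinuousLinearMap.integrable_comp i2)
  have e : ∫ ω, (w - (starRingEnd ℂ) r • z) ω * (starRingEnd ℂ) ((z - r • w) ω) *
        (z ω * (starRingEnd ℂ) (w ω))⁻¹ ∂P =
      ∫ ω, (w ω * (starRingEnd ℂ) (z ω) * (z ω * (starRingEnd ℂ) (w ω))⁻¹
        - (starRingEnd ℂ) r * (w ω / z ω) - (starRingEnd ℂ) r * (starRingEnd ℂ) (z ω / w ω)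
        + (starRingEnd ℂ) r ^ 2) ∂P := by
    refine integral_congr_ae ?_
    filter_upwards [h.ae_ne] with ω ⟨h1, h2⟩
    have h3 : (starRingEnd ℂ) (w ω) ≠ 0 := by simpa using h2
    simp only [Pi.sub_apply, Pi.smul_apply, smul_eq_mul, map_sub, map_mul, map_div₀]
    field_simp
    ring
  rw [e, integral_add (integrable_fun_sub (integrable_fun_sub i3 (i1.const_mul _)) (i4.const_mul _)) (integrable_const _),
    integral_sub (integrable_fun_sub i3 (i1.const_mul _)) (i4.const_mul _), integral_sub i3 (i1.const_mul _),
    integral_const_mul, integral_const_mul, integral_conj, e1, e2, integral_const,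
    h.integral_unimodular]
  simp
  ring

end Moments

variable {H : Submodule ℂ (Ω → ℂ)} {z w u v : Ω → ℂ} {r q Q : ℂ}

/-- The residual of `u` after regression on `z` and `w`. -/
noncomputable def leftNoise (z w u : Ω → ℂ) (r q : ℂ) : Ω → ℂ :=
  u - (q / ((1 - ‖r‖ ^ 2 : ℝ) : ℂ)) • (w - (starRingEnd ℂ) r • z)

/-- The residual of `v` after regression on `z` and `w`. -/
noncomputable def rightNoise (z w v : Ω → ℂ) (r q : ℂ) : Ω → ℂ :=
  v + (starRingEnd ℂ) (q / ((1 - ‖r‖ ^ 2 : ℝ) : ℂ)) • (z - r • w)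

variable (h : IsUnitPair P H z w r) (hu : u ∈ H) (hv : v ∈ H)
include h

lemma ofReal_one_sub_ne_zero : ((1 - ‖r‖ ^ 2 : ℝ) : ℂ) ≠ 0 := by
  exact_mod_cast h.one_sub_pos.ne'

include hu in
lemma leftNoise_mem : leftNoise z w u r q ∈ H :=
  H.sub_mem hu (H.smul_mem _ h.resid_mem)

include hv in
lemma rightNoise_mem : rightNoise z w v r q ∈ H :=
  H.add_mem hv (H.smul_mem _ h.coresid_mem)

include hu in
lemma cov_leftNoise_left (huz : cov P u z = 0) : cov P (leftNoise z w u r q) z = 0 := by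
  rw [leftNoise, h.space.cov_sub_left hu (H.smul_mem _ h.resid_mem) h.left_mem,
    IsGaussianSpace.cov_smul_left, h.cov_resid_left, huz]
  simp

include hu in
lemma cov_leftNoise_right (huw : cov P u w = q) : cov P (leftNoise z w u r q) w = 0 := by
  have := h.ofReal_one_sub_ne_zero
  rw [leftNoise, h.space.cov_sub_left hu (H.smul_mem _ h.resid_mem) h.right_mem,
    IsGaussianSpace.cov_smul_left, h.cov_resid_right, huw, div_mul_cancel₀ _ this, sub_self]

include hv in
lemma cov_rightNoise_right (hvw : cov P v w = 0) : cov P (rightNoise z w v r q) w = 0 := by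
  rw [rightNoise, h.space.cov_add_left hv (H.smul_mem _ h.coresid_mem) h.right_mem,
    IsGaussianSpace.cov_smul_left, h.cov_coresid_right, hvw]
  simp

include hv in
lemma cov_rightNoise_left (hvz : cov P v z = -(starRingEnd ℂ) q) :
    cov P (rightNoise z w v r q) z = 0 := by
  have := h.ofReal_one_sub_ne_zero
  rw [rightNoise, h.space.cov_add_left hv (H.smul_mem _ h.coresid_mem) h.left_mem,
    IsGaussianSpace.cov_smul_left, h.cov_coresid_left, hvz, map_div₀, Complex.conj_ofReal,
    div_mul_cancel₀ _ this, neg_add_cancel]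

include hu hv in
lemma cov_leftNoise_rightNoise (huz : cov P u z = 0) (huw : cov P u w = q)
    (hvw : cov P v w = 0) (hvz : cov P v z = -(starRingEnd ℂ) q) (huv : cov P u v = Q) :
    cov P (leftNoise z w u r q) (rightNoise z w v r q) =
      Q - q ^ 2 * (starRingEnd ℂ) r / ((1 - ‖r‖ ^ 2 : ℝ) : ℂ) := by
  have m1 := h.leftNoise_mem hu (q := q)
  have e1 : cov P (leftNoise z w u r q) (z - r • w) = 0 := by
    rw [h.space.cov_sub_right h.left_mem (H.smul_mem _ h.right_mem) m1,
      IsGaussianSpace.cov_smul_right, h.cov_leftNoise_left hu huz, h.cov_leftNoise_right hu huw]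
    simp
  have e2 : cov P (w - (starRingEnd ℂ) r • z) v = (starRingEnd ℂ) r * q := by
    rw [h.space.cov_sub_left h.right_mem (H.smul_mem _ h.left_mem) hv,
      IsGaussianSpace.cov_smul_left, ← cov_conj v, ← cov_conj v, hvw, hvz]
    simp
  rw [rightNoise, h.space.cov_add_right hv (H.smul_mem _ h.coresid_mem) m1,
    IsGaussianSpace.cov_smul_right, e1, leftNoise,
    h.space.cov_sub_left hu (H.smul_mem _ h.resid_mem) hv, IsGaussianSpace.cov_smul_left, e2, huv]
  ring

-- As u is uncorrelated with z, its projection on the span of z and w lies along w - r̄z; likewise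
-- that of v lies along z - rw. The remaining noises are independent of (z,w), so mixed terms vanish
-- and the noise product factors out. Taking c to be the identity or conjugation treats uv/(zw) and
-- u v̄/(z w̄) together.
include hu hv in
lemma integral_mul_div [IsProbabilityMeasure P] (huz : cov P u z = 0) (huw : cov P u w = q)
    (hvw : cov P v w = 0) (hvz : cov P v z = -(starRingEnd ℂ) q)
    {c : ℂ →+* ℂ} (hc : Measurable c) (hcn : ∀ x, ‖c x‖ = ‖x‖) :
    ∫ ω, u ω * c (v ω) * (z ω * c (w ω))⁻¹ ∂P =
      -(q / ((1 - ‖r‖ ^ 2 : ℝ) : ℂ) * c ((starRingEnd ℂ) (q / ((1 - ‖r‖ ^ 2 : ℝ) : ℂ)))) *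
        ∫ ω, (w - (starRingEnd ℂ) r • z) ω * c ((z - r • w) ω) * (z ω * c (w ω))⁻¹ ∂P +
      (∫ ω, leftNoise z w u r q ω * c (rightNoise z w v r q ω) ∂P) *
        ∫ ω, (z ω * c (w ω))⁻¹ ∂P := by
  set β := q / ((1 - ‖r‖ ^ 2 : ℝ) : ℂ) with hβ
  set ξ := leftNoise z w u r q with hξ
  set η := rightNoise z w v r q with hη
  set G := w - (starRingEnd ℂ) r • z with hG
  set G' := z - r • w with hG'
  have mz := h.isCG_left.measurable
  have mw := h.isCG_right.measurable
  have hξm : ξ ∈ H := h.leftNoise_mem hu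
  have hηm : η ∈ H := h.rightNoise_mem hv
  have hGm : G ∈ H := h.resid_mem
  have hGm' : G' ∈ H := h.coresid_mem
  have mξ := h.space.measurable hξm
  have mη := h.space.measurable hηm
  have mG := h.space.measurable hGm
  have mG' := h.space.measurable hGm'
  have ind : IndepFun (fun ω => (ξ ω, η ω)) (fun ω => (z ω, w ω)) P :=
    h.space.indepFun hξm hηm h.left_mem h.right_mem (h.cov_leftNoise_left hu huz)
      (h.cov_leftNoise_right hu huw) (h.cov_rightNoise_left hv hvz) (h.cov_rightNoise_right hv hvw)
  have split : ∀ {φ ψ : ℂ × ℂ → ℂ}, Measurable φ → Measurable ψ →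
      ∫ ω, φ (ξ ω, η ω) * ψ (z ω, w ω) ∂P =
        (∫ ω, φ (ξ ω, η ω) ∂P) * ∫ ω, ψ (z ω, w ω) ∂P := fun {φ ψ} hφ hψ =>
    (ind.comp hφ hψ).integral_fun_mul_eq_mul_integral
      (Measurable.aestronglyMeasurable (hφ.comp (by fun_prop)))
      (Measurable.aestronglyMeasurable (hψ.comp (by fun_prop)))
  have int : ∀ {a b : Ω → ℂ}, a ∈ H → b ∈ H →
      Integrable (fun ω => a ω * c (b ω) * (z ω * c (w ω))⁻¹) P := fun {a b} ha hb => by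
    have ma := h.space.measurable ha
    have mb := h.space.measurable hb
    exact h.integrable_of_norm_le ha hb (by fun_prop) fun ω => by simp [hcn, mul_comm]
  have z1 : ∫ ω, G ω * c (η ω) * (z ω * c (w ω))⁻¹ ∂P = 0 := by
    have h1 := split (φ := fun p => c p.2)
      (ψ := fun p => (p.2 - (starRingEnd ℂ) r * p.1) * (p.1 * c p.2)⁻¹) (by fun_prop) (by fun_prop)
    have h0 : ∫ ω, c (η ω) ∂P = 0 := (h.space.isCG hηm).integral_eq_of_homogeneous hc
      (u := -1) (v := -1) (by simp) (by norm_num) fun x => by simp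
    simp only [h0, zero_mul] at h1
    rw [← h1]
    congr 1; ext ω
    simp only [hG, Pi.sub_apply, Pi.smul_apply, smul_eq_mul]; ring
  have z2 : ∫ ω, ξ ω * c (G' ω) * (z ω * c (w ω))⁻¹ ∂P = 0 := by
    have h1 := split (φ := fun p => p.1)
      (ψ := fun p => c (p.1 - r * p.2) * (p.1 * c p.2)⁻¹) (by fun_prop) (by fun_prop)
    simp only [(h.space.isCG hξm).integral_eq_zero, zero_mul] at h1
    rw [← h1]
    congr 1; ext ω
    simp only [hG', Pi.sub_apply, Pi.smul_apply, smul_eq_mul]; ring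
  have z3 := split (φ := fun p => p.1 * c p.2) (ψ := fun p => (p.1 * c p.2)⁻¹) (by fun_prop)
    (by fun_prop)
  have e : ∀ ω, u ω * c (v ω) * (z ω * c (w ω))⁻¹ =
      -(β * c ((starRingEnd ℂ) β)) * (G ω * c (G' ω) * (z ω * c (w ω))⁻¹)
      + β * (G ω * c (η ω) * (z ω * c (w ω))⁻¹)
      - c ((starRingEnd ℂ) β) * (ξ ω * c (G' ω) * (z ω * c (w ω))⁻¹)
      + ξ ω * c (η ω) * (z ω * c (w ω))⁻¹ := fun ω => by
    have eu : u ω = β * G ω + ξ ω := by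
      simp only [hξ, leftNoise, Pi.sub_apply, Pi.smul_apply, smul_eq_mul, hβ, hG]; ring
    have ev : v ω = η ω - (starRingEnd ℂ) β * G' ω := by
      simp only [hη, rightNoise, Pi.sub_apply, Pi.add_apply, Pi.smul_apply, smul_eq_mul, hβ, hG']
      ring
    rw [eu, ev, map_sub, map_mul]; ring
  simp_rw [e]
  have j1 := int hGm hGm'
  have j2 := int hGm hηm
  have j3 := int hξm hGm'
  have j4 := int hξm hηm
  rw [integral_add (integrable_fun_sub ((j1.const_mul _).fun_add (j2.const_mul _)) (j3.const_mul _)) j4,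
    integral_sub ((j1.const_mul _).fun_add (j2.const_mul _)) (j3.const_mul _),
    integral_add (j1.const_mul _) (j2.const_mul _), integral_const_mul, integral_const_mul,
    integral_const_mul, z1, z2, z3]
  ring

include hu hv in
/-- The covariance of the imaginary parts of `u / z` and `v / w`. -/
theorem integral_im_mul_im [IsProbabilityMeasure P] (huz : cov P u z = 0) (huw : cov P u w = q)
    (hvw : cov P v w = 0) (hvz : cov P v z = -(starRingEnd ℂ) q) (huv : cov P u v = Q) :
    ∫ ω, (u ω / z ω).im * (v ω / w ω).im ∂P = (1 / 2 : ℝ) *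
      (-(q / (1 - ‖r‖ ^ 2 : ℝ)) ^ 2 * ((starRingEnd ℂ) r / r *
        (1 - Real.log (1 / (1 - ‖r‖ ^ 2)) * ((1 - ‖r‖ ^ 2) / ‖r‖ ^ 2)) - (starRingEnd ℂ) r ^ 2) +
        (Q - q ^ 2 * (starRingEnd ℂ) r / (1 - ‖r‖ ^ 2 : ℝ)) *
          (Real.log (1 / (1 - ‖r‖ ^ 2)) / r) + (‖q‖ ^ 2 / (1 - ‖r‖ ^ 2) : ℝ)).re := by
  have mz := h.isCG_left.measurable
  have mw := h.isCG_right.measurable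
  have mu := h.space.measurable hu
  have mv := h.space.measurable hv
  have a1 := h.integral_mul_div hu hv huz huw hvw hvz (c := RingHom.id ℂ) measurable_id
    fun x => rfl
  have a2 := h.integral_mul_div hu hv huz huw hvw hvz (c := starRingEnd ℂ) (by fun_prop)
    fun x => RCLike.norm_conj x
  simp only [RingHom.id_apply, h.integral_resid_mul_coresid, h.space.integral_mul_eq_zero
    (h.leftNoise_mem hu) (h.rightNoise_mem hv)] at a1
  have a3 := h.cov_leftNoise_rightNoise hu hv huz huw hvw hvz huv
  rw [cov] at a3
  rw [h.integral_resid_mul_conj_coresid, h.integral_inv_mul_conj, a3, Complex.conj_conj] at a2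
  have i1 : Integrable (fun ω => u ω * v ω * (z ω * w ω)⁻¹) P :=
    h.integrable_of_norm_le hu hv (by fun_prop) fun ω => by simp [mul_comm]
  have i2 : Integrable (fun ω => u ω * (starRingEnd ℂ) (v ω) *
      (z ω * (starRingEnd ℂ) (w ω))⁻¹) P :=
    h.integrable_of_norm_le hu hv (by fun_prop) fun ω => by simp [mul_comm]
  -- Im a Im b = ½ Re(a b̄ - ab). In the term ab the noise product has mean zero by circularity,
  -- leaving only -|q|²/(1-|r|²), which enters with the opposite sign.
  have e : ∀ ω, (u ω / z ω).im * (v ω / w ω).im = (1 / 2 : ℝ) *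
      ((u ω * (starRingEnd ℂ) (v ω) * (z ω * (starRingEnd ℂ) (w ω))⁻¹) -
        u ω * v ω * (z ω * w ω)⁻¹).re := fun ω => by
    have e1 : u ω * (starRingEnd ℂ) (v ω) * (z ω * (starRingEnd ℂ) (w ω))⁻¹ =
        u ω / z ω * (starRingEnd ℂ) (v ω / w ω) := by rw [map_div₀, mul_inv]; ring
    have e2 : u ω * v ω * (z ω * w ω)⁻¹ = u ω / z ω * (v ω / w ω) := by rw [mul_inv]; ring
    rw [e1, e2]
    simp only [Complex.sub_re, Complex.mul_re, Complex.conj_re, Complex.conj_im]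
    ring
  simp_rw [e]
  rw [integral_const_mul]
  have e3 := integral_re (i2.sub i1)
  simp only [Pi.sub_apply, RCLike.re_eq_complex_re] at e3
  rw [e3, integral_sub i2 i1, a2, a1]
  congr 2
  have e4 : q * (starRingEnd ℂ) q = ((‖q‖ ^ 2 : ℝ) : ℂ) := by
    rw [mul_comm, conj_mul_self_eq]
  have := h.ofReal_one_sub_ne_zero
  rw [map_div₀, Complex.conj_ofReal, Complex.ofReal_div, ← e4]
  field_simp
  ring

end IsUnitPair

end

/-! ### Identification of the two-point function with K. -/

section

/-- In the variables d = R(x) - R(0) and R', the coefficient of L d² is 1/s - 1 - |r|²/s = 0. What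
survives is -L R' and (|r|²/s)(|d|² - d²), and half the real part of |d|² - d² is (Im d)². -/
lemma twoPoint_eq {r q Q d R' : ℂ} {s L : ℝ} (hr : r ≠ 0) (hs : s ≠ 0) (hrs : ‖r‖ ^ 2 = 1 - s)
    (hq : q = r * d) (hQ : Q = -r * (R' + d ^ 2)) :
    (1 / 2 : ℝ) * (-(q / s) ^ 2 * ((starRingEnd ℂ) r / r * (1 - L * (s / ‖r‖ ^ 2))
      - (starRingEnd ℂ) r ^ 2) + (Q - q ^ 2 * (starRingEnd ℂ) r / s) * (L / r)
      + (‖q‖ ^ 2 / s : ℝ)).re = ‖r‖ ^ 2 / s * d.im ^ 2 - 1 / 2 * L * R'.re := by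
  have hn : (‖r‖ : ℂ) ≠ 0 := by simpa using hr
  have hsC : (s : ℂ) ≠ 0 := by exact_mod_cast hs
  have e1 : (starRingEnd ℂ) r = (‖r‖ : ℂ) ^ 2 / r := by
    rw [eq_div_iff hr, conj_mul_self_eq]; push_cast; rfl
  have e2 : (s : ℂ) = 1 - (‖r‖ : ℂ) ^ 2 := by
    have : s = 1 - ‖r‖ ^ 2 := by rw [hrs]; ring
    rw [this]; push_cast; rfl
  have key : -(q / s) ^ 2 * ((starRingEnd ℂ) r / r * (1 - L * (s / ‖r‖ ^ 2))
      - (starRingEnd ℂ) r ^ 2) + (Q - q ^ 2 * (starRingEnd ℂ) r / s) * (L / r) =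
      -((‖r‖ ^ 2 / s : ℝ) : ℂ) * d ^ 2 - L * R' := by
    rw [e1, hq, hQ]
    push_cast
    field_simp
    rw [e2]
    ring
  rw [key, hq, norm_mul, mul_pow]
  have e3 : ‖d‖ ^ 2 = d.re ^ 2 + d.im ^ 2 := by
    rw [← Complex.normSq_eq_norm_sq, Complex.normSq_apply]; ring
  rw [e3, neg_mul, Complex.add_re, Complex.sub_re, Complex.neg_re, Complex.re_ofReal_mul,
    Complex.re_ofReal_mul, Complex.ofReal_re, sq d, Complex.mul_re]
  ring

namespace IsSpectralMeasure

variable {ρ : Measure ℝ} {r : ℝ → ℂ}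

lemma varKernel_eq (h : IsSpectralMeasure ρ r) (h2 : MemLp id 2 ρ) {x : ℝ} (hx : ‖r x‖ < 1)
    {q Q : ℂ} (hq : q = deriv r x - Complex.I * (deriv r 0).im * r x)
    (hQ : Q = -deriv (deriv r) x + 2 * Complex.I * (deriv r 0).im * deriv r x
      + (deriv r 0).im ^ 2 * r x) :
    (1 / 2 : ℝ) * (-(q / (1 - ‖r x‖ ^ 2 : ℝ)) ^ 2 * ((starRingEnd ℂ) (r x) / r x *
        (1 - Real.log (1 / (1 - ‖r x‖ ^ 2)) * ((1 - ‖r x‖ ^ 2) / ‖r x‖ ^ 2))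
          - (starRingEnd ℂ) (r x) ^ 2) +
        (Q - q ^ 2 * (starRingEnd ℂ) (r x) / (1 - ‖r x‖ ^ 2 : ℝ)) *
          (Real.log (1 / (1 - ‖r x‖ ^ 2)) / r x) + (‖q‖ ^ 2 / (1 - ‖r x‖ ^ 2) : ℝ)).re =
      varKernel r x := by
  -- Where r vanishes every quotient by r is 0 by convention, leaving ½|q|² = ½|r'|²: the special
  -- branch of K.
  rcases eq_or_ne (r x) 0 with h0 | h0
  · have : varKernel r x = 1 / 2 * ‖deriv r x‖ ^ 2 := by
      rw [varKernel, if_pos (by simp [h0])]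
    rw [this, hq, h0]
    simp only [mul_zero, sub_zero, div_zero, zero_mul, add_zero, norm_zero, map_zero]
    norm_num [← Complex.ofReal_pow]
  · have hs : (1 - ‖r x‖ ^ 2 : ℝ) ≠ 0 := by nlinarith [norm_nonneg (r x)]
    have hne : ¬(‖r x‖ = 0 ∨ ‖r x‖ = 1) := by
      rintro (h3 | h3)
      · exact h0 (norm_eq_zero.1 h3)
      · exact hx.ne h3
    have hc := h.contDiff h2
    have d1 : DifferentiableAt ℝ r x := (hc.differentiable (by norm_num)).differentiableAt
    have d2 : DifferentiableAt ℝ (deriv r) x := by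
      have : ContDiff ℝ 1 (deriv r) := (contDiff_succ_iff_deriv.1 hc).2.2
      exact (this.differentiable (by norm_num)).differentiableAt
    have hR0 : logDerivative r 0 = Complex.I * (deriv r 0).im := by
      rw [logDerivative, h.zero, div_one]
      apply Complex.ext <;> simp [h.deriv_zero_re]
    have hR' : deriv (logDerivative r) x =
        deriv (deriv r) x / r x - (deriv r x / r x) ^ 2 := by
      have := deriv_fun_div d2 d1 h0
      change deriv (fun y => deriv r y / r y) x = _
      rw [this]
      field_simp
    rw [varKernel, if_neg hne]
    have := twoPoint_eq (q := q) (Q := Q) (d := logDerivative r x - logDerivative r 0)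
      (R' := deriv (logDerivative r) x) (L := Real.log (1 / (1 - ‖r x‖ ^ 2)))
      h0 hs (by ring) (by rw [hq, hR0, logDerivative]; field_simp) (by
        rw [hQ, hR', hR0, logDerivative]; field_simp; linear_combination
          ((deriv r 0).im ^ 2 * r x ^ 2 : ℂ) * Complex.I_sq)
    rw [← this]
    push_cast
    rfl

end IsSpectralMeasure

end

/-! ### The derivative process and the fluctuation. -/

section

variable {Ω : Type*} [MeasurableSpace Ω] {P : Measure Ω}

lemma IsCG.congr {q : ℝ} {Y Z : Ω → ℂ} (h : IsCG P q Y) (hZ : Measurable Z) (e : Z =ᵐ[P] Y) :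
    IsCG P q Z :=
  ⟨hZ, h.nonneg, by rw [Measure.map_congr e, h.law]⟩

lemma cov_congr {Y Z Y' Z' : Ω → ℂ} (hY : Y =ᵐ[P] Y') (hZ : Z =ᵐ[P] Z') :
    cov P Y Z = cov P Y' Z' := by
  refine integral_congr_ae ?_
  filter_upwards [hY, hZ] with ω h1 h2
  rw [h1, h2]

/-- The measurable functions that agree almost surely with a member of `H`. -/
def aeClosure (P : Measure Ω) (H : Submodule ℂ (Ω → ℂ)) : Submodule ℂ (Ω → ℂ) where
  carrier := {Y | Measurable Y ∧ ∃ Z ∈ H, Y =ᵐ[P] Z}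
  add_mem' := by
    rintro Y Y' ⟨m, Z, hZ, e⟩ ⟨m', Z', hZ', e'⟩
    exact ⟨m.add m', Z + Z', H.add_mem hZ hZ', e.add e'⟩
  zero_mem' := ⟨measurable_const, 0, H.zero_mem, ae_eq_refl _⟩
  smul_mem' := by
    rintro c Y ⟨m, Z, hZ, e⟩
    exact ⟨m.const_smul c, c • Z, H.smul_mem c hZ, e.const_smul c⟩

lemma IsGaussianSpace.aeClosure {H : Submodule ℂ (Ω → ℂ)} (h : IsGaussianSpace P H) :
    IsGaussianSpace P (aeClosure P H) := by
  rintro Y ⟨m, Z, hZ, e⟩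
  exact ⟨_, (h.isCG hZ).congr m e⟩

/-- A process with continuously differentiable nonvanishing paths in a Gaussian space, with
covariance kernel `r`. -/
structure IsRegularFamily (P : Measure Ω) (H : Submodule ℂ (Ω → ℂ)) (f : ℝ → Ω → ℂ)
    (r : ℝ → ℂ) : Prop where
  space : IsGaussianSpace P H
  mem : ∀ t, f t ∈ H
  cov_eq : ∀ s t, cov P (f s) (f t) = r (s - t)
  contDiff : ∀ ω, ContDiff ℝ 1 (fun t => f t ω)
  ne_zero : ∀ ω t, f t ω ≠ 0

/-- On a measurable null set the path is replaced by the constant 1, the simplest smooth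
non-vanishing path. Every path is then regular, so f' and Φ are defined and continuous for all ω and
f' is a pointwise limit everywhere. -/
lemma exists_regularVersion {H : Submodule ℂ (Ω → ℂ)} {f : ℝ → Ω → ℂ} {r : ℝ → ℂ}
    (hH : IsGaussianSpace P H) (hf : ∀ t, f t ∈ H) (hcov : ∀ s t, cov P (f s) (f t) = r (s - t))
    (hreg : ∀ᵐ ω ∂P, ContDiff ℝ 1 (fun t => f t ω) ∧ ∀ t, f t ω ≠ 0) :
    ∃ g : ℝ → Ω → ℂ, IsRegularFamily P (aeClosure P H) g r ∧ ∀ᵐ ω ∂P, ∀ t, g t ω = f t ω := by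
  classical
  obtain ⟨N, hN, hNm, hN0⟩ := exists_measurable_superset_of_null hreg
  have hae : ∀ᵐ ω ∂P, ω ∉ N := measure_eq_zero_iff_ae_notMem.1 hN0
  have hN' : ∀ ω, ω ∉ N → ContDiff ℝ 1 (fun t => f t ω) ∧ ∀ t, f t ω ≠ 0 := fun ω hω => by
    by_contra hc
    exact hω (hN hc)
  set g : ℝ → Ω → ℂ := fun t ω => if ω ∈ N then 1 else f t ω with hg
  have hgf : ∀ᵐ ω ∂P, ∀ t, g t ω = f t ω := by
    filter_upwards [hae] with ω hω t
    simp [hg, hω]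
  have hgt : ∀ t, g t =ᵐ[P] f t := fun t => hgf.mono fun ω h => h t
  refine ⟨g, ⟨hH.aeClosure, fun t => ⟨?_, f t, hf t, hgt t⟩, fun s t => ?_, fun ω => ?_,
    fun ω t => ?_⟩, hgf⟩
  · exact Measurable.ite hNm measurable_const (hH.measurable (hf t))
  · rw [cov_congr (hgt s) (hgt t), hcov]
  · by_cases hω : ω ∈ N
    · simpa [hg, hω] using contDiff_const
    · simpa [hg, hω] using (hN' ω hω).1
  · by_cases hω : ω ∈ N
    · simp [hg, hω]
    · simpa [hg, hω] using (hN' ω hω).2 t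

/-- The derivative process. -/
noncomputable def timeDeriv (f : ℝ → Ω → ℂ) (t : ℝ) (ω : Ω) : ℂ := deriv (fun s => f s ω) t

/-- The sign of c matters: a forward difference in t is a backward one in s - t, so c = -1 is needed
for the second derivative of r. -/
lemma tendsto_slope_seq {g : ℝ → ℂ} {x : ℝ} {a : ℂ} (h : HasDerivAt g a x) {c : ℝ} (hc : c ≠ 0) :
    Tendsto (fun n : ℕ => (((c / ((n : ℝ) + 1))⁻¹ : ℝ) : ℂ) * (g (x + c / ((n : ℝ) + 1)) - g x)) atTop
      (𝓝 a) := by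
  have h1 : Tendsto (fun n : ℕ => c / ((n : ℝ) + 1)) atTop (𝓝[≠] 0) := by
    refine tendsto_nhdsWithin_iff.2 ⟨?_, Eventually.of_forall fun n => ?_⟩
    · have := (tendsto_one_div_add_atTop_nhds_zero_nat (𝕜 := ℝ)).const_mul c
      simpa [div_eq_mul_inv] using this
    · have : (n : ℝ) + 1 ≠ 0 := by positivity
      exact div_ne_zero hc this
  have h2 := h.tendsto_slope_zero.comp h1
  refine h2.congr fun n => ?_
  simp only [Function.comp_apply, Complex.real_smul]

namespace IsRegularFamily

variable {H : Submodule ℂ (Ω → ℂ)} {f : ℝ → Ω → ℂ} {r : ℝ → ℂ} (h : IsRegularFamily P H f r)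
include h

lemma hasDerivAt (ω : Ω) (t : ℝ) : HasDerivAt (fun s => f s ω) (timeDeriv f t ω) t :=
  (((h.contDiff ω).differentiable (by norm_num)) t).hasDerivAt

lemma continuous_timeDeriv (ω : Ω) : Continuous fun t => timeDeriv f t ω :=
  (h.contDiff ω).continuous_deriv (by norm_num)

lemma tendsto_quotient (t : ℝ) (ω : Ω) : Tendsto (fun n : ℕ =>
    ((((1 / ((n : ℝ) + 1))⁻¹ : ℝ) : ℂ) • (f (t + 1 / ((n : ℝ) + 1)) - f t)) ω) atTop
    (𝓝 (timeDeriv f t ω)) :=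
  tendsto_slope_seq (h.hasDerivAt ω t) one_ne_zero

lemma quotient_mem (t : ℝ) (n : ℕ) :
    (((1 / ((n : ℝ) + 1))⁻¹ : ℝ) : ℂ) • (f (t + 1 / ((n : ℝ) + 1)) - f t) ∈ H :=
  H.smul_mem _ (H.sub_mem (h.mem _) (h.mem _))

lemma timeDeriv_mem (t : ℝ) : timeDeriv f t ∈ IsGaussianSpace.seqClosure H :=
  ⟨_, h.quotient_mem t, h.tendsto_quotient t⟩

lemma mem_seqClosure (t : ℝ) : f t ∈ IsGaussianSpace.seqClosure H :=
  IsGaussianSpace.le_seqClosure (h.mem t)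

lemma isCG (hr0 : r 0 = 1) (t : ℝ) : IsCG P 1 (f t) :=
  h.space.isCG_of_cov (h.mem t) (by rw [h.cov_eq, sub_self, hr0]; simp)

variable [IsProbabilityMeasure P] (hr : ContDiff ℝ 2 r)
include hr

/-- Difference quotients converge pointwise, and in a Gaussian space pointwise limits carry
covariances with them; no domination is required. -/
lemma cov_deriv_left (s t : ℝ) : cov P (timeDeriv f s) (f t) = deriv r (s - t) := by
  have h1 := h.space.tendsto_cov (h.quotient_mem s) (h.tendsto_quotient s) (fun _ => h.mem t)
    (fun _ => tendsto_const_nhds)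
  have h2 := tendsto_slope_seq ((hr.differentiable (by norm_num)) (s - t)).hasDerivAt one_ne_zero
  refine tendsto_nhds_unique (h1.congr fun n => ?_) h2
  rw [IsGaussianSpace.cov_smul_left, h.space.cov_sub_left (h.mem _) (h.mem _) (h.mem _), h.cov_eq,
    h.cov_eq]
  congr 3; ring

lemma cov_deriv_deriv (s t : ℝ) :
    cov P (timeDeriv f s) (timeDeriv f t) = -deriv (deriv r) (s - t) := by
  have h1 := h.space.closure.tendsto_cov (fun _ => h.timeDeriv_mem s)
    (fun _ => tendsto_const_nhds)
    (fun n => IsGaussianSpace.le_seqClosure (h.quotient_mem t n)) (h.tendsto_quotient t)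
  have hd : ContDiff ℝ 1 (deriv r) := (contDiff_succ_iff_deriv.1 hr).2.2
  have h2 := tendsto_slope_seq ((hd.differentiable (by norm_num)) (s - t)).hasDerivAt
    (c := -1) (by norm_num)
  refine tendsto_nhds_unique (h1.congr fun n => ?_) h2.neg
  rw [IsGaussianSpace.cov_smul_right, h.space.closure.cov_sub_right (h.mem_seqClosure _)
    (h.mem_seqClosure _) (h.timeDeriv_mem s), h.cov_deriv_left hr, h.cov_deriv_left hr,
    Complex.conj_ofReal]
  have e : s - (t + 1 / ((n : ℝ) + 1)) = s - t + -1 / ((n : ℝ) + 1) := by ring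
  rw [e, neg_div, inv_neg, Complex.ofReal_neg]
  ring

end IsRegularFamily

/-- The derivative of `f`, recentred so as to be independent of `f` at the same time. -/
noncomputable def recentred (f : ℝ → Ω → ℂ) (r : ℝ → ℂ) (t : ℝ) : Ω → ℂ :=
  timeDeriv f t - (Complex.I * (deriv r 0).im) • f t

/-- The fluctuating part of the logarithmic derivative of `f`. -/
noncomputable def fluctuation (f : ℝ → Ω → ℂ) (r : ℝ → ℂ) (t : ℝ) (ω : Ω) : ℝ :=
  (recentred f r t ω / f t ω).im

namespace IsRegularFamily

variable {H : Submodule ℂ (Ω → ℂ)} {f : ℝ → Ω → ℂ} {r : ℝ → ℂ} (h : IsRegularFamily P H f r)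
include h

lemma recentred_mem (t : ℝ) : recentred f r t ∈ IsGaussianSpace.seqClosure H :=
  Submodule.sub_mem _ (h.timeDeriv_mem t) (Submodule.smul_mem _ _ (h.mem_seqClosure t))

lemma im_deriv_div (t : ℝ) (ω : Ω) :
    (deriv (fun s => f s ω) t / f t ω).im = (deriv r 0).im + fluctuation f r t ω := by
  have hne := h.ne_zero ω t
  rw [fluctuation, recentred]
  simp only [Pi.sub_apply, Pi.smul_apply, smul_eq_mul, timeDeriv]
  rw [sub_div, mul_div_cancel_right₀ _ hne]
  simp

lemma continuous_fluctuation (ω : Ω) : Continuous fun t => fluctuation f r t ω := by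
  have h1 := h.continuous_timeDeriv ω
  have h2 := (h.contDiff ω).continuous
  refine Complex.continuous_im.comp (Continuous.div ?_ h2 (h.ne_zero ω))
  simp only [recentred, Pi.sub_apply, Pi.smul_apply]
  simp only [smul_eq_mul]
  exact h1.sub (continuous_const.mul h2)

variable [IsProbabilityMeasure P]

lemma measurable_fluctuation : Measurable (Function.uncurry (fluctuation f r)) := by
  refine measurable_uncurry_of_continuous_of_measurable h.continuous_fluctuation fun t => ?_
  exact Complex.measurable_im.comp
    ((h.space.closure.measurable (h.recentred_mem t)).div (h.space.measurable (h.mem t)))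

variable {ρ : Measure ℝ} (hρ : IsSpectralMeasure ρ r) (h2 : MemLp id 2 ρ)
include hρ h2

lemma cov_recentred_left (s t : ℝ) : cov P (recentred f r s) (f t) =
    deriv r (s - t) - Complex.I * (deriv r 0).im * r (s - t) := by
  rw [recentred, h.space.closure.cov_sub_left (h.timeDeriv_mem s)
    (Submodule.smul_mem _ _ (h.mem_seqClosure s)) (h.mem_seqClosure t),
    IsGaussianSpace.cov_smul_left, h.cov_eq, h.cov_deriv_left (hρ.contDiff h2)]

/-- The choice of centring: r(0) = 1 and r'(0) = i Im r'(0), because r(-t) is the conjugate of r(t).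
-/
lemma cov_recentred_self (t : ℝ) : cov P (recentred f r t) (f t) = 0 := by
  rw [h.cov_recentred_left hρ h2, sub_self, hρ.zero]
  apply Complex.ext <;> simp [hρ.deriv_zero_re]

lemma cov_recentred_swap (s t : ℝ) : cov P (recentred f r t) (f s) =
    -(starRingEnd ℂ) (deriv r (s - t) - Complex.I * (deriv r 0).im * r (s - t)) := by
  rw [h.cov_recentred_left hρ h2, ← neg_sub s t, hρ.deriv_neg, hρ.neg]
  simp only [map_sub, map_mul, Complex.conj_I, Complex.conj_ofReal]
  ring

lemma cov_recentred_recentred (s t : ℝ) : cov P (recentred f r s) (recentred f r t) =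
    -deriv (deriv r) (s - t) + 2 * Complex.I * (deriv r 0).im * deriv r (s - t)
      + (deriv r 0).im ^ 2 * r (s - t) := by
  have hr := hρ.contDiff h2
  have e1 : cov P (recentred f r s) (timeDeriv f t) = -deriv (deriv r) (s - t)
      + Complex.I * (deriv r 0).im * deriv r (s - t) := by
    rw [recentred, h.space.closure.cov_sub_left (h.timeDeriv_mem s)
      (Submodule.smul_mem _ _ (h.mem_seqClosure s)) (h.timeDeriv_mem t),
      IsGaussianSpace.cov_smul_left, h.cov_deriv_deriv hr, ← cov_conj (timeDeriv f t),
      h.cov_deriv_left hr, ← neg_sub s t, hρ.deriv_neg]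
    simp
  conv_lhs => rw [recentred.eq_1 f r t]
  rw [h.space.closure.cov_sub_right (h.timeDeriv_mem t)
    (Submodule.smul_mem _ _ (h.mem_seqClosure t)) (h.recentred_mem s),
    IsGaussianSpace.cov_smul_right, e1, h.cov_recentred_left hρ h2]
  simp only [map_mul, Complex.conj_I, Complex.conj_ofReal]
  linear_combination (-((deriv r 0).im : ℂ) ^ 2 * r (s - t)) * Complex.I_sq

lemma isCG_recentred (t : ℝ) :
    IsCG P (∫ ω, ‖recentred f r 0 ω‖ ^ 2 ∂P) (recentred f r t) := by
  refine h.space.closure.isCG_of_cov (h.recentred_mem t) ?_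
  rw [← cov_self, h.cov_recentred_recentred hρ h2, h.cov_recentred_recentred hρ h2, sub_self,
    sub_self]

lemma cov_recentred_self_self (t : ℝ) :
    cov P (recentred f r t) (recentred f r t) = (∫ ω, ‖recentred f r 0 ω‖ ^ 2 ∂P : ℝ) := by
  rw [cov_self, (h.isCG_recentred hρ h2 t).integral_norm_sq]

omit h2 in
lemma isUnitPair {s t : ℝ} (hst : ‖r (s - t)‖ < 1) :
    IsUnitPair P (IsGaussianSpace.seqClosure H) (f s) (f t) (r (s - t)) where
  space := h.space.closure
  left_mem := h.mem_seqClosure s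
  right_mem := h.mem_seqClosure t
  cov_left := by rw [h.cov_eq, sub_self, hρ.zero]
  cov_right := by rw [h.cov_eq, sub_self, hρ.zero]
  cov_eq := h.cov_eq s t
  norm_lt := hst

/-- The regression formula with u, v the recentred derivatives at s and t: the four preceding
covariance computations are exactly its hypotheses. -/
lemma integral_fluctuation_mul {s t : ℝ} (hst : ‖r (s - t)‖ < 1) :
    ∫ ω, fluctuation f r s ω * fluctuation f r t ω ∂P = varKernel r (s - t) := by
  have := (h.isUnitPair hρ hst).integral_im_mul_im (h.recentred_mem s) (h.recentred_mem t)
    (h.cov_recentred_self hρ h2 s) (h.cov_recentred_left hρ h2 s t) (h.cov_recentred_self hρ h2 t)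
    (h.cov_recentred_swap hρ h2 s t) (h.cov_recentred_recentred hρ h2 s t)
  rw [← hρ.varKernel_eq h2 hst rfl rfl]
  exact this

end IsRegularFamily

attribute [irreducible] fluctuation

end

/-! ### Integrating a function of s - t over a square. -/

section

lemma volume_real_overlap (T x : ℝ) :
    volume.real {t | x + t ∈ Ioc 0 T ∧ t ∈ Ioc 0 T} = max (T - |x|) 0 := by
  have e : {t | x + t ∈ Ioc 0 T ∧ t ∈ Ioc 0 T} = Ioc (max 0 (-x)) (min T (T - x)) := by
    ext t
    simp only [mem_ofPred_eq, mem_Ioc, max_lt_iff, le_min_iff]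
    constructor
    · rintro ⟨⟨h1, h2⟩, h3, h4⟩
      exact ⟨⟨h3, by linarith⟩, h4, by linarith⟩
    · rintro ⟨⟨h1, h2⟩, h3, h4⟩
      exact ⟨⟨by linarith, by linarith⟩, h1, h3⟩
  rw [e, Real.volume_real_Ioc]
  congr 1
  rcases le_total 0 x with hx | hx
  · rw [abs_of_nonneg hx, max_eq_left (by linarith), min_eq_right (by linarith)]; ring
  · rw [abs_of_nonpos hx, max_eq_right (by linarith), min_eq_left (by linarith)]

/-- The shear (s,t) ↦ (s-t,t) preserves area, and the slice of the image of the square over x has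
length max(T-|x|, 0). -/
lemma integral_sub_square {g : ℝ → ℝ} (hg : LocallyIntegrable g) {T : ℝ} (hT : 0 < T) :
    Integrable (fun p : ℝ × ℝ => g (p.1 - p.2))
      ((volume.restrict (Ioc 0 T)).prod (volume.restrict (Ioc 0 T))) ∧
    ∫ p : ℝ × ℝ, g (p.1 - p.2) ∂((volume.restrict (Ioc 0 T)).prod (volume.restrict (Ioc 0 T))) =
      ∫ x in (-T)..T, (T - |x|) * g x := by
  set S : Set (ℝ × ℝ) := {q | q.1 + q.2 ∈ Ioc 0 T ∧ q.2 ∈ Ioc 0 T} with hS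
  have hSm : MeasurableSet S :=
    (measurableSet_Ioc.preimage (by fun_prop : Measurable fun q : ℝ × ℝ => q.1 + q.2)).inter
      (measurableSet_Ioc.preimage measurable_snd)
  set k : ℝ × ℝ → ℝ := S.indicator (fun q => g q.1) with hk
  have hki : Integrable k (volume.prod volume) := by
    have h1 : Integrable ((Icc (-T) T).indicator g) volume :=
      (integrable_indicator_iff measurableSet_Icc).2 (hg.integrableOn_isCompact isCompact_Icc)
    have h2 : Integrable ((Ioc 0 T).indicator (fun _ => (1 : ℝ))) volume :=
      (integrable_indicator_iff measurableSet_Ioc).2 (by simp)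
    have h3 := (h1.mul_prod h2).indicator hSm
    refine h3.congr (ae_of_all _ fun q => ?_)
    by_cases hq : q ∈ S
    · have hq2 : q.2 ∈ Ioc 0 T := hq.2
      have hq1 : q.1 ∈ Icc (-T) T := by
        obtain ⟨⟨a1, a2⟩, a3, a4⟩ := hq
        exact ⟨by linarith, by linarith⟩
      rw [hk, indicator_of_mem hq, indicator_of_mem hq, indicator_of_mem hq1,
        indicator_of_mem hq2, mul_one]
    · rw [hk, indicator_of_notMem hq, indicator_of_notMem hq]
  have hsh : MeasurePreserving (fun p : ℝ × ℝ => (p.1 - p.2, p.2)) (volume.prod volume)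
      (volume.prod volume) := measurePreserving_sub_prod _ _
  have hind : (Ioc 0 T ×ˢ Ioc 0 T).indicator (fun p : ℝ × ℝ => g (p.1 - p.2)) =
      fun p => k (p.1 - p.2, p.2) := by
    ext p
    by_cases hp : p ∈ Ioc 0 T ×ˢ Ioc 0 T
    · have : (p.1 - p.2, p.2) ∈ S := ⟨by simpa using hp.1, hp.2⟩
      rw [indicator_of_mem hp, hk, indicator_of_mem this]
    · have : (p.1 - p.2, p.2) ∉ S := fun hc => hp ⟨by simpa using hc.1, hc.2⟩
      rw [indicator_of_notMem hp, hk, indicator_of_notMem this]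
  have hm : MeasurableSet (Ioc 0 T ×ˢ Ioc 0 T) := measurableSet_Ioc.prod measurableSet_Ioc
  rw [Measure.prod_restrict]
  refine ⟨?_, ?_⟩
  · change IntegrableOn _ _ _
    rw [← integrable_indicator_iff hm, hind]
    exact hsh.integrable_comp_of_integrable hki
  · rw [← integral_indicator hm, hind]
    have e1 : ∫ p : ℝ × ℝ, k (p.1 - p.2, p.2) ∂(volume.prod volume) =
        ∫ q, k q ∂(volume.prod volume) := by
      have := integral_map (μ := volume.prod volume) (f := k) hsh.measurable.aemeasurable
        (by rw [hsh.map_eq]; exact hki.1)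
      rw [hsh.map_eq] at this
      exact this.symm
    rw [e1, integral_prod _ hki]
    have e2 : ∀ x, ∫ t, k (x, t) = max (T - |x|) 0 * g x := fun x => by
      have : (fun t => k (x, t)) =
          {t | x + t ∈ Ioc 0 T ∧ t ∈ Ioc 0 T}.indicator (fun _ => g x) := rfl
      have hms : MeasurableSet {t | x + t ∈ Ioc 0 T ∧ t ∈ Ioc 0 T} :=
        (measurableSet_Ioc.preimage (by fun_prop : Measurable fun t => x + t)).inter
          measurableSet_Ioc
      rw [this, integral_indicator_const _ hms, volume_real_overlap, smul_eq_mul]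
    simp_rw [e2]
    rw [intervalIntegral.integral_of_le (by linarith),
      ← setIntegral_eq_integral_of_forall_compl_eq_zero (s := Ioc (-T) T)]
    · refine setIntegral_congr_fun measurableSet_Ioc fun x hx => ?_
      have : |x| ≤ T := abs_le.2 ⟨hx.1.le, hx.2⟩
      rw [max_eq_left (by linarith)]
    · intro x hx
      have : T ≤ |x| := by
        by_contra hc
        obtain ⟨h1, h2⟩ := abs_lt.1 (not_le.1 hc)
        exact hx ⟨h1, h2.le⟩
      rw [max_eq_right (by linarith), zero_mul]

lemma measurable_varKernel {r : ℝ → ℂ} (hr : Continuous r) : Measurable (varKernel r) := by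
  classical
  have m0 := hr.measurable
  have m1 : Measurable (deriv r) := measurable_deriv r
  have m2 : Measurable (logDerivative r) := m1.div m0
  have m3 : Measurable (deriv (logDerivative r)) := measurable_deriv _
  have mn : Measurable fun x => ‖r x‖ := m0.norm
  refine Measurable.ite ?_ (by fun_prop) (by fun_prop)
  exact (mn (measurableSet_singleton 0)).union (mn (measurableSet_singleton 1))

end

/-! ### Fubini, and the moments of the winding. -/

section

variable {Ω : Type*} [MeasurableSpace Ω] {P : Measure Ω} [IsProbabilityMeasure P]

/-- A bound for the two-point function of the fluctuation. -/
noncomputable def kernelBound (M : ℝ) (r : ℝ → ℂ) (x : ℝ) : ℝ :=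
  2 * (M ^ 5 * 120) + IsUnitPair.negMomentConst * (1 - ‖r x‖ ^ 2) ^ (-(3 / 8) : ℝ)

lemma locallyIntegrable_kernelBound {ρ : Measure ℝ} {r : ℝ → ℂ} (hρ : IsSpectralMeasure ρ r)
    (h2 : MemLp id 2 ρ) (hnd : ¬ ∃ φ : ℝ, ρ = Measure.dirac φ) (M : ℝ) :
    LocallyIntegrable (kernelBound M r) :=
  (locallyIntegrable_const _).add ((hρ.locallyIntegrable_rpow h2 hnd).smul
    IsUnitPair.negMomentConst)

namespace IsRegularFamily

variable {H : Submodule ℂ (Ω → ℂ)} {f : ℝ → Ω → ℂ} {r : ℝ → ℂ} (h : IsRegularFamily P H f r)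
  {ρ : Measure ℝ} (hρ : IsSpectralMeasure ρ r) (h2 : MemLp id 2 ρ)
include h

lemma measurable_fluctuation_apply (t : ℝ) : Measurable (fluctuation f r t) :=
  h.measurable_fluctuation.of_uncurry_left

include hρ h2

lemma integrable_fluctuation_mul {s t : ℝ} (hst : ‖r (s - t)‖ < 1) :
    Integrable (fun ω => fluctuation f r s ω * fluctuation f r t ω) P ∧
    ∫ ω, ‖fluctuation f r s ω * fluctuation f r t ω‖ ∂P ≤
      kernelBound (∫ ω, ‖recentred f r 0 ω‖ ^ 2 ∂P) r (s - t) := by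
  have hp := h.isUnitPair hρ hst
  have hs := h.recentred_mem s
  have ht := h.recentred_mem t
  have m1 := hp.space.measurable hs
  have m2 := hp.space.measurable ht
  have m3 := h.space.measurable (h.mem s)
  have m4 := h.space.measurable (h.mem t)
  have hi : Integrable (fun ω => recentred f r s ω * recentred f r t ω * (f s ω * f t ω)⁻¹) P :=
    hp.integrable_of_norm_le hs ht (by fun_prop) fun ω => by simp [mul_comm]
  have hb : ∀ ω, ‖fluctuation f r s ω * fluctuation f r t ω‖ ≤
      ‖recentred f r s ω‖ * ‖recentred f r t ω‖ * (‖f s ω‖ * ‖f t ω‖)⁻¹ := fun ω => by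
    rw [norm_mul, fluctuation, fluctuation]
    refine (mul_le_mul (Complex.abs_im_le_norm _) (Complex.abs_im_le_norm _) (abs_nonneg _)
      (norm_nonneg _)).trans (le_of_eq ?_)
    rw [norm_div, norm_div, mul_inv]
    ring
  have hi2 : Integrable (fun ω =>
      ‖recentred f r s ω‖ * ‖recentred f r t ω‖ * (‖f s ω‖ * ‖f t ω‖)⁻¹) P := by
    simpa using hi.norm
  refine ⟨hi2.mono' ((h.measurable_fluctuation_apply s).mul
    (h.measurable_fluctuation_apply t)).aestronglyMeasurable (ae_of_all _ hb), ?_⟩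
  exact (integral_mono_of_nonneg (ae_of_all _ fun ω => norm_nonneg _) hi2 (ae_of_all _ hb)).trans
    (hp.integral_norm_le hs ht (h.cov_recentred_self_self hρ h2 s)
      (h.cov_recentred_self_self hρ h2 t))

lemma indepFun_recentred (t : ℝ) : IndepFun (recentred f r t) (f t) P := by
  have hc := h.cov_recentred_self hρ h2 t
  exact (h.space.closure.indepFun (h.recentred_mem t) (h.recentred_mem t) (h.mem_seqClosure t)
    (h.mem_seqClosure t) hc hc hc hc).comp measurable_fst measurable_fst

/-- The recentred derivative is independent of f(t) and centred, while 1/|f(t)| has a finite mean.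
The bound does not depend on t, as needed for Fubini over [0,T]. -/
lemma fluctuation_moments (t : ℝ) : Integrable (fluctuation f r t) P ∧
    ∫ ω, fluctuation f r t ω ∂P = 0 ∧
    ∫ ω, ‖fluctuation f r t ω‖ ∂P ≤
      Real.sqrt (∫ ω, ‖recentred f r 0 ω‖ ^ 2 ∂P) * Real.Gamma (3 / 2) * Real.Gamma (1 / 2) := by
  have c1 := h.isCG_recentred hρ h2 t
  have c2 := h.isCG hρ.zero t
  have m1 := c1.measurable
  have m2 := c2.measurable
  have hi : IndepFun (recentred f r t) (fun ω => (f t ω)⁻¹) P :=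
    (h.indepFun_recentred hρ h2 t).comp (φ := id) (ψ := fun x => x⁻¹) measurable_id (by fun_prop)
  have hn : IndepFun (fun ω => ‖recentred f r t ω‖) (fun ω => ‖(f t ω)⁻¹‖) P :=
    hi.comp measurable_norm measurable_norm
  have i1 : Integrable (fun ω => ‖recentred f r t ω‖) P := by
    simpa using c1.integrable_norm_pow 1
  have e1 : ∀ ω, ‖(f t ω)⁻¹‖ = ‖f t ω‖ ^ (-1 : ℝ) := fun ω => by
    rw [norm_inv, Real.rpow_neg_one]
  have i2 : Integrable (fun ω => ‖(f t ω)⁻¹‖) P := by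
    simp_rw [e1]; exact c2.integrable_norm_rpow (by norm_num)
  have i3 : Integrable (fun ω => ‖recentred f r t ω‖ * ‖(f t ω)⁻¹‖) P := hn.integrable_mul i1 i2
  have i4 : Integrable (fun ω => recentred f r t ω * (f t ω)⁻¹) P := by
    refine i3.mono' (by fun_prop) (ae_of_all _ fun ω => ?_)
    rw [norm_mul]
  have hb : ∀ ω, ‖fluctuation f r t ω‖ ≤ ‖recentred f r t ω‖ * ‖(f t ω)⁻¹‖ := fun ω => by
    rw [← norm_mul, ← div_eq_mul_inv, fluctuation]
    exact Complex.abs_im_le_norm _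
  refine ⟨i3.mono' (h.measurable_fluctuation_apply t).aestronglyMeasurable (ae_of_all _ hb), ?_, ?_⟩
  · have e2 := hi.integral_fun_mul_eq_mul_integral m1.aestronglyMeasurable
      m2.inv.aestronglyMeasurable
    rw [c1.integral_eq_zero, zero_mul] at e2
    have e3 := integral_im i4
    simp only [RCLike.im_eq_complex_im] at e3
    rw [e2, Complex.zero_im] at e3
    simp_rw [fluctuation, div_eq_mul_inv]
    exact e3
  · refine (integral_mono_of_nonneg (ae_of_all _ fun ω => norm_nonneg _) i3
      (ae_of_all _ hb)).trans (le_of_eq ?_)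
    rw [hn.integral_fun_mul_eq_mul_integral i1.1 i2.1]
    simp_rw [e1]
    rw [c2.integral_norm_rpow (by norm_num)]
    have e4 := c1.integral_norm_rpow (p := 1) (by norm_num)
    simp only [Real.rpow_one] at e4
    rw [e4]
    norm_num

lemma integral_intervalIntegral_fluctuation {T : ℝ} (hT : 0 < T) :
    ∫ ω, (∫ t in (0 : ℝ)..T, fluctuation f r t ω) ∂P = 0 := by
  have hm : Measurable fun p : Ω × ℝ => fluctuation f r p.2 p.1 := by
    have := h.measurable_fluctuation.comp (measurable_swap (α := Ω) (β := ℝ))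
    exact this
  have hi : Integrable (fun p : Ω × ℝ => fluctuation f r p.2 p.1)
      (P.prod (volume.restrict (Ioc 0 T))) := by
    rw [integrable_prod_iff' hm.aestronglyMeasurable]
    refine ⟨ae_of_all _ fun t => (h.fluctuation_moments hρ h2 t).1, ?_⟩
    refine Integrable.mono' (integrable_const (Real.sqrt (∫ ω, ‖recentred f r 0 ω‖ ^ 2 ∂P) *
      Real.Gamma (3 / 2) * Real.Gamma (1 / 2)))
      (StronglyMeasurable.integral_prod_left' hm.norm.stronglyMeasurable).aestronglyMeasurable
      (ae_of_all _ fun t => ?_)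
    rw [Real.norm_of_nonneg (integral_nonneg fun ω => norm_nonneg _)]
    exact (h.fluctuation_moments hρ h2 t).2.2
  simp_rw [intervalIntegral.integral_of_le hT.le]
  rw [integral_integral_swap (f := fun ω t => fluctuation f r t ω) hi]
  simp [(h.fluctuation_moments hρ h2 _).2.1]

variable (hnd : ¬ ∃ φ : ℝ, ρ = Measure.dirac φ)
include hnd

omit h [IsProbabilityMeasure P] in
lemma _root_.GaussianWinding.IsSpectralMeasure.ae_norm_sub_lt_one (μ ν : Measure ℝ) [SFinite μ]
    [SFinite ν] (hμ : μ ≪ volume) (hν : ν ≪ volume) :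
    ∀ᵐ p : ℝ × ℝ ∂(μ.prod ν), ‖r (p.1 - p.2)‖ < 1 := by
  have hq := quasiMeasurePreserving_sub (volume : Measure ℝ) (volume : Measure ℝ)
  exact (hμ.prod hν).ae_le (hq.ae (hρ.ae_norm_lt_one h2 hnd))

/-- K(x) is the two-point function at times x and 0, so the probabilistic bound applies and the
singularities of the explicit formula need no analysis. -/
lemma abs_varKernel_le : ∀ᵐ x, |varKernel r x| ≤
    kernelBound (∫ ω, ‖recentred f r 0 ω‖ ^ 2 ∂P) r x := by
  filter_upwards [hρ.ae_norm_lt_one h2 hnd] with x hx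
  have hx' : ‖r (x - 0)‖ < 1 := by rwa [sub_zero]
  have h1 := (h.integrable_fluctuation_mul hρ h2 hx').2
  have h3 := h.integral_fluctuation_mul hρ h2 hx'
  rw [sub_zero] at h1 h3
  rw [← h3]
  exact (norm_integral_le_integral_norm _).trans h1

lemma locallyIntegrable_varKernel : LocallyIntegrable (varKernel r) := by
  have hB := locallyIntegrable_kernelBound hρ h2 hnd (∫ ω, ‖recentred f r 0 ω‖ ^ 2 ∂P)
  refine hB.mono (measurable_varKernel (hρ.contDiff h2).continuous).aestronglyMeasurable ?_
  filter_upwards [h.abs_varKernel_le hρ h2 hnd] with x hx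
  exact hx.trans (le_abs_self _)

/-- The square is a double integral over (0,T]². The bound on the mean of |Φ(s)Φ(t)| is a locally
integrable function of s-t, which justifies exchanging it with the expectation. -/
lemma intervalIntegral_fluctuation_sq {T : ℝ} (hT : 0 < T) :
    Integrable (fun ω => (∫ t in (0 : ℝ)..T, fluctuation f r t ω) ^ 2) P ∧
    ∫ ω, (∫ t in (0 : ℝ)..T, fluctuation f r t ω) ^ 2 ∂P =
      ∫ x in (-T)..T, (T - |x|) * varKernel r x := by
  set ν := (volume.restrict (Ioc 0 T)).prod (volume.restrict (Ioc (0 : ℝ) T)) with hν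
  set φ : Ω × (ℝ × ℝ) → ℝ := fun p => fluctuation f r p.2.1 p.1 * fluctuation f r p.2.2 p.1 with hφ
  have hm : Measurable φ :=
    (h.measurable_fluctuation.comp (by fun_prop : Measurable fun p : Ω × (ℝ × ℝ) =>
      (p.2.1, p.1))).mul (h.measurable_fluctuation.comp
        (by fun_prop : Measurable fun p : Ω × (ℝ × ℝ) => (p.2.2, p.1)))
  -- The excluded pairs, the diagonal among them, are those with s - t in the null set where |r| =
  -- 1.
  have hae : ∀ᵐ p ∂ν, ‖r (p.1 - p.2)‖ < 1 :=
    hρ.ae_norm_sub_lt_one h2 hnd _ _ Measure.restrict_le_self.absolutelyContinuous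
      Measure.restrict_le_self.absolutelyContinuous
  have hi : Integrable φ (P.prod ν) := by
    rw [integrable_prod_iff' hm.aestronglyMeasurable]
    refine ⟨hae.mono fun p hp => (h.integrable_fluctuation_mul hρ h2 hp).1, ?_⟩
    refine (integral_sub_square (locallyIntegrable_kernelBound hρ h2 hnd
      (∫ ω, ‖recentred f r 0 ω‖ ^ 2 ∂P)) hT).1.mono'
      (StronglyMeasurable.integral_prod_left' hm.norm.stronglyMeasurable).aestronglyMeasurable
      (hae.mono fun p hp => ?_)
    rw [Real.norm_of_nonneg (integral_nonneg fun ω => norm_nonneg _)]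
    exact (h.integrable_fluctuation_mul hρ h2 hp).2
  have e : ∀ ω, (∫ t in (0 : ℝ)..T, fluctuation f r t ω) ^ 2 = ∫ p, φ (ω, p) ∂ν := fun ω => by
    rw [intervalIntegral.integral_of_le hT.le, sq, hν, hφ]
    exact (integral_prod_mul _ _).symm
  simp_rw [e]
  refine ⟨hi.integral_prod_left, ?_⟩
  rw [integral_integral_swap (f := fun ω p => φ (ω, p)) hi,
    ← (integral_sub_square (h.locallyIntegrable_varKernel hρ h2 hnd) hT).2]
  exact integral_congr_ae (hae.mono fun p hp => h.integral_fluctuation_mul hρ h2 hp)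

lemma winding_moments {T : ℝ} (hT : 0 < T) :
    MemLp (fun ω => winding (fun t => f t ω) T) 2 P ∧
    ∫ ω, winding (fun t => f t ω) T ∂P = T * (deriv r 0).im ∧
    variance (fun ω => winding (fun t => f t ω) T) P =
      T * ∫ x in (-T)..T, (1 - |x| / T) * varKernel r x := by
  have e : ∀ ω, winding (fun t => f t ω) T =
      T * (deriv r 0).im + ∫ t in (0 : ℝ)..T, fluctuation f r t ω := fun ω => by
    rw [winding]
    simp_rw [h.im_deriv_div (r := r)]
    rw [intervalIntegral.integral_add (by simp)
      ((h.continuous_fluctuation ω).intervalIntegrable _ _)]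
    simp
  have hm : Measurable fun ω => ∫ t in (0 : ℝ)..T, fluctuation f r t ω := by
    simp_rw [intervalIntegral.integral_of_le hT.le]
    have hs := h.measurable_fluctuation (r := r).stronglyMeasurable
    exact (StronglyMeasurable.integral_prod_left (μ := volume.restrict (Ioc 0 T)) hs).measurable
  obtain ⟨hi, hv⟩ := h.intervalIntegral_fluctuation_sq hρ h2 hnd hT
  have hL : MemLp (fun ω => ∫ t in (0 : ℝ)..T, fluctuation f r t ω) 2 P :=
    (memLp_two_iff_integrable_sq hm.aestronglyMeasurable).2 hi
  have h0 := h.integral_intervalIntegral_fluctuation hρ h2 hT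
  have hmean : ∫ ω, winding (fun t => f t ω) T ∂P = T * (deriv r 0).im := by
    simp_rw [e]
    rw [integral_add (integrable_const _) (hL.integrable (by norm_num)), h0]
    simp
  have hw : MemLp (fun ω => winding (fun t => f t ω) T) 2 P := by
    have hc : MemLp (fun _ : Ω => T * (deriv r 0).im) 2 P := memLp_const _
    have hs := hc.add hL
    rw [funext e]
    exact hs
  refine ⟨hw, hmean, ?_⟩
  have hvar : variance (fun ω => winding (fun t => f t ω) T) P =
      ∫ ω, (∫ t in (0 : ℝ)..T, fluctuation f r t ω) ^ 2 ∂P := by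
    rw [variance_eq_integral hw.1.aemeasurable, hmean]
    congr 1
    ext ω
    rw [e, add_sub_cancel_left]
  rw [hvar, hv, ← intervalIntegral.integral_const_mul]
  refine intervalIntegral.integral_congr fun x _ => ?_
  field_simp

end IsRegularFamily

end

end GaussianWinding

/-! ### The theorem. -/

open GaussianWinding in
theorem theorem1p1 {Ω : Type*} [MeasurableSpace Ω] (P : Measure Ω) [IsProbabilityMeasure P]
    (f : ℝ → Ω → ℂ) (ρ : Measure ℝ)
    (hgauss : GaussianWinding.IsComplexGaussianProcess f P)
    (hstat : GaussianWinding.IsStationary f P)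
    (hcont : ∀ᵐ ω ∂P, Continuous (fun t => f t ω))
    (hnorm : GaussianWinding.covKernel f P 0 = 1)
    (hspec : GaussianWinding.IsSpectralMeasure ρ (GaussianWinding.covKernel f P))
    (hnondeg : ¬ ∃ φ : ℝ, ρ = Measure.dirac φ)
    (hlog : GaussianWinding.LogMomentCondition ρ) :
    -- the winding and the kernel are well defined
    (∀ᵐ ω ∂P, ContDiff ℝ 1 (fun t => f t ω) ∧ ∀ t, f t ω ≠ 0) ∧
    ContDiff ℝ 2 (GaussianWinding.covKernel f P) ∧
    -- `K` is integrable on compact sets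
    (∀ C : Set ℝ, IsCompact C →
      IntegrableOn (GaussianWinding.varKernel (GaussianWinding.covKernel f P)) C volume) ∧
    ∀ T : ℝ, 0 < T →
      MemLp (fun ω => GaussianWinding.winding (fun t => f t ω) T) 2 P ∧
      -- the mean
      ∫ ω, GaussianWinding.winding (fun t => f t ω) T ∂P
        = T * (deriv (GaussianWinding.covKernel f P) 0).im ∧
      -- the variance
      ProbabilityTheory.variance (fun ω => GaussianWinding.winding (fun t => f t ω) T) P
        = T * ∫ x in (-T)..T, (1 - |x| / T) *
            GaussianWinding.varKernel (GaussianWinding.covKernel f P) x := by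
  have := hspec.isProbability
  have h2 := hlog.memLp_two
  have hH := hgauss.isGaussianSpace
  have hmem : ∀ t, f t ∈ Submodule.span ℂ (Set.range f) := fun t =>
    Submodule.subset_span (Set.mem_range_self t)
  have hcov := cov_eq_covKernel hgauss.measurable hstat
  have hcg : ∀ t, IsCG P 1 (f t) := fun t =>
    hH.isCG_of_cov (hmem t) (by rw [hcov, sub_self, hnorm]; simp)
  have hC := ae_contDiff hH hmem hcov hspec hlog hcont
  have hreg := hC.and (ae_forall_ne_zero hcg hC)
  -- The everywhere regular version has the same kernel and almost surely the same paths. It also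
  -- supplies the local integrability of K, whose proof goes through the process.
  obtain ⟨g, hg, hgf⟩ := exists_regularVersion hH hmem hcov hreg
  refine ⟨hreg, hspec.contDiff h2, fun C hc =>
    (hg.locallyIntegrable_varKernel hspec h2 hnondeg).integrableOn_isCompact hc, fun T hT => ?_⟩
  have hw : (fun ω => winding (fun t => f t ω) T) =ᵐ[P] fun ω => winding (fun t => g t ω) T := by
    filter_upwards [hgf] with ω hω
    simp_rw [hω]
  obtain ⟨h3, h4, h5⟩ := hg.winding_moments hspec h2 hnondeg hT
  exact ⟨(memLp_congr_ae hw).2 h3, (integral_congr_ae hw).trans h4,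
    (variance_congr hw).trans h5⟩
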